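/- Let $n\ge 2$ and $N\ge 1$ be integers, let $p_1,p_2,q_1,q_2\in[1,\infty]$ and $s_1,s_2\in\mathbb R$, and put $\sigma=2-\frac{n-1}{2}N$. The spherical average is $A_1f(x)=\int_{\mathbb S^{n-1}}f(x-y')\,d\omega(y')$, where $d\omega(y')$ is the normalized surface measure on the unit sphere of $\mathbb R^n$. It is defined in this way on Schwartz functions and extended to tempered distributions by duality, $\langle A_1f,g\rangle=\langle f,A_1g\rangle$. The operator $\Delta(A_1)^N$ is the Laplacian applied to the $N$-th iterate of $A_1$, acting on $\mathcal S'(\mathbb R^n)$. Let $\varphi\in C_c^\infty(\mathbb R^n)$ be such that $\sum_{k\in\mathbb Z^n}\varphi(\xi-k)=1$ for every $\xi\in\mathbb R^n$, let $\Box_k=\mathcal F^{-1}\varphi(\cdot-k)\mathcal F$ (with $\mathcal Ff(\xi)=\int f(x)e^{-ix\cdot\xi}\,dx$) and $\langle k\rangle=(1+|k|^2)^{1/2}$. The modulation space $M^s_{p,q}(\mathbb R^n)$ is the set of all $f\in\mathcal S'(\mathbb R^n)$ with $$\|f\|_{M^s_{p,q}}=\Big(\sum_{k\in\mathbb Z^n}\langle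 k\rangle^{sq}\|\Box_kf\|_{L^p(\mathbb R^n)}^q\Big)^{1/q}<\infty,$$ with the supremum over $k$ in place of the sum when $q=\infty$. An operator $T$ is bounded from $M^{s_1}_{p_1,q_1}$ to $M^{s_2}_{p_2,q_2}$ if it maps the first space into the second and there is a constant $C$ with $\|Tf\|_{M^{s_2}_{p_2,q_2}}\le C\|f\|_{M^{s_1}_{p_1,q_1}}$ for all $f\in M^{s_1}_{p_1,q_1}$. Then, with $n/\infty=0$ and for every such $\varphi$: (i) If $q_1\le q_2$, then $\Delta(A_1)^N$ is bounded from $M^{s_1}_{p_1,q_1}(\mathbb R^n)$ to $M^{s_2}_{p_2,q_2}(\mathbb R^n)$ if and only if $p_1\le p_2$ and $s_1\ge s_2+\sigma$. (ii) If $q_1>q_2$, then $\Delta(A_1)^N$ is bounded from $M^{s_1}_{p_1,q_1}(\mathbb R^n)$ to $M^{s_2}_{p_2,q_2}(\mathbb R^n)$ if and only if $p_1\le p_2$ and $s_1+\frac n{q_1}>s_2+\sigma+\frac n{q_2}$. -/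

import Mathlib

open MeasureTheory SchwartzMap
open scoped ENNReal NNReal ContDiff FourierTransform Laplacian

noncomputable section

namespace SphericalModulation

/-- Euclidean space `ℝⁿ`. -/
abbrev E (n : ℕ) : Type := EuclideanSpace ℝ (Fin n)

/-! ### The spherical average -/

/-- The normalized surface measure on the unit sphere of `ℝⁿ`. -/
def sphereMeasure (n : ℕ) : Measure (Metric.sphere (0 : E n) 1) :=
  ((volume : Measure (E n)).toSphere Set.univ)⁻¹ • (volume : Measure (E n)).toSphere

instance instIsFiniteMeasureSphereMeasure (n : ℕ) : IsFiniteMeasure (sphereMeasure n) where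
  measure_univ_lt_top := by
    simp only [sphereMeasure, Measure.smul_apply, smul_eq_mul]
    exact (ENNReal.inv_mul_le_one _).trans_lt ENNReal.one_lt_top

theorem sphereMeasure_real_univ_le (n : ℕ) : (sphereMeasure n).real Set.univ ≤ 1 := by
  refine ENNReal.toReal_le_of_le_ofReal zero_le_one ?_
  simp only [sphereMeasure, Measure.smul_apply, smul_eq_mul, ENNReal.ofReal_one]
  exact ENNReal.inv_mul_le_one _

/-- The spherical average `A₁ f (x) = ∫_{S^{n-1}} f (x - y) dσ(y)` of a function. -/
def sphericalAverage {n : ℕ} {F : Type} [NormedAddCommGroup F] [NormedSpace ℝ F]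
    (f : E n → F) (x : E n) : F :=
  ∫ y, f (x - (y : E n)) ∂(sphereMeasure n)

section Schwartz

variable {n : ℕ} {F : Type} [NormedAddCommGroup F] [NormedSpace ℝ F]

theorem integrable_translate (f : 𝓢(E n, F)) (x : E n) :
    Integrable (fun y : Metric.sphere (0 : E n) 1 => f (x - (y : E n))) (sphereMeasure n) := by
  have hc : Continuous (fun y : Metric.sphere (0 : E n) 1 => f (x - (y : E n))) :=
    f.continuous.comp (by fun_prop)
  refine Integrable.of_bound hc.aestronglyMeasurable (SchwartzMap.seminorm ℝ 0 0 f) ?_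
  exact Filter.Eventually.of_forall fun y => norm_le_seminorm ℝ f _

theorem hasFDerivAt_sphericalAverage (f : 𝓢(E n, F)) (x : E n) :
    HasFDerivAt (sphericalAverage f) (sphericalAverage (fderivCLM ℝ (E n) F f) x) x := by
  refine hasFDerivAt_integral_of_dominated_of_fderiv_le (s := Set.univ)
    (F' := fun (z : E n) (y : Metric.sphere (0 : E n) 1) => fderivCLM ℝ (E n) F f (z - (y : E n)))
    (bound := fun _ => SchwartzMap.seminorm ℝ 0 0 (fderivCLM ℝ (E n) F f))
    Filter.univ_mem ?_ (integrable_translate f x)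
    (integrable_translate (fderivCLM ℝ (E n) F f) x).aestronglyMeasurable ?_
    (integrable_const _) ?_
  · exact Filter.Eventually.of_forall fun z => (integrable_translate f z).aestronglyMeasurable
  · exact Filter.Eventually.of_forall fun y z _ => norm_le_seminorm ℝ _ _
  · refine Filter.Eventually.of_forall fun y z _ => ?_
    have h := (f.differentiableAt (x := z - (y : E n))).hasFDerivAt.comp z
      ((hasFDerivAt_id z).sub_const (y : E n))
    simpa [Function.comp_def] using h

theorem fderiv_sphericalAverage (f : 𝓢(E n, F)) :
    fderiv ℝ (sphericalAverage f) = sphericalAverage (fderivCLM ℝ (E n) F f) :=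
  funext fun x => (hasFDerivAt_sphericalAverage f x).fderiv

theorem contDiff_sphericalAverage_nat (m : ℕ) :
    ∀ {F : Type} [NormedAddCommGroup F] [NormedSpace ℝ F] (f : 𝓢(E n, F)),
      ContDiff ℝ m (sphericalAverage f) := by
  induction m with
  | zero =>
    intro F _ _ f
    have hd : Differentiable ℝ (sphericalAverage f) :=
      fun x => (hasFDerivAt_sphericalAverage f x).differentiableAt
    simpa using hd.continuous
  | succ m ih =>
    intro F _ _ f
    have h := ih (fderivCLM ℝ (E n) F f)
    rw [← fderiv_sphericalAverage] at h
    push_cast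
    refine contDiff_succ_iff_fderiv.2 ⟨fun x => (hasFDerivAt_sphericalAverage f x).differentiableAt,
      by simp, h⟩

theorem contDiff_sphericalAverage (f : 𝓢(E n, F)) : ContDiff ℝ ∞ (sphericalAverage f) :=
  contDiff_infty.2 fun m => contDiff_sphericalAverage_nat m f

theorem norm_pow_mul_sphericalAverage_le (k : ℕ) (f : E n → F) (B C : ℝ)
    (hB : ∀ x, ‖f x‖ ≤ B) (hC : ∀ x, ‖x‖ ^ k * ‖f x‖ ≤ C) (x : E n) :
    ‖x‖ ^ k * ‖sphericalAverage f x‖ ≤ 2 ^ k * (C + B) := by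
  have hB0 : 0 ≤ B := (norm_nonneg _).trans (hB 0)
  have hC0 : 0 ≤ C := le_trans (by positivity) (hC 0)
  have hpt : ∀ y : Metric.sphere (0 : E n) 1,
      ‖(‖x‖ ^ k) • f (x - (y : E n))‖ ≤ 2 ^ k * (C + B) := by
    intro y
    have hy : ‖(y : E n)‖ = 1 := by simp
    have h1 : ‖x‖ ≤ ‖x - (y : E n)‖ + 1 := by
      have := norm_add_le (x - (y : E n)) (y : E n)
      rwa [sub_add_cancel, hy] at this
    have h2 : ‖x‖ ^ k ≤ 2 ^ k * (‖x - (y : E n)‖ ^ k + 1) := by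
      calc ‖x‖ ^ k ≤ (‖x - (y : E n)‖ + 1) ^ k := by gcongr
        _ ≤ (2 * max ‖x - (y : E n)‖ 1) ^ k := by
            gcongr
            have := le_max_left ‖x - (y : E n)‖ 1
            have := le_max_right ‖x - (y : E n)‖ 1
            linarith
        _ = 2 ^ k * (max ‖x - (y : E n)‖ 1) ^ k := mul_pow _ _ _
        _ ≤ 2 ^ k * (‖x - (y : E n)‖ ^ k + 1) := by
            gcongr
            rcases max_cases ‖x - (y : E n)‖ 1 with h | h
            · rw [h.1]; linarith
            · rw [h.1, one_pow]
              have : 0 ≤ ‖x - (y : E n)‖ ^ k := by positivity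
              linarith
    rw [norm_smul, norm_pow, norm_norm]
    calc ‖x‖ ^ k * ‖f (x - (y : E n))‖
        ≤ 2 ^ k * (‖x - (y : E n)‖ ^ k + 1) * ‖f (x - (y : E n))‖ := by gcongr
      _ = 2 ^ k * (‖x - (y : E n)‖ ^ k * ‖f (x - (y : E n))‖ + ‖f (x - (y : E n))‖) := by ring
      _ ≤ 2 ^ k * (C + B) := by
            gcongr
            · exact hC _
            · exact hB _
  have hint : ‖∫ y : Metric.sphere (0 : E n) 1, (‖x‖ ^ k) • f (x - (y : E n)) ∂(sphereMeasure n)‖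
      ≤ 2 ^ k * (C + B) * (sphereMeasure n).real Set.univ :=
    norm_integral_le_of_norm_le_const (Filter.Eventually.of_forall hpt)
  rw [integral_smul, norm_smul, norm_pow, norm_norm] at hint
  refine hint.trans ?_
  exact mul_le_of_le_one_right (by positivity) (sphereMeasure_real_univ_le n)

theorem iteratedFDeriv_sphericalAverage_le (k m : ℕ) :
    ∀ {F : Type} [NormedAddCommGroup F] [NormedSpace ℝ F] (f : 𝓢(E n, F)) (x : E n),
      ‖x‖ ^ k * ‖iteratedFDeriv ℝ m (sphericalAverage f) x‖ ≤
        2 ^ k * (SchwartzMap.seminorm ℝ k m f + SchwartzMap.seminorm ℝ 0 m f) := by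
  induction m with
  | zero =>
    intro F _ _ f x
    rw [norm_iteratedFDeriv_zero]
    exact norm_pow_mul_sphericalAverage_le k f _ _ (fun x => norm_le_seminorm ℝ f x)
      (fun x => norm_pow_mul_le_seminorm ℝ f k x) x
  | succ m ih =>
    intro F _ _ f x
    have key : ∀ j, SchwartzMap.seminorm ℝ j m (fderivCLM ℝ (E n) F f) ≤
        SchwartzMap.seminorm ℝ j (m + 1) f := by
      intro j
      refine seminorm_le_bound ℝ j m _ (apply_nonneg _ _) fun x => ?_
      have : (fderivCLM ℝ (E n) F f : E n → _) = fderiv ℝ f := rfl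
      rw [this, norm_iteratedFDeriv_fderiv]
      exact le_seminorm ℝ j (m + 1) f x
    have h := ih (fderivCLM ℝ (E n) F f) x
    rw [← fderiv_sphericalAverage, norm_iteratedFDeriv_fderiv] at h
    refine h.trans ?_
    gcongr <;> exact key _

/-- The spherical average as a continuous linear operator on Schwartz functions. -/
def sphericalAverageSchwartz (n : ℕ) : 𝓢(E n, ℂ) →L[ℂ] 𝓢(E n, ℂ) :=
  SchwartzMap.mkCLM (fun f => sphericalAverage f)
    (fun f g x => by
      simp only [sphericalAverage, add_apply]
      exact integral_add (integrable_translate f x) (integrable_translate g x))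
    (fun a f x => by
      simp only [sphericalAverage, smul_apply, RingHom.id_apply]
      exact integral_smul a _)
    contDiff_sphericalAverage
    (fun ⟨k, m⟩ => by
      refine ⟨{(k, m), (0, m)}, 2 ^ k * 2, by positivity, fun f x => ?_⟩
      refine (iteratedFDeriv_sphericalAverage_le k m f x).trans ?_
      have h1 : SchwartzMap.seminorm ℂ k m f ≤
          (({(k, m), (0, m)} : Finset (ℕ × ℕ)).sup (schwartzSeminormFamily ℂ (E n) ℂ)) f :=
        Seminorm.le_def.1 (Finset.le_sup (f := schwartzSeminormFamily ℂ (E n) ℂ)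
          (b := (k, m)) (by simp)) f
      have h2 : SchwartzMap.seminorm ℂ 0 m f ≤
          (({(k, m), (0, m)} : Finset (ℕ × ℕ)).sup (schwartzSeminormFamily ℂ (E n) ℂ)) f :=
        Seminorm.le_def.1 (Finset.le_sup (f := schwartzSeminormFamily ℂ (E n) ℂ)
          (b := (0, m)) (by simp)) f
      have e : ∀ j, SchwartzMap.seminorm ℝ j m f = SchwartzMap.seminorm ℂ j m f := fun j => rfl
      rw [e, e, mul_assoc]
      gcongr
      linarith)

theorem sphericalAverageSchwartz_apply (f : 𝓢(E n, ℂ)) (x : E n) :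
    sphericalAverageSchwartz n f x = ∫ y, f (x - (y : E n)) ∂(sphereMeasure n) := rfl

end Schwartz

/-- The spherical average `A₁` on tempered distributions, by duality. The surface measure is
invariant under `y ↦ -y`, so `A₁` is its own transpose: `⟨A₁ f, g⟩ = ⟨f, A₁ g⟩`. -/
def sphericalAverageDistribution (n : ℕ) : 𝓢'(E n, ℂ) →L[ℂ] 𝓢'(E n, ℂ) :=
  PointwiseConvergenceCLM.precomp _ (sphericalAverageSchwartz n)

/-- The operator `Δ (A₁)^N` on tempered distributions. -/
def laplacianIteratedAverage (n N : ℕ) (f : 𝓢'(E n, ℂ)) : 𝓢'(E n, ℂ) :=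
  Δ ((sphericalAverageDistribution n)^[N] f)

/-! ### Modulation spaces -/

/-- An integer vector, viewed in `ℝⁿ`. -/
def latticePoint {n : ℕ} (k : Fin n → ℤ) : E n := WithLp.toLp 2 fun i => (k i : ℝ)

/-- `φ` is smooth with compact support and its integer translates form a partition of unity. -/
structure IsPartitionWindow {n : ℕ} (φ : E n → ℂ) : Prop where
  smooth : ContDiff ℝ ∞ φ
  compactSupport : HasCompactSupport φ
  partition : ∀ ξ : E n, HasSum (fun k : Fin n → ℤ => φ (ξ - latticePoint k)) 1

/-- The frequency-uniform decomposition operator `□_k = 𝓕⁻¹ φ(· - k) 𝓕`, where `𝓕` is taken with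
the kernel `e^{-i x·ξ}`. Mathlib's Fourier transform has the kernel `e^{-2πi x·ξ}`, which turns the
symbol `φ(ξ - k)` into `φ(2πξ - k)`. -/
def box {n : ℕ} (φ : E n → ℂ) (k : Fin n → ℤ) : 𝓢'(E n, ℂ) →L[ℂ] 𝓢'(E n, ℂ) :=
  TemperedDistribution.fourierMultiplierCLM ℂ
    fun ξ : E n => φ ((2 * Real.pi) • ξ - latticePoint k)

/-- The `L^p` norm, `1 ≤ p ≤ ∞`, of a tempered distribution: it is `‖g‖_p` if the distribution is
given by a (necessarily a.e. unique) function `g ∈ L^p`, and `∞` if there is no such `g`. -/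
def distLpNorm {n : ℕ} (p : ℝ≥0∞) (u : 𝓢'(E n, ℂ)) : ℝ≥0∞ :=
  ⨅ (g : E n → ℂ) (_ : MemLp g p volume) (_ : ∀ ψ : 𝓢(E n, ℂ), u ψ = ∫ x, g x * ψ x),
    eLpNorm g p volume

/-- The Japanese bracket `⟨k⟩ = (1 + |k|²)^{1/2}`. -/
def bracket {n : ℕ} (k : Fin n → ℤ) : ℝ := √(1 + ‖latticePoint k‖ ^ 2)

/-- The norm of the modulation space `M^s_{p,q}(ℝⁿ)`, with values in `[0, ∞]`. -/
def modulationNorm {n : ℕ} (φ : E n → ℂ) (s : ℝ) (p q : ℝ≥0∞) (f : 𝓢'(E n, ℂ)) : ℝ≥0∞ :=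
  if q = ⊤ then
    ⨆ k : Fin n → ℤ, ENNReal.ofReal (bracket k ^ s) * distLpNorm p (box φ k f)
  else
    (∑' k : Fin n → ℤ,
      (ENNReal.ofReal (bracket k ^ s) * distLpNorm p (box φ k f)) ^ q.toReal) ^ (1 / q.toReal)

/-- The modulation space `M^s_{p,q}(ℝⁿ)`. -/
def modulationSpace {n : ℕ} (φ : E n → ℂ) (s : ℝ) (p q : ℝ≥0∞) : Set 𝓢'(E n, ℂ) :=
  {f | modulationNorm φ s p q f < ⊤}

/-- `T` maps `M^{s₁}_{p₁,q₁}` boundedly into `M^{s₂}_{p₂,q₂}`. -/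
def IsBoundedOnModulation {n : ℕ} (φ : E n → ℂ) (s₁ : ℝ) (p₁ q₁ : ℝ≥0∞) (s₂ : ℝ) (p₂ q₂ : ℝ≥0∞)
    (T : 𝓢'(E n, ℂ) → 𝓢'(E n, ℂ)) : Prop :=
  ∃ C : ℝ≥0, ∀ f ∈ modulationSpace φ s₁ p₁ q₁,
    T f ∈ modulationSpace φ s₂ p₂ q₂ ∧
      modulationNorm φ s₂ p₂ q₂ (T f) ≤ C * modulationNorm φ s₁ p₁ q₁ f

end SphericalModulation

end

open MeasureTheory SchwartzMap
open scoped ENNReal NNReal ContDiff FourierTransform Laplacian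

noncomputable section

namespace SphericalModulation

/-! ### Rotation invariance of the surface measure -/

/-! `Δ (A₁)^N` is the Fourier multiplier with symbol M(η) = -|η|² m(η)^N, where m is the Fourier
transform of the sphere measure. Two facts about M carry the theorem: all its derivatives are
O(⟨η⟩^σ) (`isSymbol_averageSymbol`), and within distance 1 of every κ with |κ| ≥ 1 there is a point
where |M| ≥ c⟨κ⟩^σ (`exists_averageSymbol_ge`).

Both rest on the radial profile g of m, which solves g'' + (n-1)g'/r + g = 0. For u = r^{(n-1)/2} g
the energy u'² + u² has derivative O(energy/r²), so on [1,∞) it stays between two positive constants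
(`exists_radialEnergy_bounds`). The upper constant gives the decay of m. The lower one, with the
mean value theorem, gives in every interval [r, r+1] a radius where |u| is bounded below
(`exists_radial_lower_bound`). No Bessel asymptotics are needed. The derivatives of m obey the same
decay because the measure lives in the unit ball: m reproduces itself under convolution with a
Schwartz function Ψ (`exists_sphereSymbol_eq_mollify`), and derivatives can be put on Ψ.

Sufficiency. On the k-th frequency cell the operator is convolution with a rapidly decaying kernel
of size ⟨k⟩^σ, so it maps L^{p₁} to L^{p₂} for p₁ ≤ p₂ with norm O(⟨k⟩^σ), up to finitely many
neighbouring cells (`exists_distLpNorm_box_laplacianIteratedAverage_le`). What remains is an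
embedding of weighted ℓ^q spaces: monotonicity in q if q₁ ≤ q₂, Hölder's inequality if q₁ > q₂.

Necessity. Place wave packets with amplitudes a_k, over a sparse finite set of k, at frequencies
near k where |M| is large. Testing the image against each packet recovers a_k ⟨k⟩^σ up to constants,
so boundedness implies the sequence inequality `IsBoundedOnModulation.exists_ellNorm_le`, whose
constant depends explicitly on the packet shape. Dilating the shape forces p₁ ≤ p₂, a single packet
sent to infinity forces s₁ ≥ s₂ + σ, and extremal sequences for Hölder's inequality force the strict
condition when q₁ > q₂. -/

/-- A linear isometry of `ℝⁿ`, restricted to the unit sphere. -/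
def sphereIsometry {n : ℕ} (U : E n ≃ₗᵢ[ℝ] E n) (y : Metric.sphere (0 : E n) 1) :
    Metric.sphere (0 : E n) 1 :=
  ⟨U y, by simp⟩

theorem continuous_sphereIsometry {n : ℕ} (U : E n ≃ₗᵢ[ℝ] E n) :
    Continuous (sphereIsometry U) :=
  Continuous.subtype_mk (U.continuous.comp continuous_subtype_val) _

-- The surface measure of s is, up to a constant, the volume of the cone over s. Isometries carry
-- cones to cones and preserve volume.
open scoped Pointwise in
theorem measurePreserving_sphereIsometry {n : ℕ} (U : E n ≃ₗᵢ[ℝ] E n) :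
    MeasurePreserving (sphereIsometry U) (sphereMeasure n) (sphereMeasure n) := by
  have hm : Measurable (sphereIsometry U) := (continuous_sphereIsometry U).measurable
  refine ⟨hm, ?_⟩
  rw [sphereMeasure, Measure.map_smul]
  congr 1
  ext s hs
  rw [Measure.map_apply hm hs, Measure.toSphere_apply' _ hs, Measure.toSphere_apply' _ (hm hs)]
  congr 1
  have hset : Set.Ioo (0 : ℝ) 1 • ((↑) '' (sphereIsometry U ⁻¹' s) : Set (E n)) =
      U ⁻¹' (Set.Ioo (0 : ℝ) 1 • ((↑) '' s : Set (E n))) := by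
    ext x
    simp only [Set.mem_smul, Set.mem_image, Set.mem_preimage]
    constructor
    · rintro ⟨r, hr, _, ⟨y, hy, rfl⟩, rfl⟩
      exact ⟨r, hr, _, ⟨_, hy, rfl⟩, by simp [sphereIsometry]⟩
    · rintro ⟨r, hr, _, ⟨y, hy, rfl⟩, hx⟩
      refine ⟨r, hr, U.symm y, ⟨⟨U.symm y, by simp⟩, ?_, rfl⟩, ?_⟩
      · convert hy
        exact Subtype.ext (U.apply_symm_apply _)
      · rw [← U.symm.map_smul, hx, U.symm_apply_apply]
  rw [hset]
  exact U.measurePreserving.measure_preimage_equiv (f := U.toMeasurableEquiv) _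

theorem integral_sphere_comp_isometry {n : ℕ} {F : Type*} [NormedAddCommGroup F] [NormedSpace ℝ F]
    (U : E n ≃ₗᵢ[ℝ] E n) {f : E n → F} (hf : Continuous f) :
    ∫ y, f (U (y : E n)) ∂sphereMeasure n = ∫ y, f (y : E n) ∂sphereMeasure n := by
  conv_rhs => rw [← (measurePreserving_sphereIsometry U).map_eq]
  exact (integral_map (f := fun y : Metric.sphere (0 : E n) 1 => f y)
    (continuous_sphereIsometry U).measurable.aemeasurable
    (hf.comp continuous_subtype_val).aestronglyMeasurable).symm

theorem isProbabilityMeasure_sphereMeasure {n : ℕ} (hn : 1 ≤ n) :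
    IsProbabilityMeasure (sphereMeasure n) := by
  have : Nonempty (Fin n) := ⟨⟨0, hn⟩⟩
  constructor
  simp only [sphereMeasure, Measure.smul_apply, smul_eq_mul]
  refine ENNReal.inv_mul_cancel ?_ (measure_ne_top _ _)
  rw [Ne, Measure.measure_univ_eq_zero]
  exact Measure.toSphere_ne_zero _

/-! ### The symbol of the spherical average -/

/-- The Fourier transform `ξ ↦ ∫_{S^{n-1}} cos ⟨y, ξ⟩ dω(y)` of the surface measure. -/
def sphereSymbol (n : ℕ) (ξ : E n) : ℝ :=
  ∫ y, Real.cos (inner ℝ (y : E n) ξ) ∂sphereMeasure n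

theorem integrable_sphere {n : ℕ} {F : Type*} [NormedAddCommGroup F]
    {f : Metric.sphere (0 : E n) 1 → F} (hf : Continuous f) : Integrable f (sphereMeasure n) := by
  obtain ⟨C, hC⟩ := (isCompact_range hf.norm).bddAbove
  exact Integrable.of_bound hf.aestronglyMeasurable C
    (Filter.Eventually.of_forall fun y => hC ⟨y, rfl⟩)

/-- The reflection in the hyperplane orthogonal to ξ - ζ takes ξ to ζ when the norms agree, and it
preserves the surface measure. -/
theorem sphereSymbol_eq_of_norm_eq {n : ℕ} {ξ ζ : E n} (h : ‖ξ‖ = ‖ζ‖) :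
    sphereSymbol n ξ = sphereSymbol n ζ := by
  have hU := Submodule.reflection_sub h
  set U := (Submodule.span ℝ {ξ - ζ})ᗮ.reflection with hUdef
  rw [sphereSymbol, sphereSymbol, ← integral_sphere_comp_isometry U
    (f := fun y => Real.cos (inner ℝ y ζ)) (by fun_prop)]
  refine integral_congr_ae (Filter.Eventually.of_forall fun y => ?_)
  simp only
  rw [← hU, U.inner_map_map]

/-- The antipodal map preserves the measure and the integrand is odd. This is what makes the symbol
of the average real. -/
theorem integral_sin_inner_sphere {n : ℕ} (ξ : E n) :
    ∫ y, Real.sin (inner ℝ (y : E n) ξ) ∂sphereMeasure n = 0 := by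
  have h := integral_sphere_comp_isometry (LinearIsometryEquiv.neg ℝ (E := E n))
    (f := fun y => Real.sin (inner ℝ y ξ)) (by fun_prop)
  simp only [LinearIsometryEquiv.coe_neg, inner_neg_left, Real.sin_neg, integral_neg] at h
  linarith

theorem integral_cexp_inner_sphere {n : ℕ} (ξ : E n) :
    ∫ y, Complex.exp (((-inner ℝ (y : E n) ξ : ℝ) : ℂ) * Complex.I) ∂sphereMeasure n =
      (sphereSymbol n ξ : ℂ) := by
  have hc : ∀ y : Metric.sphere (0 : E n) 1,
      Complex.exp (((-inner ℝ (y : E n) ξ : ℝ) : ℂ) * Complex.I) =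
      ((Real.cos (inner ℝ (y : E n) ξ) : ℝ) : ℂ) -
        ((Real.sin (inner ℝ (y : E n) ξ) : ℝ) : ℂ) * Complex.I := by
    intro y
    rw [Complex.exp_mul_I]
    push_cast
    simp [sub_eq_add_neg]
  simp_rw [hc]
  rw [integral_sub, integral_mul_const, integral_complex_ofReal, integral_complex_ofReal,
    integral_sin_inner_sphere]
  · simp [sphereSymbol]
  · exact integrable_sphere (by fun_prop)
  · exact integrable_sphere (by fun_prop)

theorem abs_sphereSymbol_le (n : ℕ) (ξ : E n) : |sphereSymbol n ξ| ≤ 1 := by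
  have h := norm_integral_le_of_norm_le_const (μ := sphereMeasure n) (C := 1)
    (f := fun y : Metric.sphere (0 : E n) 1 => Real.cos (inner ℝ (y : E n) ξ))
    (Filter.Eventually.of_forall fun y => Real.abs_cos_le_one _)
  rw [one_mul] at h
  exact h.trans (sphereMeasure_real_univ_le n)

theorem continuous_sphereSymbol (n : ℕ) : Continuous (sphereSymbol n) := by
  refine continuous_of_dominated (bound := fun _ => 1) ?_ ?_ (integrable_const _) ?_
  · intro ξ
    exact (by fun_prop : Continuous fun y : Metric.sphere (0 : E n) 1 =>
      Real.cos (inner ℝ (y : E n) ξ)).aestronglyMeasurable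
  · exact fun ξ => Filter.Eventually.of_forall fun y => Real.abs_cos_le_one _
  · exact Filter.Eventually.of_forall fun y => by fun_prop

/-! ### The radial equation -/

theorem hasDerivAt_integral_sphere {n : ℕ} {f f' : ℝ → Metric.sphere (0 : E n) 1 → ℝ} (C : ℝ)
    (hf : ∀ t, Continuous (f t)) (hf' : ∀ t, Continuous (f' t)) (hC : ∀ t y, |f' t y| ≤ C)
    (hd : ∀ t y, HasDerivAt (fun s => f s y) (f' t y) t) (t : ℝ) :
    HasDerivAt (fun s => ∫ y, f s y ∂sphereMeasure n) (∫ y, f' t y ∂sphereMeasure n) t :=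
  (hasDerivAt_integral_of_dominated_loc_of_deriv_le (s := Set.univ) (bound := fun _ => C)
    Filter.univ_mem
    (Filter.Eventually.of_forall fun s => (hf s).aestronglyMeasurable) (integrable_sphere (hf t))
    (hf' t).aestronglyMeasurable (Filter.Eventually.of_forall fun y s _ => hC s y)
    (integrable_const _) (Filter.Eventually.of_forall fun y s _ => hd s y)).2

theorem abs_inner_sphere_le {n : ℕ} (y : Metric.sphere (0 : E n) 1) {e : E n} (he : ‖e‖ = 1) :
    |inner ℝ (y : E n) e| ≤ 1 := by
  have := abs_real_inner_le_norm (y : E n) e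
  simpa [he] using this

/-- Rotate e towards v: since m is radial, t ↦ m(r(cos t · e + sin t · v)) is constant, and the
vanishing of its second derivative at t = 0 is the identity. Here θ is the phase ⟨y, r(cos t · e +
sin t · v)⟩, so that θ'' = -θ. -/
theorem integral_sphere_inner_sq_mul_cos {n : ℕ} {e v : E n} (he : ‖e‖ = 1) (hv : ‖v‖ = 1)
    (hev : inner ℝ e v = 0) (r : ℝ) :
    r ^ 2 * ∫ y, inner ℝ (y : E n) v ^ 2 * Real.cos (r * inner ℝ (y : E n) e) ∂sphereMeasure n =
      r * ∫ y, inner ℝ (y : E n) e * Real.sin (r * inner ℝ (y : E n) e) ∂sphereMeasure n := by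
  set θ : ℝ → Metric.sphere (0 : E n) 1 → ℝ := fun t y =>
    r * (Real.cos t * inner ℝ (y : E n) e + Real.sin t * inner ℝ (y : E n) v) with hθ
  set θ' : ℝ → Metric.sphere (0 : E n) 1 → ℝ := fun t y =>
    r * (-Real.sin t * inner ℝ (y : E n) e + Real.cos t * inner ℝ (y : E n) v) with hθ'
  have dθ : ∀ t y, HasDerivAt (fun s => θ s y) (θ' t y) t := fun t y =>
    (((Real.hasDerivAt_cos t).mul_const _).add ((Real.hasDerivAt_sin t).mul_const _)).const_mul r
  have dθ' : ∀ t y, HasDerivAt (fun s => θ' s y) (-θ t y) t := fun t y => by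
    have := ((((Real.hasDerivAt_sin t).neg.mul_const (inner ℝ (y : E n) e)).add
      ((Real.hasDerivAt_cos t).mul_const (inner ℝ (y : E n) v))).const_mul r)
    exact this.congr_deriv (by simp only [hθ]; ring)
  have bd : ∀ a b A B : ℝ, |a| ≤ 1 → |b| ≤ 1 → |A| ≤ 1 → |B| ≤ 1 →
      |r * (a * A + b * B)| ≤ 2 * |r| := by
    intro a b A B ha hb hA hB
    rw [abs_mul, mul_comm]
    have h1 : |a * A| ≤ 1 := by rw [abs_mul]; exact mul_le_one₀ ha (abs_nonneg _) hA
    have h2 : |b * B| ≤ 1 := by rw [abs_mul]; exact mul_le_one₀ hb (abs_nonneg _) hB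
    have := abs_add_le (a * A) (b * B)
    gcongr
    linarith
  have bθ : ∀ t y, |θ t y| ≤ 2 * |r| := fun t y =>
    bd _ _ _ _ (Real.abs_cos_le_one t) (Real.abs_sin_le_one t) (abs_inner_sphere_le y he)
      (abs_inner_sphere_le y hv)
  have bθ' : ∀ t y, |θ' t y| ≤ 2 * |r| := fun t y =>
    bd _ _ _ _ (by rw [abs_neg]; exact Real.abs_sin_le_one t) (Real.abs_cos_le_one t)
      (abs_inner_sphere_le y he) (abs_inner_sphere_le y hv)
  have cθ : ∀ t, Continuous (θ t) := fun t => by simp only [hθ]; fun_prop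
  have cθ' : ∀ t, Continuous (θ' t) := fun t => by simp only [hθ']; fun_prop
  have d1 : ∀ t, HasDerivAt (fun s => ∫ y, Real.cos (θ s y) ∂sphereMeasure n)
      (∫ y, -Real.sin (θ t y) * θ' t y ∂sphereMeasure n) t := by
    refine hasDerivAt_integral_sphere (2 * |r|) (fun t => by fun_prop) (fun t => by fun_prop)
      (fun t y => ?_) (fun t y => (dθ t y).cos)
    rw [abs_mul, abs_neg]
    calc _ ≤ 1 * (2 * |r|) := by
          gcongr
          · exact Real.abs_sin_le_one _
          · exact bθ' t y
      _ = _ := one_mul _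
  have d2 : HasDerivAt (fun s => ∫ y, -Real.sin (θ s y) * θ' s y ∂sphereMeasure n)
      (∫ y, (-(Real.cos (θ 0 y) * θ' 0 y) * θ' 0 y + -Real.sin (θ 0 y) * -θ 0 y)
        ∂sphereMeasure n) 0 := by
    refine hasDerivAt_integral_sphere
      (f' := fun t y => -(Real.cos (θ t y) * θ' t y) * θ' t y + -Real.sin (θ t y) * -θ t y)
      (2 * |r| * (2 * |r|) + 2 * |r|) (fun t => by fun_prop)
      (fun t => by fun_prop) (fun t y => ?_) (fun t y => ((dθ t y).sin.neg).mul (dθ' t y)) 0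
    refine (abs_add_le _ _).trans (add_le_add ?_ ?_)
    · rw [abs_mul, abs_neg, abs_mul]
      calc _ ≤ 1 * (2 * |r|) * (2 * |r|) := by
            gcongr
            · exact Real.abs_cos_le_one _
            · exact bθ' t y
            · exact bθ' t y
        _ = _ := by ring
    · rw [abs_mul, abs_neg, abs_neg]
      calc _ ≤ 1 * (2 * |r|) := by
            gcongr
            · exact Real.abs_sin_le_one _
            · exact bθ t y
        _ = _ := one_mul _
  have hconst : ∀ s, ∫ y, Real.cos (θ s y) ∂sphereMeasure n = sphereSymbol n (r • e) := by
    intro s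
    have : sphereSymbol n (r • (Real.cos s • e + Real.sin s • v)) = sphereSymbol n (r • e) := by
      apply sphereSymbol_eq_of_norm_eq
      rw [norm_smul, norm_smul, he]
      congr 1
      rw [← sq_eq_sq₀ (norm_nonneg _) zero_le_one, norm_add_sq_real, norm_smul, norm_smul, he, hv,
        inner_smul_left, inner_smul_right, hev]
      simp
    rw [← this, sphereSymbol]
    simp only [hθ, inner_smul_right, inner_add_right]
  have hz : ∀ t, ∫ y, -Real.sin (θ t y) * θ' t y ∂sphereMeasure n = 0 := by
    intro t
    have := d1 t
    simp_rw [hconst] at this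
    exact this.unique (hasDerivAt_const t _)
  simp_rw [hz] at d2
  have h0 := d2.unique (hasDerivAt_const 0 _)
  simp only [hθ, hθ', Real.cos_zero, Real.sin_zero, one_mul, zero_mul, neg_zero, add_zero,
    zero_add] at h0
  rw [← integral_const_mul, ← integral_const_mul, ← sub_eq_zero, ← integral_sub, ← neg_eq_zero,
    ← integral_neg, ← h0]
  · refine integral_congr_ae (Filter.Eventually.of_forall fun y => ?_)
    simp only
    ring
  · exact integrable_sphere (by fun_prop)
  · exact integrable_sphere (by fun_prop)

/-! ### Energy estimates for the radial equation -/

section Energy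

variable {g g₁ g₂ : ℝ → ℝ} {d : ℕ}

/-- The energy `r^d (w² + g²)`, `w = g' + d g / (2 r)`, of a solution of `g'' + d g' / r + g = 0`. -/
def radialEnergy (d : ℕ) (g g₁ : ℝ → ℝ) (r : ℝ) : ℝ :=
  r ^ d * ((g₁ r + d / 2 * g r / r) ^ 2 + g r ^ 2)

theorem radialEnergy_nonneg {r : ℝ} (hr : 0 < r) : 0 ≤ radialEnergy d g g₁ r := by
  unfold radialEnergy; positivity

/-- With u = r^{d/2} g the equation becomes u'' = -u + c u/r², c = (d/2)² - d/2, and the energy is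
u'² + u². Only the term 2c u u'/r² survives differentiation. -/
theorem hasDerivAt_radialEnergy (hg : ∀ r, HasDerivAt g (g₁ r) r)
    (hg₁ : ∀ r, HasDerivAt g₁ (g₂ r) r) (hode : ∀ r, 0 < r → r * g₂ r + d * g₁ r + r * g r = 0)
    {r : ℝ} (hr : 0 < r) :
    HasDerivAt (radialEnergy d g g₁)
      (r ^ d * (2 * ((d / 2 : ℝ) ^ 2 - d / 2) * (g₁ r + d / 2 * g r / r) * g r / r ^ 2)) r := by
  have h := ((hasDerivAt_id r).pow d).mul
    ((((hg₁ r).add (((hg r).const_mul (d / 2 : ℝ)).div (hasDerivAt_id r) hr.ne')).pow 2).add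
      ((hg r).pow 2))
  refine h.congr_deriv ?_
  have e2 : g₂ r = -(d * g₁ r / r) - g r := by
    have := hode r hr
    field_simp
    linarith
  -- At d = 0 the exponent d - 1 is truncated, but the factor d makes both sides vanish.
  have e3 : (d : ℝ) * r ^ (d - 1) = d * r ^ d / r := by
    rcases d with _ | d
    · simp
    · rw [Nat.add_sub_cancel, pow_succ]
      field_simp
  simp only [Pi.pow_apply, id, mul_one, e3, e2, Pi.add_apply, Pi.div_apply,
    show (2 - 1 : ℕ) = 1 from rfl, pow_one, Nat.cast_ofNat]
  field_simp
  ring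

theorem abs_two_mul_mul_le (c w x : ℝ) : |2 * c * w * x| ≤ |c| * (w ^ 2 + x ^ 2) := by
  have : 2 * |w * x| ≤ w ^ 2 + x ^ 2 := by
    rw [abs_mul]
    nlinarith [sq_nonneg (|w| - |x|), sq_abs w, sq_abs x]
  calc |2 * c * w * x| = |c| * (2 * |w * x|) := by
        rw [show 2 * c * w * x = 2 * (c * (w * x)) by ring, abs_mul, abs_mul]
        simp; ring
    _ ≤ _ := by gcongr

/-- From |e'| ≤ |c| e/r² it follows that e · exp(|c|/r) decreases and e · exp(-|c|/r) increases. As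
1/r² is integrable at infinity, the two exponentials stay bounded on [1,∞) and pin e between
multiples of e(1). -/
theorem exists_radialEnergy_bounds (hg : ∀ r, HasDerivAt g (g₁ r) r)
    (hg₁ : ∀ r, HasDerivAt g₁ (g₂ r) r) (hode : ∀ r, 0 < r → r * g₂ r + d * g₁ r + r * g r = 0)
    (h0 : g 0 ≠ 0) :
    ∃ a A : ℝ, 0 < a ∧ 0 < A ∧
      ∀ r, 1 ≤ r → a ≤ radialEnergy d g g₁ r ∧ radialEnergy d g g₁ r ≤ A := by
  set c : ℝ := (d / 2 : ℝ) ^ 2 - d / 2 with hc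
  set e : ℝ → ℝ := radialEnergy d g g₁ with he
  set e' : ℝ → ℝ := fun r => r ^ d * (2 * c * (g₁ r + d / 2 * g r / r) * g r / r ^ 2) with he'
  have hd : ∀ r, 0 < r → HasDerivAt e (e' r) r := fun r hr => hasDerivAt_radialEnergy hg hg₁ hode hr
  have hb : ∀ r, 0 < r → |e' r| ≤ |c| * e r / r ^ 2 := by
    intro r hr
    have h1 := abs_two_mul_mul_le c (g₁ r + d / 2 * g r / r) (g r)
    have hp : 0 < r ^ d := by positivity
    have hp2 : 0 < r ^ 2 := by positivity
    simp only [he', he, radialEnergy]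
    rw [abs_mul, abs_of_pos hp, abs_div, abs_of_pos hp2]
    calc _ ≤ r ^ d * (|c| * ((g₁ r + d / 2 * g r / r) ^ 2 + g r ^ 2) / r ^ 2) := by gcongr
      _ = _ := by ring
  have dexp : ∀ (κ r : ℝ), 0 < r →
      HasDerivAt (fun s => Real.exp (κ / s)) (Real.exp (κ / r) * (-κ / r ^ 2)) r := by
    intro κ r hr
    have := ((hasDerivAt_const r κ).div (hasDerivAt_id r) hr.ne').exp
    refine this.congr_deriv ?_
    simp
  have dprod : ∀ (κ r : ℝ), 0 < r → HasDerivAt (fun s => e s * Real.exp (κ / s))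
      (Real.exp (κ / r) * (e' r - κ * e r / r ^ 2)) r := by
    intro κ r hr
    refine ((hd r hr).mul (dexp κ r hr)).congr_deriv ?_
    ring
  have hcont : ∀ κ, ContinuousOn (fun s => e s * Real.exp (κ / s)) (Set.Ioi 0) := fun κ r hr =>
    (dprod κ r hr).continuousAt.continuousWithinAt
  have hanti : AntitoneOn (fun s => e s * Real.exp (|c| / s)) (Set.Ioi 0) := by
    refine antitoneOn_of_deriv_nonpos (convex_Ioi 0) (hcont _) ?_ ?_
    · rw [interior_Ioi]
      exact fun r hr => (dprod _ r hr).differentiableAt.differentiableWithinAt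
    · rw [interior_Ioi]
      intro r hr
      rw [(dprod _ r hr).deriv]
      have := (abs_le.1 (hb r hr)).2
      exact mul_nonpos_of_nonneg_of_nonpos (Real.exp_nonneg _) (by linarith)
  have hmono : MonotoneOn (fun s => e s * Real.exp (-|c| / s)) (Set.Ioi 0) := by
    refine monotoneOn_of_deriv_nonneg (convex_Ioi 0) (hcont _) ?_ ?_
    · rw [interior_Ioi]
      exact fun r hr => (dprod _ r hr).differentiableAt.differentiableWithinAt
    · rw [interior_Ioi]
      intro r hr
      rw [(dprod _ r hr).deriv]
      have := (abs_le.1 (hb r hr)).1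
      refine mul_nonneg (Real.exp_nonneg _) ?_
      have h2 : -|c| * e r / r ^ 2 = -(|c| * e r / r ^ 2) := by ring
      rw [h2]; linarith
  -- If e(1) = 0, the increasing quantity is at most 0 on (0,1]. Then g vanishes there, and by
  -- continuity g(0) = 0.
  have e1 : 0 < e 1 := by
    rcases (radialEnergy_nonneg (d := d) (g := g) (g₁ := g₁) one_pos).lt_or_eq with h | h
    · exact h
    exfalso
    have hz : ∀ r ∈ Set.Ioc (0 : ℝ) 1, g r = 0 := by
      intro r hr
      have h1 := hmono (Set.mem_Ioi.2 hr.1) (Set.mem_Ioi.2 one_pos) hr.2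
      simp only [he, ← h, zero_mul] at h1
      have h2 : radialEnergy d g g₁ r ≤ 0 := by
        by_contra hcon
        push Not at hcon
        exact absurd h1 (not_le.2 (mul_pos hcon (Real.exp_pos _)))
      have hp : 0 < r ^ d := pow_pos hr.1 d
      have h3 : (g₁ r + d / 2 * g r / r) ^ 2 + g r ^ 2 ≤ 0 := by
        unfold radialEnergy at h2
        by_contra hcon
        push Not at hcon
        exact absurd h2 (not_le.2 (mul_pos hp hcon))
      have h4 : g r ^ 2 = 0 := le_antisymm (by nlinarith [sq_nonneg (g₁ r + d / 2 * g r / r)])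
        (sq_nonneg _)
      exact pow_eq_zero_iff (two_ne_zero) |>.1 h4
    have ht : Filter.Tendsto g (nhdsWithin 0 (Set.Ioi 0)) (nhds (g 0)) :=
      (hg 0).continuousAt.continuousWithinAt
    have ht' : Filter.Tendsto g (nhdsWithin 0 (Set.Ioi 0)) (nhds 0) := by
      refine tendsto_const_nhds.congr' ?_
      filter_upwards [Ioc_mem_nhdsGT one_pos] with r hr
      exact (hz r hr).symm
    exact h0 (tendsto_nhds_unique ht ht')
  refine ⟨e 1 * Real.exp (-|c|), e 1 * Real.exp |c|, by positivity, by positivity,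
    fun r hr => ?_⟩
  have hr0 : 0 < r := by linarith
  have her : 0 ≤ e r := radialEnergy_nonneg hr0
  constructor
  · have := hmono (Set.mem_Ioi.2 one_pos) (Set.mem_Ioi.2 hr0) hr
    simp only [div_one] at this
    refine this.trans (mul_le_of_le_one_right her (Real.exp_le_one_iff.2 ?_))
    rw [neg_div]
    have : 0 ≤ |c| / r := by positivity
    linarith
  · have := hanti (Set.mem_Ioi.2 one_pos) (Set.mem_Ioi.2 hr0) hr
    simp only [div_one] at this
    refine le_trans (le_mul_of_one_le_right her (Real.one_le_exp_iff.2 ?_)) this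
    positivity

/-- Suppose |u| < ε on [r, r+1] for u = t^{d/2} g. The mean value theorem gives a t with |u'(t)| <
2ε, so the energy at t is below 4ε² + ε² = 5ε². This contradicts the lower bound a once ε² = a/5. -/
theorem exists_radial_lower_bound (hg : ∀ r, HasDerivAt g (g₁ r) r) {a : ℝ} (ha : 0 < a)
    (hE : ∀ r, 1 ≤ r → a ≤ radialEnergy d g g₁ r) :
    ∃ ε : ℝ, 0 < ε ∧ ∀ r, 1 ≤ r → ∃ t ∈ Set.Icc r (r + 1), ε ≤ t ^ ((d : ℝ) / 2) * |g t| := by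
  set b : ℝ := (d : ℝ) / 2 with hb
  set ε : ℝ := √(a / 5) with hε
  have hε0 : 0 < ε := Real.sqrt_pos.2 (by positivity)
  have hε2 : ε ^ 2 = a / 5 := Real.sq_sqrt (by positivity)
  refine ⟨ε, hε0, fun r hr => ?_⟩
  by_contra hcon
  push Not at hcon
  have hu : ∀ t, 1 ≤ t → HasDerivAt (fun s => s ^ b * g s) (t ^ b * (g₁ t + b * g t / t)) t := by
    intro t ht
    have h0 : 0 < t := by linarith
    refine ((Real.hasDerivAt_rpow_const (Or.inl h0.ne')).mul (hg t)).congr_deriv ?_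
    rw [Real.rpow_sub_one h0.ne']
    field_simp
    ring
  have habs : ∀ t ∈ Set.Icc r (r + 1), |t ^ b * g t| < ε := by
    intro t ht
    rw [abs_mul, abs_of_nonneg (Real.rpow_nonneg (by linarith [ht.1]) _)]
    exact hcon t ht
  obtain ⟨t, ht, hte⟩ := exists_hasDerivAt_eq_slope (fun s => s ^ b * g s)
    (fun t => t ^ b * (g₁ t + b * g t / t)) (by linarith : r < r + 1)
    (fun t ht => (hu t (hr.trans ht.1)).continuousAt.continuousWithinAt)
    (fun t ht => hu t (hr.trans ht.1.le))
  have h1 := habs r ⟨le_rfl, by linarith⟩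
  have h2 := habs (r + 1) ⟨by linarith, le_rfl⟩
  have h3 := habs t ⟨ht.1.le, ht.2.le⟩
  have ht0 : 0 < t := by linarith [ht.1]
  have hsq : (t ^ b) ^ 2 = t ^ d := by
    rw [← Real.rpow_natCast, ← Real.rpow_mul ht0.le, hb]
    norm_num
  have hEt := hE t (hr.trans ht.1.le)
  have hE' : radialEnergy d g g₁ t =
      (t ^ b * (g₁ t + b * g t / t)) ^ 2 + (t ^ b * g t) ^ 2 := by
    rw [mul_pow, mul_pow, hsq, radialEnergy]; ring
  rw [hE', hte] at hEt
  simp only [add_sub_cancel_left, div_one] at hEt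
  rw [abs_lt] at h1 h2 h3
  have k1 : ((r + 1) ^ b * g (r + 1) - r ^ b * g r) ^ 2 < (2 * ε) ^ 2 :=
    sq_lt_sq' (by linarith) (by linarith)
  have k2 : (t ^ b * g t) ^ 2 < ε ^ 2 := sq_lt_sq' (by linarith) (by linarith)
  nlinarith

end Energy

/-! ### Decay and lower bound of the symbol -/

/-- Fix a basis vector e and set g(r) = m(re). The equation is the sum of
`integral_sphere_inner_sq_mul_cos` over the other n - 1 basis vectors, because their squared
coordinates on the sphere add up to 1 - ⟨y,e⟩². -/
theorem exists_sphereSymbol_profile {n : ℕ} (hn : 1 ≤ n) :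
    ∃ g g₁ g₂ : ℝ → ℝ, (∀ r, HasDerivAt g (g₁ r) r) ∧ (∀ r, HasDerivAt g₁ (g₂ r) r) ∧
      (∀ r, 0 < r → r * g₂ r + ((n - 1 : ℕ) : ℝ) * g₁ r + r * g r = 0) ∧ g 0 = 1 ∧
      ∀ ξ : E n, sphereSymbol n ξ = g ‖ξ‖ := by
  have := isProbabilityMeasure_sphereMeasure hn
  set i₀ : Fin n := ⟨0, hn⟩
  set b := EuclideanSpace.basisFun (Fin n) ℝ with hb
  have hb1 : ∀ i, ‖b i‖ = 1 := fun i => b.orthonormal.1 i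
  set A : Metric.sphere (0 : E n) 1 → ℝ := fun y => inner ℝ (y : E n) (b i₀) with hA
  have cA : Continuous A := by simp only [hA]; fun_prop
  have bA : ∀ y, |A y| ≤ 1 := fun y => abs_inner_sphere_le y (hb1 i₀)
  have dA : ∀ (y) (t : ℝ), HasDerivAt (fun s => s * A y) (A y) t := fun y t => by
    simpa using (hasDerivAt_id t).mul_const (A y)
  refine ⟨fun r => ∫ y, Real.cos (r * A y) ∂sphereMeasure n,
    fun r => ∫ y, -Real.sin (r * A y) * A y ∂sphereMeasure n,
    fun r => ∫ y, -(Real.cos (r * A y) * A y) * A y ∂sphereMeasure n, fun r => ?_, fun r => ?_,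
    fun r hr => ?_, by simp, fun ξ => ?_⟩
  · refine hasDerivAt_integral_sphere (f' := fun r y => -Real.sin (r * A y) * A y) 1
      (fun t => by fun_prop) (fun t => by fun_prop)
      (fun t y => ?_) (fun t y => (dA y t).cos) r
    rw [abs_mul, abs_neg]
    exact mul_le_one₀ (Real.abs_sin_le_one _) (abs_nonneg _) (bA y)
  · refine hasDerivAt_integral_sphere (f' := fun r y => -(Real.cos (r * A y) * A y) * A y) 1
      (fun t => by fun_prop) (fun t => by fun_prop)
      (fun t y => ?_) (fun t y => ((dA y t).sin.neg).mul_const _) r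
    rw [abs_mul, abs_neg, abs_mul]
    exact mul_le_one₀ (mul_le_one₀ (Real.abs_cos_le_one _) (abs_nonneg _) (bA y))
      (abs_nonneg _) (bA y)
  · have key : ∑ j ∈ Finset.univ.erase i₀,
        r ^ 2 * ∫ y, inner ℝ (y : E n) (b j) ^ 2 * Real.cos (r * A y) ∂sphereMeasure n =
        ∑ j ∈ Finset.univ.erase i₀, r * ∫ y, A y * Real.sin (r * A y) ∂sphereMeasure n := by
      refine Finset.sum_congr rfl fun j hj => ?_
      exact integral_sphere_inner_sq_mul_cos (hb1 i₀) (hb1 j)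
        (b.orthonormal.2 (Finset.ne_of_mem_erase hj).symm) r
    rw [Finset.sum_const, Finset.card_erase_of_mem (Finset.mem_univ _), Finset.card_univ,
      Fintype.card_fin, nsmul_eq_mul, ← Finset.mul_sum, ← integral_finsetSum] at key
    · have hs : ∀ y : Metric.sphere (0 : E n) 1,
          ∑ j ∈ Finset.univ.erase i₀, inner ℝ (y : E n) (b j) ^ 2 * Real.cos (r * A y) =
          Real.cos (r * A y) - A y ^ 2 * Real.cos (r * A y) := by
        intro y
        have h1 := b.sum_sq_inner_left (y : E n)
        rw [← Finset.add_sum_erase _ _ (Finset.mem_univ i₀)] at h1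
        have h2 : ‖(y : E n)‖ = 1 := by simp
        rw [h2] at h1
        rw [← Finset.sum_mul, eq_sub_of_add_eq' h1]
        simp only [hA]
        ring
      simp_rw [hs] at key
      rw [integral_sub (integrable_sphere (by fun_prop)) (integrable_sphere (by fun_prop))] at key
      have k1 : ∫ y, -Real.sin (r * A y) * A y ∂sphereMeasure n =
          -∫ y, A y * Real.sin (r * A y) ∂sphereMeasure n := by
        rw [← integral_neg]
        exact integral_congr_ae (Filter.Eventually.of_forall fun y => by simp only; ring)
      have k2 : ∫ y, -(Real.cos (r * A y) * A y) * A y ∂sphereMeasure n =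
          -∫ y, A y ^ 2 * Real.cos (r * A y) ∂sphereMeasure n := by
        rw [← integral_neg]
        exact integral_congr_ae (Filter.Eventually.of_forall fun y => by simp only; ring)
      simp only [k1, k2]
      refine mul_left_cancel₀ hr.ne' ?_
      linarith
    · exact fun j _ => integrable_sphere (by fun_prop)
  · rw [sphereSymbol_eq_of_norm_eq (ζ := ‖ξ‖ • b i₀) (by rw [norm_smul, hb1]; simp), sphereSymbol]
    simp only [inner_smul_right, hA]

/-- The lower bound can only be claimed at one radius in each unit interval, since the profile
oscillates. The upper bound discards the square of the derivative term in the energy. -/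
theorem exists_sphereSymbol_bounds {n : ℕ} (hn : 1 ≤ n) :
    (∃ C : ℝ, 0 < C ∧ ∀ ξ : E n, |sphereSymbol n ξ| ≤ C * √(1 + ‖ξ‖ ^ 2) ^ (-(((n : ℝ) - 1) / 2))) ∧
    ∃ ε : ℝ, 0 < ε ∧ ∀ r, 1 ≤ r → ∃ t ∈ Set.Icc r (r + 1), ∀ ξ : E n, ‖ξ‖ = t →
      ε ≤ t ^ (((n : ℝ) - 1) / 2) * |sphereSymbol n ξ| := by
  obtain ⟨g, g₁, g₂, hg, hg₁, hode, h0, hsym⟩ := exists_sphereSymbol_profile hn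
  obtain ⟨a, A, ha, hA, hE⟩ := exists_radialEnergy_bounds hg hg₁ hode (by simp [h0])
  have hcast : ((n - 1 : ℕ) : ℝ) = (n : ℝ) - 1 := by push_cast [Nat.cast_sub hn]; ring
  constructor
  · set b : ℝ := ((n : ℝ) - 1) / 2 with hb
    have hb0 : 0 ≤ b := by
      have : (1 : ℝ) ≤ n := by exact_mod_cast hn
      rw [hb]; linarith
    -- The 1 serves |ξ| ≤ 1, where |m| ≤ 1 and ⟨ξ⟩ ≤ √2. The √A comes from the energy for |ξ| ≥ 1,
    -- where ⟨ξ⟩ ≤ √2 |ξ|.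
    refine ⟨(1 + √A) * √2 ^ b, by positivity, fun ξ => ?_⟩
    have hpos : 0 < √(1 + ‖ξ‖ ^ 2) := by positivity
    rw [Real.rpow_neg hpos.le, ← div_eq_mul_inv, le_div_iff₀ (Real.rpow_pos_of_pos hpos _)]
    rcases le_total ‖ξ‖ 1 with h | h
    · have h1 : √(1 + ‖ξ‖ ^ 2) ≤ √2 := by
        apply Real.sqrt_le_sqrt
        nlinarith [norm_nonneg ξ]
      calc _ ≤ 1 * √2 ^ b := by
            gcongr
            exact abs_sphereSymbol_le n ξ
        _ ≤ _ := by
            gcongr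
            linarith [Real.sqrt_nonneg A]
    · have hr0 : 0 < ‖ξ‖ := by linarith
      have h1 : √(1 + ‖ξ‖ ^ 2) ≤ √2 * ‖ξ‖ := by
        rw [← Real.sqrt_sq hr0.le, ← Real.sqrt_mul (by norm_num), Real.sqrt_sq hr0.le]
        apply Real.sqrt_le_sqrt
        nlinarith
      have hsq : (‖ξ‖ ^ b) ^ 2 = ‖ξ‖ ^ (n - 1) := by
        rw [← Real.rpow_natCast, ← Real.rpow_mul hr0.le, hb, ← Real.rpow_natCast, hcast]
        norm_num
      have h2 : |sphereSymbol n ξ| * ‖ξ‖ ^ b ≤ √A := by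
        apply Real.le_sqrt_of_sq_le
        rw [mul_pow, hsq, sq_abs, hsym]
        refine le_trans ?_ (hE _ h).2
        rw [radialEnergy, mul_comm]
        gcongr
        nlinarith [sq_nonneg (g₁ ‖ξ‖ + ((n - 1 : ℕ) : ℝ) / 2 * g ‖ξ‖ / ‖ξ‖)]
      calc _ ≤ |sphereSymbol n ξ| * (√2 * ‖ξ‖) ^ b := by gcongr
        _ = |sphereSymbol n ξ| * ‖ξ‖ ^ b * √2 ^ b := by
            rw [Real.mul_rpow (by positivity) hr0.le]; ring
        _ ≤ _ := by gcongr; linarith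
  · obtain ⟨ε, hε, h⟩ := exists_radial_lower_bound hg ha fun r hr => (hE r hr).1
    refine ⟨ε, hε, fun r hr => ?_⟩
    obtain ⟨t, ht, h⟩ := h r hr
    refine ⟨t, ht, fun ξ hξ => ?_⟩
    rwa [hsym, hξ, ← hcast]

/-! ### The Japanese bracket -/

/-- The Japanese bracket `⟨ξ⟩ = (1 + |ξ|²)^{1/2}` on `ℝⁿ`. -/
def japaneseBracket {n : ℕ} (ξ : E n) : ℝ := √(1 + ‖ξ‖ ^ 2)

section Bracket

variable {n : ℕ}

theorem bracket_eq (k : Fin n → ℤ) : bracket k = japaneseBracket (latticePoint k) := rfl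

theorem one_le_japaneseBracket (ξ : E n) : 1 ≤ japaneseBracket ξ := by
  rw [japaneseBracket, Real.one_le_sqrt]
  nlinarith [sq_nonneg ‖ξ‖]

theorem japaneseBracket_pos (ξ : E n) : 0 < japaneseBracket ξ :=
  one_pos.trans_le (one_le_japaneseBracket ξ)

theorem norm_le_japaneseBracket (ξ : E n) : ‖ξ‖ ≤ japaneseBracket ξ :=
  Real.le_sqrt_of_sq_le (by linarith)

theorem japaneseBracket_le_one_add_norm (ξ : E n) : japaneseBracket ξ ≤ 1 + ‖ξ‖ := by
  rw [japaneseBracket, Real.sqrt_le_left (by positivity)]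
  nlinarith [norm_nonneg ξ]

theorem japaneseBracket_neg (ξ : E n) : japaneseBracket (-ξ) = japaneseBracket ξ := by
  simp [japaneseBracket]

theorem continuous_japaneseBracket : Continuous (japaneseBracket : E n → ℝ) := by
  unfold japaneseBracket; fun_prop

theorem japaneseBracket_add_le (x y : E n) :
    japaneseBracket (x + y) ≤ 2 * japaneseBracket x * japaneseBracket y := by
  unfold japaneseBracket
  rw [mul_assoc, ← Real.sqrt_mul (by positivity)]
  refine Real.sqrt_le_iff.2 ⟨by positivity, ?_⟩
  rw [mul_pow, Real.sq_sqrt (by positivity)]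
  have h := norm_add_le x y
  have h2 : ‖x + y‖ ^ 2 ≤ (‖x‖ + ‖y‖) ^ 2 := by gcongr
  nlinarith [sq_nonneg (‖x‖ - ‖y‖), mul_nonneg (sq_nonneg ‖x‖) (sq_nonneg ‖y‖), sq_nonneg ‖x‖,
    sq_nonneg ‖y‖]

theorem japaneseBracket_rpow_pos (ξ : E n) (a : ℝ) : 0 < japaneseBracket ξ ^ a :=
  Real.rpow_pos_of_pos (japaneseBracket_pos ξ) a

/-- Peetre's inequality. For negative a, apply the case of exponent 1 to x = (x + y) - y. -/
theorem japaneseBracket_add_rpow_le (x y : E n) (a : ℝ) :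
    japaneseBracket (x + y) ^ a ≤ 2 ^ |a| * japaneseBracket x ^ a * japaneseBracket y ^ |a| := by
  have hx := japaneseBracket_pos x
  have hy := japaneseBracket_pos y
  have hxy := japaneseBracket_pos (x + y)
  rcases le_total 0 a with ha | ha
  · rw [abs_of_nonneg ha, ← Real.mul_rpow (by norm_num) hx.le,
      ← Real.mul_rpow (by positivity) hy.le]
    exact Real.rpow_le_rpow hxy.le (japaneseBracket_add_le x y) ha
  · rw [abs_of_nonpos ha]
    have h : japaneseBracket x ≤ 2 * japaneseBracket (x + y) * japaneseBracket y := by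
      have := japaneseBracket_add_le (x + y) (-y)
      rwa [japaneseBracket_neg, add_neg_cancel_right] at this
    have h2 := Real.rpow_le_rpow_of_nonpos hx h ha
    rw [Real.mul_rpow (by positivity) hy.le, Real.mul_rpow (by norm_num) hxy.le] at h2
    calc japaneseBracket (x + y) ^ a
        = 2 ^ (-a) * (2 ^ a * japaneseBracket (x + y) ^ a * japaneseBracket y ^ a) *
            japaneseBracket y ^ (-a) := by
          rw [Real.rpow_neg (by norm_num), Real.rpow_neg hy.le]
          have : (0 : ℝ) < 2 ^ a := by positivity
          have := japaneseBracket_rpow_pos y a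
          field_simp
      _ ≤ _ := by
          have := japaneseBracket_rpow_pos y (-a)
          gcongr

theorem japaneseBracket_rpow_le_of_norm_sub_le {x y : E n} {R : ℝ} (h : ‖x - y‖ ≤ R) (a : ℝ) :
    japaneseBracket x ^ a ≤ 2 ^ |a| * (1 + R) ^ |a| * japaneseBracket y ^ a := by
  have h1 := japaneseBracket_add_rpow_le y (x - y) a
  rw [add_sub_cancel] at h1
  refine h1.trans ?_
  rw [mul_assoc, mul_assoc, mul_comm (japaneseBracket y ^ a)]
  have := japaneseBracket_rpow_pos y a
  have h2 := (japaneseBracket_le_one_add_norm (x - y)).trans (add_le_add_right h 1)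
  have := japaneseBracket_pos (x - y)
  gcongr

theorem integrable_japaneseBracket_rpow {r : ℝ} (hr : (n : ℝ) < r) :
    Integrable (fun x : E n => japaneseBracket x ^ (-r)) := by
  have h := integrable_rpow_neg_one_add_norm_sq (E := E n) (μ := volume) (r := r) (by simpa using hr)
  refine h.congr (Filter.Eventually.of_forall fun x => ?_)
  simp only [japaneseBracket]
  rw [Real.sqrt_eq_rpow, ← Real.rpow_mul (by positivity)]
  congr 1
  ring

theorem exists_schwartz_le_japaneseBracket {F : Type} [NormedAddCommGroup F] [NormedSpace ℝ F]
    (Ψ : 𝓢(E n, F)) (r : ℝ) : ∃ C : ℝ, 0 < C ∧ ∀ x, ‖Ψ x‖ ≤ C * japaneseBracket x ^ (-r) := by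
  set k := ⌈|r|⌉₊
  set S := 2 ^ k * ((Finset.Iic (k, 0)).sup fun m => SchwartzMap.seminorm ℝ m.1 m.2) Ψ with hS
  have hS0 : 0 ≤ S := by positivity
  refine ⟨S + 1, by positivity, fun x => ?_⟩
  have h := one_add_le_sup_seminorm_apply (𝕜 := ℝ) (m := (k, 0)) (k := k) (n := 0) le_rfl le_rfl Ψ x
  rw [norm_iteratedFDeriv_zero] at h
  have hx := japaneseBracket_pos x
  rw [Real.rpow_neg hx.le, ← div_eq_mul_inv, le_div_iff₀ (Real.rpow_pos_of_pos hx _)]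
  have h1 : japaneseBracket x ^ r ≤ (1 + ‖x‖) ^ k := by
    calc japaneseBracket x ^ r ≤ japaneseBracket x ^ (k : ℝ) :=
          Real.rpow_le_rpow_of_exponent_le (one_le_japaneseBracket x)
            ((le_abs_self r).trans (Nat.le_ceil _))
      _ = japaneseBracket x ^ k := Real.rpow_natCast _ _
      _ ≤ _ := by gcongr; exact japaneseBracket_le_one_add_norm x
  calc ‖Ψ x‖ * japaneseBracket x ^ r ≤ ‖Ψ x‖ * (1 + ‖x‖) ^ k := by gcongr
    _ = (1 + ‖x‖) ^ k * ‖Ψ x‖ := mul_comm _ _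
    _ ≤ S := h
    _ ≤ S + 1 := by linarith

end Bracket

/-! ### Symbol classes -/

/-- `f` is smooth and all its derivatives are `O(⟨ξ⟩^a)`. -/
structure IsSymbol {n : ℕ} {F : Type*} [NormedAddCommGroup F] [NormedSpace ℝ F] (a : ℝ)
    (f : E n → F) : Prop where
  contDiff : ContDiff ℝ ∞ f
  bound : ∀ j : ℕ, ∃ C : ℝ, 0 ≤ C ∧ ∀ ξ, ‖iteratedFDeriv ℝ j f ξ‖ ≤ C * japaneseBracket ξ ^ a

namespace IsSymbol

variable {n : ℕ} {F G H : Type*} [NormedAddCommGroup F] [NormedSpace ℝ F] [NormedAddCommGroup G]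
  [NormedSpace ℝ G] [NormedAddCommGroup H] [NormedSpace ℝ H] {a b : ℝ}

theorem bilin (B : F →L[ℝ] G →L[ℝ] H) {f : E n → F} {g : E n → G} (hf : IsSymbol a f)
    (hg : IsSymbol b g) : IsSymbol (a + b) fun ξ => B (f ξ) (g ξ) := by
  choose C hC0 hC using hf.bound
  choose D hD0 hD using hg.bound
  refine ⟨B.isBoundedBilinearMap.contDiff.comp (hf.contDiff.prodMk hg.contDiff), fun j => ?_⟩
  refine ⟨‖B‖ * ∑ i ∈ Finset.range (j + 1), (j.choose i : ℝ) * C i * D (j - i),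
    mul_nonneg (norm_nonneg B) (Finset.sum_nonneg fun i _ => mul_nonneg (mul_nonneg
      (Nat.cast_nonneg _) (hC0 _)) (hD0 _)), fun ξ => ?_⟩
  refine (B.norm_iteratedFDeriv_le_of_bilinear hf.contDiff hg.contDiff ξ (n := j)
    (by exact_mod_cast le_top)).trans ?_
  rw [mul_assoc, Finset.sum_mul]
  refine mul_le_mul_of_nonneg_left (Finset.sum_le_sum fun i _ => ?_) (norm_nonneg B)
  have hx := japaneseBracket_pos ξ
  rw [Real.rpow_add hx]
  calc _ ≤ (j.choose i : ℝ) * (C i * japaneseBracket ξ ^ a) *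
        (D (j - i) * japaneseBracket ξ ^ b) := by
        have := hC0 i
        gcongr
        · exact hC i ξ
        · exact hD _ ξ
    _ = _ := by ring

/-- Differentiation does not lower the order in this class, so the bound on f and those on its
derivative carry the same exponent. -/
theorem of_norm_le_of_fderiv {f : E n → F} (hf : ContDiff ℝ ∞ f) {C : ℝ} (hC : 0 ≤ C)
    (h : ∀ ξ, ‖f ξ‖ ≤ C * japaneseBracket ξ ^ a) (hd : IsSymbol a (fderiv ℝ f)) :
    IsSymbol a f := by
  refine ⟨hf, fun j => ?_⟩
  rcases j with _ | j
  · exact ⟨C, hC, fun ξ => by rw [norm_iteratedFDeriv_zero]; exact h ξ⟩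
  · obtain ⟨D, hD, h⟩ := hd.bound j
    exact ⟨D, hD, fun ξ => by rw [← norm_iteratedFDeriv_fderiv]; exact h ξ⟩

theorem const (c : F) (ha : 0 ≤ a) : IsSymbol a fun _ : E n => c := by
  have h1 : ∀ ξ : E n, 1 ≤ japaneseBracket ξ ^ a := fun ξ =>
    Real.one_le_rpow (one_le_japaneseBracket ξ) ha
  refine ⟨contDiff_const, fun j => ⟨‖c‖, norm_nonneg _, fun ξ => ?_⟩⟩
  rcases j with _ | j
  · rw [norm_iteratedFDeriv_zero]
    exact le_mul_of_one_le_right (norm_nonneg _) (h1 ξ)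
  · rw [iteratedFDeriv_const_of_ne (by simp)]
    simp only [Pi.zero_apply, norm_zero]
    exact mul_nonneg (norm_nonneg _) (zero_le_one.trans (h1 ξ))

theorem id : IsSymbol 1 fun ξ : E n => ξ := by
  refine of_norm_le_of_fderiv (C := 1) contDiff_id zero_le_one
    (fun ξ => by simpa using norm_le_japaneseBracket ξ) ?_
  have : fderiv ℝ (fun ξ : E n => ξ) = fun _ => ContinuousLinearMap.id ℝ (E n) := by
    ext1 ξ; exact fderiv_fun_id
  rw [this]
  exact const _ zero_le_one

theorem norm_sq : IsSymbol 2 fun ξ : E n => ((‖ξ‖ ^ 2 : ℝ) : ℂ) := by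
  have h := (bilin (innerSL ℝ) (id (n := n)) id).bilin (ContinuousLinearMap.lsmul ℝ ℝ)
    (const (n := n) (1 : ℂ) le_rfl)
  have e : (1 + 1 + 0 : ℝ) = 2 := by norm_num
  rw [e] at h
  refine (congrArg (IsSymbol 2) (funext fun ξ => ?_)).mpr h
  have h2 : innerSL ℝ ξ ξ = ‖ξ‖ ^ 2 := real_inner_self_eq_norm_sq ξ
  simp [h2]

theorem mul {f g : E n → ℂ} (hf : IsSymbol a f) (hg : IsSymbol b g) :
    IsSymbol (a + b) fun ξ => f ξ * g ξ :=
  bilin (ContinuousLinearMap.mul ℝ ℂ) hf hg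

theorem pow {f : E n → ℂ} (hf : IsSymbol a f) (N : ℕ) : IsSymbol (N * a) fun ξ => f ξ ^ N := by
  induction N with
  | zero => simpa using const (n := n) (1 : ℂ) le_rfl
  | succ N ih =>
    have := ih.mul hf
    simp_rw [← pow_succ] at this
    convert this using 1
    push_cast; ring

theorem neg {f : E n → ℂ} (hf : IsSymbol a f) : IsSymbol a fun ξ => -f ξ := by
  have := (const (n := n) (-1 : ℂ) le_rfl).mul hf
  simpa using this

theorem hasTemperateGrowth {f : E n → F} (hf : IsSymbol a f) : f.HasTemperateGrowth := by
  refine ⟨hf.contDiff, fun j => ?_⟩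
  obtain ⟨C, hC, h⟩ := hf.bound j
  refine ⟨⌈|a|⌉₊, C, fun ξ => (h ξ).trans ?_⟩
  gcongr
  calc japaneseBracket ξ ^ a ≤ japaneseBracket ξ ^ ((⌈|a|⌉₊ : ℕ) : ℝ) :=
        Real.rpow_le_rpow_of_exponent_le (one_le_japaneseBracket ξ)
          ((le_abs_self a).trans (Nat.le_ceil _))
    _ = japaneseBracket ξ ^ ⌈|a|⌉₊ := Real.rpow_natCast _ _
    _ ≤ _ := by
        gcongr
        · exact (japaneseBracket_pos ξ).le
        · exact japaneseBracket_le_one_add_norm ξ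

end IsSymbol

/-! ### Convolution with a Schwartz function -/

section Mollify

variable {n : ℕ} {F : Type} [NormedAddCommGroup F] [NormedSpace ℝ F] {m : E n → ℝ} {a C : ℝ}

/-- The convolution of a scalar function and a Schwartz function. -/
def mollify (m : E n → ℝ) (Ψ : E n → F) (ξ : E n) : F := ∫ η, m η • Ψ (ξ - η)

/-- Peetre's inequality moves the weight from η to ξ at the price of ⟨ξ - η⟩^{|a|}. Decay of Ψ of
order |a| + n + 1 pays for it and leaves an integrable factor. -/
theorem exists_norm_smul_schwartz_le (hC : 0 ≤ C) (hm : ∀ ξ, |m ξ| ≤ C * japaneseBracket ξ ^ a)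
    (Ψ : 𝓢(E n, F)) : ∃ D : ℝ, 0 ≤ D ∧ ∀ ξ η,
      ‖m η • Ψ (ξ - η)‖ ≤ D * japaneseBracket ξ ^ a * japaneseBracket (ξ - η) ^ (-((n : ℝ) + 1)) := by
  obtain ⟨B, hB, h⟩ := exists_schwartz_le_japaneseBracket Ψ (|a| + (n + 1))
  refine ⟨C * 2 ^ |a| * B, by positivity, fun ξ η => ?_⟩
  have h1 := japaneseBracket_add_rpow_le ξ (-(ξ - η)) a
  rw [japaneseBracket_neg, neg_sub, add_sub_cancel] at h1
  have hp := japaneseBracket_pos (ξ - η)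
  have hq := japaneseBracket_rpow_pos ξ a
  have hp' := japaneseBracket_rpow_pos (ξ - η) (-(|a| + (n + 1)))
  rw [norm_smul, Real.norm_eq_abs]
  calc _ ≤ (C * (2 ^ |a| * japaneseBracket ξ ^ a * japaneseBracket (ξ - η) ^ |a|)) *
        (B * japaneseBracket (ξ - η) ^ (-(|a| + (n + 1)))) := by
        gcongr
        · exact (hm η).trans (by gcongr)
        · exact h _
    _ = C * 2 ^ |a| * B * japaneseBracket ξ ^ a *
        (japaneseBracket (ξ - η) ^ |a| * japaneseBracket (ξ - η) ^ (-(|a| + (n + 1)))) := by ring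
    _ = _ := by
        rw [← Real.rpow_add hp]
        congr 2
        ring

theorem integrable_japaneseBracket_sub (ξ : E n) :
    Integrable fun η : E n => japaneseBracket (ξ - η) ^ (-((n : ℝ) + 1)) :=
  (integrable_japaneseBracket_rpow (lt_add_one _)).comp_sub_left ξ

theorem integrable_mollify (hmc : Continuous m) (hC : 0 ≤ C)
    (hm : ∀ ξ, |m ξ| ≤ C * japaneseBracket ξ ^ a) (Ψ : 𝓢(E n, F)) (ξ : E n) :
    Integrable fun η => m η • Ψ (ξ - η) := by
  obtain ⟨D, hD, h⟩ := exists_norm_smul_schwartz_le hC hm Ψ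
  refine Integrable.mono' ((integrable_japaneseBracket_sub ξ).const_mul _) ?_
    (Filter.Eventually.of_forall fun η => h ξ η)
  exact (hmc.smul (Ψ.continuous.comp (by fun_prop))).aestronglyMeasurable

theorem exists_norm_mollify_le (hC : 0 ≤ C) (hm : ∀ ξ, |m ξ| ≤ C * japaneseBracket ξ ^ a)
    (Ψ : 𝓢(E n, F)) : ∃ D : ℝ, 0 ≤ D ∧ ∀ ξ, ‖mollify m Ψ ξ‖ ≤ D * japaneseBracket ξ ^ a := by
  obtain ⟨D, hD, h⟩ := exists_norm_smul_schwartz_le hC hm Ψ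
  refine ⟨D * ∫ η : E n, japaneseBracket η ^ (-((n : ℝ) + 1)), mul_nonneg hD
    (integral_nonneg fun η => (japaneseBracket_rpow_pos _ _).le), fun ξ => ?_⟩
  refine (norm_integral_le_of_norm_le ((integrable_japaneseBracket_sub ξ).const_mul _)
    (Filter.Eventually.of_forall fun η => h ξ η)).trans_eq ?_
  rw [integral_const_mul, integral_sub_left_eq_self (fun η : E n =>
    japaneseBracket η ^ (-((n : ℝ) + 1))) volume ξ]
  ring

theorem hasFDerivAt_mollify (hmc : Continuous m) (hC : 0 ≤ C)
    (hm : ∀ ξ, |m ξ| ≤ C * japaneseBracket ξ ^ a) (Ψ : 𝓢(E n, F)) (ξ : E n) :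
    HasFDerivAt (mollify m Ψ) (mollify m (fderivCLM ℝ (E n) F Ψ) ξ) ξ := by
  obtain ⟨D, hD, h⟩ := exists_norm_smul_schwartz_le hC hm (fderivCLM ℝ (E n) F Ψ)
  refine hasFDerivAt_integral_of_dominated_of_fderiv_le (s := Metric.ball ξ 1)
    (F' := fun z η => m η • fderivCLM ℝ (E n) F Ψ (z - η))
    (bound := fun η => D * (2 ^ |a| * (1 + 1) ^ |a| * japaneseBracket ξ ^ a) *
      (2 ^ |-((n : ℝ) + 1)| * (1 + 1) ^ |-((n : ℝ) + 1)| *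
        japaneseBracket (ξ - η) ^ (-((n : ℝ) + 1))))
    (Metric.ball_mem_nhds ξ one_pos) ?_ (integrable_mollify hmc hC hm Ψ ξ)
    (integrable_mollify hmc hC hm _ ξ).aestronglyMeasurable ?_ ?_ ?_
  · exact Filter.Eventually.of_forall fun z =>
      (integrable_mollify hmc hC hm Ψ z).aestronglyMeasurable
  · refine Filter.Eventually.of_forall fun η z hz => (h z η).trans ?_
    have hz' : ‖z - ξ‖ ≤ 1 := (mem_ball_iff_norm.1 hz).le
    have := japaneseBracket_rpow_pos (z - η) (-((n : ℝ) + 1))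
    have := japaneseBracket_rpow_pos ξ a
    gcongr
    · exact japaneseBracket_rpow_le_of_norm_sub_le hz' a
    · exact japaneseBracket_rpow_le_of_norm_sub_le (by simpa using hz') _
  · exact ((integrable_japaneseBracket_sub ξ).const_mul _).const_mul _
  · refine Filter.Eventually.of_forall fun η z _ => ?_
    have h := (Ψ.differentiableAt (x := z - η)).hasFDerivAt.comp z
      ((hasFDerivAt_id z).sub_const η)
    exact HasFDerivAt.const_smul (by simpa [Function.comp_def] using h) (m η)

theorem fderiv_mollify (hmc : Continuous m) (hC : 0 ≤ C)
    (hm : ∀ ξ, |m ξ| ≤ C * japaneseBracket ξ ^ a) (Ψ : 𝓢(E n, F)) :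
    fderiv ℝ (mollify m Ψ) = mollify m (fderivCLM ℝ (E n) F Ψ) :=
  funext fun ξ => (hasFDerivAt_mollify hmc hC hm Ψ ξ).fderiv

theorem contDiff_mollify_nat (hmc : Continuous m) (hC : 0 ≤ C)
    (hm : ∀ ξ, |m ξ| ≤ C * japaneseBracket ξ ^ a) (j : ℕ) :
    ∀ {F : Type} [NormedAddCommGroup F] [NormedSpace ℝ F] (Ψ : 𝓢(E n, F)),
      ContDiff ℝ j (mollify m Ψ) := by
  induction j with
  | zero =>
    intro F _ _ Ψ
    have hd : Differentiable ℝ (mollify m Ψ) :=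
      fun ξ => (hasFDerivAt_mollify hmc hC hm Ψ ξ).differentiableAt
    simpa using hd.continuous
  | succ j ih =>
    intro F _ _ Ψ
    have h := ih (fderivCLM ℝ (E n) F Ψ)
    rw [← fderiv_mollify hmc hC hm] at h
    push_cast
    exact contDiff_succ_iff_fderiv.2
      ⟨fun ξ => (hasFDerivAt_mollify hmc hC hm Ψ ξ).differentiableAt, by simp, h⟩

/-- All derivatives fall on Ψ, so a size bound on m alone controls every derivative of the
convolution with the same exponent. -/
theorem isSymbol_mollify (hmc : Continuous m) (hC : 0 ≤ C)
    (hm : ∀ ξ, |m ξ| ≤ C * japaneseBracket ξ ^ a) (Ψ : 𝓢(E n, F)) :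
    IsSymbol a (mollify m Ψ) := by
  refine ⟨contDiff_infty.2 fun j => contDiff_mollify_nat hmc hC hm j Ψ, fun j => ?_⟩
  induction j generalizing F with
  | zero =>
    obtain ⟨D, hD, h⟩ := exists_norm_mollify_le hC hm Ψ
    exact ⟨D, hD, fun ξ => by rw [norm_iteratedFDeriv_zero]; exact h ξ⟩
  | succ j ih =>
    obtain ⟨D, hD, h⟩ := ih (fderivCLM ℝ (E n) F Ψ)
    refine ⟨D, hD, fun ξ => ?_⟩
    rw [← norm_iteratedFDeriv_fderiv, fderiv_mollify hmc hC hm]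
    exact h ξ

end Mollify

/-! ### The symbol of the spherical average is a symbol -/

section Reproduction

variable {n : ℕ}

theorem sphereSymbol_neg (ξ : E n) : sphereSymbol n (-ξ) = sphereSymbol n ξ :=
  sphereSymbol_eq_of_norm_eq (norm_neg ξ)

theorem integrable_prod_sphere_mul {f : Metric.sphere (0 : E n) 1 × E n → ℂ} (hf : Continuous f)
    (hf1 : ∀ z, ‖f z‖ ≤ 1) (Φ : 𝓢(E n, ℂ)) :
    Integrable (fun z : Metric.sphere (0 : E n) 1 × E n => f z * Φ z.2)
      ((sphereMeasure n).prod volume) := by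
  have h := Φ.integrable (μ := volume)
  refine Integrable.mono (h.comp_snd (sphereMeasure n))
    (hf.mul (Φ.continuous.comp continuous_snd)).aestronglyMeasurable
    (Filter.Eventually.of_forall fun z => ?_)
  rw [norm_mul]
  exact mul_le_of_le_one_left (norm_nonneg _) (hf1 z)

theorem norm_cexp_ofReal_mul_I_le (t : ℝ) : ‖Complex.exp ((t : ℂ) * Complex.I)‖ ≤ 1 :=
  (Complex.norm_exp_ofReal_mul_I t).le

theorem exists_schwartz_eq_one_on_ball (n : ℕ) :
    ∃ χ : 𝓢(E n, ℂ), ∀ y, ‖y‖ ≤ 1 → χ y = 1 := by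
  let b : ContDiffBump (0 : E n) := ⟨1, 2, one_pos, one_lt_two⟩
  have hc : HasCompactSupport fun y => ((b y : ℝ) : ℂ) :=
    b.hasCompactSupport.comp_left Complex.ofReal_zero
  have hs : ContDiff ℝ ∞ fun y => ((b y : ℝ) : ℂ) :=
    Complex.ofRealCLM.contDiff.comp b.contDiff
  refine ⟨hc.toSchwartzMap hs, fun y hy => ?_⟩
  have : b y = 1 := b.one_of_mem_closedBall (by simpa using hy)
  simp [this]

/-- For y on the sphere, e^{-i⟨y,ξ⟩} = e^{-i⟨y,ξ⟩} 𝓕Φ(y) = ∫ e^{-i⟨y,ξ+2πζ⟩} Φ(ζ) dζ. Integrate in y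
and exchange the integrals. -/
theorem sphereSymbol_eq_integral (Φ : 𝓢(E n, ℂ)) (hΦ : ∀ y, ‖y‖ ≤ 1 → 𝓕 Φ y = 1) (ξ : E n) :
    (sphereSymbol n ξ : ℂ) =
      ∫ ζ, (sphereSymbol n (ξ + (2 * Real.pi) • ζ) : ℂ) * Φ ζ := by
  have h1 : ∀ y : Metric.sphere (0 : E n) 1,
      Complex.exp (((-inner ℝ (y : E n) ξ : ℝ) : ℂ) * Complex.I) =
      ∫ ζ, Complex.exp (((-inner ℝ (y : E n) (ξ + (2 * Real.pi) • ζ) : ℝ) : ℂ) * Complex.I) *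
        Φ ζ := by
    intro y
    have h2 := hΦ y (by simp)
    rw [fourier_coe, Real.fourier_eq'] at h2
    refine (mul_one (Complex.exp _)).symm.trans ((congrArg (_ * ·) h2.symm).trans ?_)
    refine (integral_const_mul _ _).symm.trans ?_
    refine integral_congr_ae (Filter.Eventually.of_forall fun ζ => ?_)
    simp only [smul_eq_mul]
    rw [← mul_assoc, ← Complex.exp_add, ← add_mul, ← Complex.ofReal_add]
    congr 4
    rw [inner_add_right, inner_smul_right, real_inner_comm ζ]
    ring
  rw [← integral_cexp_inner_sphere]
  have hcont : Continuous fun z : Metric.sphere (0 : E n) 1 × E n =>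
      Complex.exp (((-inner ℝ (z.1 : E n) (ξ + (2 * Real.pi) • z.2) : ℝ) : ℂ) * Complex.I) := by
    have h3 : Continuous fun z : Metric.sphere (0 : E n) 1 × E n =>
        inner ℝ (z.1 : E n) (ξ + (2 * Real.pi) • z.2) :=
      (continuous_subtype_val.comp continuous_fst).inner
        (by fun_prop)
    exact Complex.continuous_exp.comp
      ((Complex.continuous_ofReal.comp h3.neg).mul continuous_const)
  have hint : Integrable (Function.uncurry fun (y : Metric.sphere (0 : E n) 1) (ζ : E n) =>
      Complex.exp (((-inner ℝ (y : E n) (ξ + (2 * Real.pi) • ζ) : ℝ) : ℂ) * Complex.I) * Φ ζ)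
      ((sphereMeasure n).prod volume) :=
    integrable_prod_sphere_mul hcont (fun z => norm_cexp_ofReal_mul_I_le _) Φ
  rw [integral_congr_ae (Filter.Eventually.of_forall h1), integral_integral_swap hint]
  refine integral_congr_ae (Filter.Eventually.of_forall fun ζ => ?_)
  exact (integral_mul_const _ _).trans (by rw [integral_cexp_inner_sphere])

/-- Dilation of `ℝⁿ` by a nonzero factor. -/
def dilation (n : ℕ) {c : ℝ} (hc : c ≠ 0) : E n ≃L[ℝ] E n :=
  ContinuousLinearEquiv.smulLeft (Units.mk0 c hc)

theorem dilation_apply {c : ℝ} (hc : c ≠ 0) (x : E n) : dilation n hc x = c • x := rfl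

theorem exists_sphereSymbol_eq_mollify (n : ℕ) :
    ∃ Ψ : 𝓢(E n, ℂ), ∀ ξ, (sphereSymbol n ξ : ℂ) = mollify (sphereSymbol n) Ψ ξ := by
  obtain ⟨χ, hχ⟩ := exists_schwartz_eq_one_on_ball n
  set Φ : 𝓢(E n, ℂ) := 𝓕⁻ χ with hΦ
  have hΦ1 : ∀ y, ‖y‖ ≤ 1 → 𝓕 Φ y = 1 := by
    intro y hy
    rw [hΦ, FourierTransform.fourier_fourierInv_eq]
    exact hχ y hy
  have hpi : (2 * Real.pi) ≠ 0 := by positivity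
  -- After substitution Φ is evaluated at (η - ξ)/2π, whereas the convolution evaluates Ψ at ξ - η;
  -- hence the sign. The constant c below is the Jacobian.
  have hc : (-(2 * Real.pi)⁻¹) ≠ 0 := by simp [Real.pi_ne_zero]
  set c : ℝ := |((2 * Real.pi) ^ Module.finrank ℝ (E n))⁻¹|
  refine ⟨c • compCLMOfContinuousLinearEquiv ℝ (dilation n hc) Φ, fun ξ => ?_⟩
  rw [sphereSymbol_eq_integral Φ hΦ1]
  have h := Measure.integral_comp_smul (volume : Measure (E n))
    (fun x => (sphereSymbol n (ξ + x) : ℂ) * Φ ((2 * Real.pi)⁻¹ • x)) (2 * Real.pi)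
  simp only [smul_smul, inv_mul_cancel₀ hpi, one_smul] at h
  rw [h, ← integral_sub_right_eq_self _ ξ, ← integral_smul]
  refine integral_congr_ae (Filter.Eventually.of_forall fun η => ?_)
  simp only [add_sub_cancel, smul_apply, compCLMOfContinuousLinearEquiv_apply,
    Function.comp_apply, dilation_apply, neg_smul, ← smul_neg, neg_sub]
  rw [smul_comm]
  simp [c]

theorem isSymbol_sphereSymbol (hn : 1 ≤ n) :
    IsSymbol (-(((n : ℝ) - 1) / 2)) fun ξ : E n => (sphereSymbol n ξ : ℂ) := by
  obtain ⟨C, hC, h⟩ := (exists_sphereSymbol_bounds hn).1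
  obtain ⟨Ψ, hΨ⟩ := exists_sphereSymbol_eq_mollify n
  rw [funext hΨ]
  exact isSymbol_mollify (continuous_sphereSymbol n) hC.le h Ψ

end Reproduction

/-! ### The operator as a Fourier multiplier -/

section Multiplier

variable {n : ℕ}

/-- The symbol `-|η|² m(η)^N` of `Δ (A₁)^N`, where `m` is the symbol of `A₁`. -/
def averageSymbol (n N : ℕ) (η : E n) : ℂ :=
  -(((‖η‖ ^ 2 : ℝ) : ℂ) * (sphereSymbol n η : ℂ) ^ N)

theorem isSymbol_averageSymbol (hn : 1 ≤ n) (N : ℕ) :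
    IsSymbol (2 - ((n : ℝ) - 1) / 2 * N) (averageSymbol n N) := by
  have h := (IsSymbol.norm_sq.mul ((isSymbol_sphereSymbol hn).pow N)).neg
  have e : 2 + (N : ℝ) * -(((n : ℝ) - 1) / 2) = 2 - ((n : ℝ) - 1) / 2 * N := by ring
  rw [e] at h
  exact h

theorem hasTemperateGrowth_comp_two_pi {f : E n → ℂ} (hf : f.HasTemperateGrowth) :
    (fun ξ => f ((2 * Real.pi) • ξ)).HasTemperateGrowth :=
  hf.comp (dilation n (by positivity : (2 * Real.pi) ≠ 0)).hasTemperateGrowth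

/-- Fourier inversion and Fubini. The order 𝓕 · 𝓕⁻¹ is that of the transposed multiplier, the form
in which multipliers act on test functions; it has the same symbol because m is even. -/
theorem sphericalAverageSchwartz_eq (hn : 1 ≤ n) (ψ : 𝓢(E n, ℂ)) :
    sphericalAverageSchwartz n ψ =
      𝓕 (smulLeftCLM ℂ (fun ξ : E n => (sphereSymbol n ((2 * Real.pi) • ξ) : ℂ)) (𝓕⁻ ψ)) := by
  have ht := hasTemperateGrowth_comp_two_pi (isSymbol_sphereSymbol hn).hasTemperateGrowth
  ext x
  rw [sphericalAverageSchwartz_apply, fourier_coe, Real.fourier_eq']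
  have h1 : ∀ y : Metric.sphere (0 : E n) 1, ψ (x - (y : E n)) =
      ∫ v, Complex.exp (((-2 * Real.pi * inner ℝ v (x - (y : E n)) : ℝ) : ℂ) * Complex.I) *
        (𝓕⁻ ψ : 𝓢(E n, ℂ)) v := by
    intro y
    conv_lhs => rw [← FourierTransform.fourier_fourierInv_eq (F := 𝓢(E n, ℂ)) ψ]
    rw [fourier_coe, Real.fourier_eq']
    simp only [smul_eq_mul]
  have hint : Integrable (Function.uncurry fun (y : Metric.sphere (0 : E n) 1) (v : E n) =>
      Complex.exp (((-2 * Real.pi * inner ℝ v (x - (y : E n)) : ℝ) : ℂ) * Complex.I) *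
        (𝓕⁻ ψ : 𝓢(E n, ℂ)) v) ((sphereMeasure n).prod volume) :=
    integrable_prod_sphere_mul
      (f := fun z => Complex.exp (((-2 * Real.pi * inner ℝ z.2 (x - (z.1 : E n)) : ℝ) : ℂ) *
        Complex.I)) (by fun_prop) (fun z => norm_cexp_ofReal_mul_I_le _) (𝓕⁻ ψ)
  rw [integral_congr_ae (Filter.Eventually.of_forall h1), integral_integral_swap hint]
  refine integral_congr_ae (Filter.Eventually.of_forall fun v => ?_)
  refine (integral_mul_const _ _).trans ?_
  simp only
  rw [smulLeftCLM_apply_apply ht, smul_eq_mul, smul_eq_mul, ← mul_assoc,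
    ← sphereSymbol_neg, ← integral_cexp_inner_sphere, ← integral_const_mul]
  congr 2
  ext y
  rw [← Complex.exp_add, ← add_mul, ← Complex.ofReal_add]
  congr 4
  rw [inner_sub_right, inner_neg_right, inner_smul_right, real_inner_comm v]
  ring

theorem sphericalAverageDistribution_eq (hn : 1 ≤ n) (f : 𝓢'(E n, ℂ)) :
    sphericalAverageDistribution n f = TemperedDistribution.fourierMultiplierCLM ℂ
      (fun ξ : E n => (sphereSymbol n ((2 * Real.pi) • ξ) : ℂ)) f := by
  ext ψ
  rw [TemperedDistribution.fourierMultiplierCLM_apply_apply, ← sphericalAverageSchwartz_eq hn]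
  rfl

theorem iterate_sphericalAverageDistribution_eq (hn : 1 ≤ n) (N : ℕ) (f : 𝓢'(E n, ℂ)) :
    (sphericalAverageDistribution n)^[N] f = TemperedDistribution.fourierMultiplierCLM ℂ
      (fun ξ : E n => (sphereSymbol n ((2 * Real.pi) • ξ) : ℂ) ^ N) f := by
  have ht := hasTemperateGrowth_comp_two_pi (isSymbol_sphereSymbol hn).hasTemperateGrowth
  have htN : ∀ M : ℕ, (fun ξ : E n => (sphereSymbol n ((2 * Real.pi) • ξ) : ℂ) ^ M).HasTemperateGrowth :=
    fun M => ht.pow M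
  induction N with
  | zero => simp
  | succ N ih =>
    rw [Function.iterate_succ_apply', ih, sphericalAverageDistribution_eq hn,
      TemperedDistribution.fourierMultiplierCLM_fourierMultiplierCLM_apply (htN N) ht]
    congr 1

theorem laplacianIteratedAverage_eq (hn : 1 ≤ n) (N : ℕ) (f : 𝓢'(E n, ℂ)) :
    laplacianIteratedAverage n N f = TemperedDistribution.fourierMultiplierCLM ℂ
      (fun ξ : E n => averageSymbol n N ((2 * Real.pi) • ξ)) f := by
  have ht := hasTemperateGrowth_comp_two_pi (isSymbol_sphereSymbol hn).hasTemperateGrowth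
  have htN : (fun ξ : E n => (sphereSymbol n ((2 * Real.pi) • ξ) : ℂ) ^ N).HasTemperateGrowth :=
    ht.pow N
  have hs : (fun ξ : E n => ((‖ξ‖ ^ 2 : ℝ) : ℂ)).HasTemperateGrowth :=
    IsSymbol.norm_sq.hasTemperateGrowth
  rw [laplacianIteratedAverage, TemperedDistribution.laplacian_eq_fourierMultiplierCLM,
    iterate_sphericalAverageDistribution_eq hn,
    TemperedDistribution.fourierMultiplierCLM_fourierMultiplierCLM_apply htN hs,
    ← Complex.coe_smul, ← _root_.smul_apply,
    ← TemperedDistribution.fourierMultiplierCLM_smul (htN.mul hs)]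
  congr 2
  ext ξ
  simp only [averageSymbol, Pi.smul_apply, Pi.mul_apply, smul_eq_mul, norm_smul, mul_pow,
    Real.norm_eq_abs, sq_abs]
  push_cast
  ring

end Multiplier

/-! ### Convolution estimates in `L^p` -/

section Young

variable {n : ℕ}

/-- Interpolation with L^∞: |h|^{p₂} ≤ D^{p₂-p₁} |h|^{p₁}. It serves both for convolutions on ℝⁿ and
for the inclusion ℓ^{q₁} ⊂ ℓ^{q₂}. -/
theorem eLpNorm_le_of_enorm_le {α F : Type*} [MeasurableSpace α] {μ : Measure α} [ENorm F]
    {h : α → F} {p₁ p₂ D : ℝ≥0∞} (hp₁ : 1 ≤ p₁) (hp : p₁ ≤ p₂)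
    (hb : ∀ y, ‖h y‖ₑ ≤ D) (h₁ : eLpNorm h p₁ μ ≤ D) : eLpNorm h p₂ μ ≤ D := by
  rcases eq_or_ne p₂ ⊤ with rfl | h2
  · rw [eLpNorm_exponent_top]
    exact eLpNormEssSup_le_of_ae_enorm_bound (Filter.Eventually.of_forall hb)
  have h1 : p₁ ≠ ⊤ := ne_top_of_le_ne_top h2 hp
  have hp₂ := hp₁.trans hp
  have h10 : p₁ ≠ 0 := (one_pos.trans_le hp₁).ne'
  have h20 : p₂ ≠ 0 := (one_pos.trans_le hp₂).ne'
  have r1 : 0 < p₁.toReal := ENNReal.toReal_pos h10 h1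
  have r2 : 0 < p₂.toReal := ENNReal.toReal_pos h20 h2
  have r12 : p₁.toReal ≤ p₂.toReal := ENNReal.toReal_mono h2 hp
  rw [eLpNorm_eq_lintegral_rpow_enorm_toReal h10 h1, one_div, ENNReal.rpow_inv_le_iff r1] at h₁
  rw [eLpNorm_eq_lintegral_rpow_enorm_toReal h20 h2, one_div, ENNReal.rpow_inv_le_iff r2]
  have hsplit : ∀ t : ℝ≥0∞, t ^ p₂.toReal = t ^ (p₂.toReal - p₁.toReal) * t ^ p₁.toReal := by
    intro t
    rw [← ENNReal.rpow_add_of_nonneg _ _ (by linarith) r1.le, sub_add_cancel]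
  rcases eq_or_ne D ⊤ with rfl | hD
  · rw [ENNReal.top_rpow_of_pos r2]; exact le_top
  calc ∫⁻ x, ‖h x‖ₑ ^ p₂.toReal ∂μ
      ≤ ∫⁻ x, D ^ (p₂.toReal - p₁.toReal) * ‖h x‖ₑ ^ p₁.toReal ∂μ := by
        refine lintegral_mono fun x => ?_
        rw [hsplit]
        gcongr
        exact hb x
    _ = D ^ (p₂.toReal - p₁.toReal) * ∫⁻ x, ‖h x‖ₑ ^ p₁.toReal ∂μ :=
        lintegral_const_mul' _ _ (ENNReal.rpow_ne_top_of_nonneg (by linarith) hD)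
    _ ≤ D ^ (p₂.toReal - p₁.toReal) * D ^ p₁.toReal := by gcongr
    _ = D ^ p₂.toReal := (hsplit D).symm

/-- The integrable weight `⟨x⟩^{-(n+1)}`. -/
def decayWeight (x : E n) : ℝ := japaneseBracket x ^ (-((n : ℝ) + 1))

theorem decayWeight_nonneg (x : E n) : 0 ≤ decayWeight x := (japaneseBracket_rpow_pos _ _).le

theorem decayWeight_le_one (x : E n) : decayWeight x ≤ 1 :=
  Real.rpow_le_one_of_one_le_of_nonpos (one_le_japaneseBracket x)
    (by have : (0 : ℝ) ≤ n := Nat.cast_nonneg n; linarith)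

theorem continuous_decayWeight : Continuous (decayWeight : E n → ℝ) :=
  continuous_japaneseBracket.rpow_const fun x => Or.inl (japaneseBracket_pos x).ne'

theorem integrable_decayWeight : Integrable (decayWeight : E n → ℝ) :=
  integrable_japaneseBracket_rpow (lt_add_one _)

/-- The larger of `1` and the integral of the weight. -/
def decayMass (n : ℕ) : ℝ≥0∞ := max 1 (∫⁻ x : E n, ‖decayWeight x‖ₑ)

theorem decayMass_ne_top : decayMass n ≠ ⊤ :=
  max_ne_top ENNReal.one_ne_top integrable_decayWeight.2.ne

theorem eLpNorm_decayWeight_le {p : ℝ≥0∞} (hp : 1 ≤ p) :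
    eLpNorm (decayWeight : E n → ℝ) p volume ≤ decayMass n := by
  refine eLpNorm_le_of_enorm_le le_rfl hp (fun y => ?_) ?_
  · refine le_trans ?_ (le_max_left _ _)
    rw [Real.enorm_of_nonneg (decayWeight_nonneg y)]
    exact ENNReal.ofReal_le_one.2 (decayWeight_le_one y)
  · rw [eLpNorm_one_eq_lintegral_enorm]
    exact le_max_right _ _

/-- Hölder's inequality, the weight being bounded by `decayMass` in every L^p with p ≥ 1. This is
the L^p to L^∞ half of the convolution estimate. -/
theorem lintegral_enorm_mul_decayWeight_le {p : ℝ≥0∞} (hp : 1 ≤ p) {g : E n → ℂ}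
    (hg : AEStronglyMeasurable g volume) (y : E n) :
    ∫⁻ x, ‖g x‖ₑ * ‖decayWeight (x - y)‖ₑ ≤ decayMass n * eLpNorm g p volume := by
  have := ENNReal.HolderConjugate.conjExponent hp
  have hw : Continuous fun x : E n => decayWeight (x - y) :=
    continuous_decayWeight.comp (by fun_prop)
  have h := eLpNorm_smul_le_mul_eLpNorm (p := ENNReal.conjExponent p) (q := p) (r := 1) hg
    hw.aestronglyMeasurable
  rw [eLpNorm_one_eq_lintegral_enorm] at h
  have e : eLpNorm (fun x : E n => decayWeight (x - y)) (ENNReal.conjExponent p) volume =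
      eLpNorm (decayWeight : E n → ℝ) (ENNReal.conjExponent p) volume :=
    eLpNorm_comp_measurePreserving (g := decayWeight) (f := fun x : E n => x - y)
      continuous_decayWeight.aestronglyMeasurable (measurePreserving_sub_right volume y)
  rw [e] at h
  calc ∫⁻ x, ‖g x‖ₑ * ‖decayWeight (x - y)‖ₑ
      = ∫⁻ x, ‖((fun x : E n => decayWeight (x - y)) • g) x‖ₑ := by
        refine lintegral_congr fun x => ?_
        rw [Pi.smul_apply', enorm_smul, mul_comm]
    _ ≤ _ := h
    _ ≤ _ := by
        gcongr
        exact eLpNorm_decayWeight_le (ENNReal.HolderConjugate.one_le p.conjExponent p)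

/-- Young's inequality with an integrable kernel: Jensen's inequality for each y, then Tonelli. -/
theorem lintegral_rpow_convolution_le {p : ℝ≥0∞} (hp : 1 ≤ p) (hp' : p ≠ ⊤) {g : E n → ℂ}
    (hg : AEStronglyMeasurable g volume) :
    ∫⁻ y, (∫⁻ x, ‖g x‖ₑ * ‖decayWeight (x - y)‖ₑ) ^ p.toReal ≤
      (decayMass n * eLpNorm g p volume) ^ p.toReal := by
  have hp0 : p ≠ 0 := (one_pos.trans_le hp).ne'
  have r : 0 < p.toReal := ENNReal.toReal_pos hp0 hp'
  have r1 : 1 ≤ p.toReal := by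
    have := ENNReal.toReal_mono hp' hp
    simpa using this
  set c := ∫⁻ x : E n, ‖decayWeight x‖ₑ with hc
  have hwm : ∀ y : E n, Measurable fun x : E n => ‖decayWeight (x - y)‖ₑ := fun y =>
    (continuous_decayWeight.comp (by fun_prop)).measurable.enorm
  have hmass : ∀ y : E n, ∫⁻ x, ‖decayWeight (x - y)‖ₑ = c := fun y =>
    lintegral_sub_right_eq_self (fun x : E n => ‖decayWeight x‖ₑ) y
  have hmass' : ∀ x : E n, ∫⁻ y, ‖decayWeight (x - y)‖ₑ = c := fun x =>
    lintegral_sub_left_eq_self (fun x : E n => ‖decayWeight x‖ₑ) x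
  have hpt : ∀ y : E n, (∫⁻ x, ‖g x‖ₑ * ‖decayWeight (x - y)‖ₑ) ^ p.toReal ≤
      (∫⁻ x, ‖g x‖ₑ ^ p.toReal * ‖decayWeight (x - y)‖ₑ) * c ^ (p.toReal - 1) := by
    intro y
    -- The measure ν has total mass c for every y, so comparing its L¹ and L^p norms costs exactly
    -- the power c^{p-1}.
    set ν := (volume : Measure (E n)).withDensity fun x => ‖decayWeight (x - y)‖ₑ with hν
    have hac : ν ≪ volume := withDensity_absolutelyContinuous _ _
    have h := eLpNorm_le_eLpNorm_mul_rpow_measure_univ (μ := ν) hp (hg.mono_ac hac)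
    have huniv : ν Set.univ = c := by
      rw [hν, withDensity_apply _ MeasurableSet.univ, Measure.restrict_univ, hmass]
    have e1 : ∫⁻ x, ‖g x‖ₑ ∂ν = ∫⁻ x, ‖g x‖ₑ * ‖decayWeight (x - y)‖ₑ := by
      rw [hν, lintegral_withDensity_eq_lintegral_mul₀ (hwm y).aemeasurable hg.enorm]
      exact lintegral_congr fun x => mul_comm ‖decayWeight (x - y)‖ₑ ‖g x‖ₑ
    have e2 : ∫⁻ x, ‖g x‖ₑ ^ p.toReal ∂ν =
        ∫⁻ x, ‖g x‖ₑ ^ p.toReal * ‖decayWeight (x - y)‖ₑ := by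
      rw [hν, lintegral_withDensity_eq_lintegral_mul₀ (hwm y).aemeasurable (hg.enorm.pow_const _)]
      exact lintegral_congr fun x => mul_comm ‖decayWeight (x - y)‖ₑ (‖g x‖ₑ ^ p.toReal)
    rw [eLpNorm_one_eq_lintegral_enorm, eLpNorm_eq_lintegral_rpow_enorm_toReal hp0 hp', huniv,
      e1, e2] at h
    refine (ENNReal.rpow_le_rpow h r.le).trans_eq ?_
    rw [ENNReal.mul_rpow_of_nonneg _ _ r.le, ← ENNReal.rpow_mul, ← ENNReal.rpow_mul,
      one_div_mul_cancel r.ne', ENNReal.rpow_one]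
    congr 2
    simp
    field_simp
  have hc1 : c * c ^ (p.toReal - 1) ≤ decayMass n ^ p.toReal := by
    have : c * c ^ (p.toReal - 1) = c ^ p.toReal := by
      conv_lhs => rw [← ENNReal.rpow_one c, ← ENNReal.rpow_mul, one_mul]
      rw [← ENNReal.rpow_add_of_nonneg _ _ zero_le_one (by linarith)]
      congr 1
      ring
    rw [this]
    gcongr
    exact le_max_right _ _
  have hctop : c ^ (p.toReal - 1) ≠ ⊤ :=
    ENNReal.rpow_ne_top_of_nonneg (by linarith) integrable_decayWeight.2.ne
  have hmeas : AEMeasurable (Function.uncurry fun y x : E n =>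
      ‖g x‖ₑ ^ p.toReal * ‖decayWeight (x - y)‖ₑ) (volume.prod volume) := by
    refine AEMeasurable.mul ((hg.enorm.pow_const _).comp_quasiMeasurePreserving
      Measure.quasiMeasurePreserving_snd) ?_
    exact (continuous_decayWeight.comp (by fun_prop :
      Continuous fun z : E n × E n => z.2 - z.1)).measurable.enorm.aemeasurable
  calc _ ≤ ∫⁻ y, (∫⁻ x, ‖g x‖ₑ ^ p.toReal * ‖decayWeight (x - y)‖ₑ) * c ^ (p.toReal - 1) :=
        lintegral_mono hpt
    _ = (∫⁻ y, ∫⁻ x, ‖g x‖ₑ ^ p.toReal * ‖decayWeight (x - y)‖ₑ) * c ^ (p.toReal - 1) :=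
        lintegral_mul_const' _ _ hctop
    _ = (∫⁻ x, ∫⁻ y, ‖g x‖ₑ ^ p.toReal * ‖decayWeight (x - y)‖ₑ) * c ^ (p.toReal - 1) := by
        rw [lintegral_lintegral_swap hmeas]
    _ = (∫⁻ x, ‖g x‖ₑ ^ p.toReal * c) * c ^ (p.toReal - 1) := by
        congr 1
        refine lintegral_congr fun x => ?_
        have hm : Measurable fun y : E n => ‖decayWeight (x - y)‖ₑ :=
          (continuous_decayWeight.comp (by fun_prop)).measurable.enorm
        rw [lintegral_const_mul _ hm, hmass']
    _ = (∫⁻ x, ‖g x‖ₑ ^ p.toReal) * (c * c ^ (p.toReal - 1)) := by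
        rw [lintegral_mul_const' _ _ integrable_decayWeight.2.ne, mul_assoc]
    _ ≤ (∫⁻ x, ‖g x‖ₑ ^ p.toReal) * decayMass n ^ p.toReal := by gcongr
    _ = _ := by
        rw [ENNReal.mul_rpow_of_nonneg _ _ r.le, eLpNorm_eq_lintegral_rpow_enorm_toReal hp0 hp',
          ← ENNReal.rpow_mul, one_div_mul_cancel r.ne', ENNReal.rpow_one, mul_comm]

variable {K : E n → ℂ} {A : ℝ} {g : E n → ℂ}

theorem enorm_kernel_le (hA : 0 ≤ A) (hK : ∀ x, ‖K x‖ ≤ A * decayWeight x) (x : E n) :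
    ‖K x‖ₑ ≤ ENNReal.ofReal A * ‖decayWeight x‖ₑ := by
  rw [Real.enorm_of_nonneg (decayWeight_nonneg x), ← ENNReal.ofReal_mul hA,
    ← ofReal_norm]
  exact ENNReal.ofReal_le_ofReal (hK x)

theorem lintegral_enorm_mul_kernel_le (hA : 0 ≤ A) (hK : ∀ x, ‖K x‖ ≤ A * decayWeight x) (y : E n) :
    ∫⁻ x, ‖g x * K (x - y)‖ₑ ≤
      ENNReal.ofReal A * ∫⁻ x, ‖g x‖ₑ * ‖decayWeight (x - y)‖ₑ := by
  rw [← lintegral_const_mul' _ _ ENNReal.ofReal_ne_top]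
  refine lintegral_mono fun x => ?_
  rw [enorm_mul, mul_left_comm]
  gcongr
  exact enorm_kernel_le hA hK _

theorem aestronglyMeasurable_prod_mul_kernel (hKc : Continuous K)
    (hg : AEStronglyMeasurable g volume) :
    AEStronglyMeasurable (fun z : E n × E n => g z.2 * K (z.2 - z.1)) (volume.prod volume) :=
  hg.comp_snd.mul (hKc.comp (by fun_prop)).aestronglyMeasurable

/-- The bounds L^{p₁} → L^{p₁} (Young) and L^{p₁} → L^∞ (Hölder) have the same constant, and
`eLpNorm_le_of_enorm_le` yields every p₂ between them. -/
theorem memLp_convolution_kernel {p₁ p₂ : ℝ≥0∞} (hp₁ : 1 ≤ p₁) (hp : p₁ ≤ p₂)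
    (hKc : Continuous K) (hA : 0 ≤ A) (hK : ∀ x, ‖K x‖ ≤ A * decayWeight x)
    (hg : MemLp g p₁ volume) :
    MemLp (fun y => ∫ x, g x * K (x - y)) p₂ volume ∧
      eLpNorm (fun y => ∫ x, g x * K (x - y)) p₂ volume ≤
        decayMass n * ENNReal.ofReal A * eLpNorm g p₁ volume := by
  set D := decayMass n * ENNReal.ofReal A * eLpNorm g p₁ volume with hD
  have hDtop : D ≠ ⊤ := ENNReal.mul_ne_top (ENNReal.mul_ne_top decayMass_ne_top
    ENNReal.ofReal_ne_top) hg.2.ne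
  have hle : ∀ y, ‖∫ x, g x * K (x - y)‖ₑ ≤
      ENNReal.ofReal A * ∫⁻ x, ‖g x‖ₑ * ‖decayWeight (x - y)‖ₑ := fun y =>
    (enorm_integral_le_lintegral_enorm _).trans (lintegral_enorm_mul_kernel_le hA hK y)
  have hb : ∀ y, ‖∫ x, g x * K (x - y)‖ₑ ≤ D := fun y => by
    refine (hle y).trans ?_
    rw [hD, mul_comm (decayMass n), mul_assoc]
    gcongr
    exact lintegral_enorm_mul_decayWeight_le hp₁ hg.1 y
  have hmeas : AEStronglyMeasurable (fun y => ∫ x, g x * K (x - y)) volume :=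
    (aestronglyMeasurable_prod_mul_kernel hKc hg.1).integral_prod_right'
  have h1 : eLpNorm (fun y => ∫ x, g x * K (x - y)) p₁ volume ≤ D := by
    rcases eq_or_ne p₁ ⊤ with h | h
    · rw [h, eLpNorm_exponent_top]
      exact eLpNormEssSup_le_of_ae_enorm_bound (Filter.Eventually.of_forall hb)
    have hp0 : p₁ ≠ 0 := (one_pos.trans_le hp₁).ne'
    have r : 0 < p₁.toReal := ENNReal.toReal_pos hp0 h
    rw [eLpNorm_eq_lintegral_rpow_enorm_toReal hp0 h, one_div, ENNReal.rpow_inv_le_iff r]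
    calc _ ≤ ∫⁻ y, ENNReal.ofReal A ^ p₁.toReal *
          (∫⁻ x, ‖g x‖ₑ * ‖decayWeight (x - y)‖ₑ) ^ p₁.toReal := by
          refine lintegral_mono fun y => ?_
          rw [← ENNReal.mul_rpow_of_nonneg _ _ r.le]
          exact ENNReal.rpow_le_rpow (hle y) r.le
      _ = ENNReal.ofReal A ^ p₁.toReal *
          ∫⁻ y, (∫⁻ x, ‖g x‖ₑ * ‖decayWeight (x - y)‖ₑ) ^ p₁.toReal :=
          lintegral_const_mul' _ _ (ENNReal.rpow_ne_top_of_nonneg r.le ENNReal.ofReal_ne_top)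
      _ ≤ ENNReal.ofReal A ^ p₁.toReal * (decayMass n * eLpNorm g p₁ volume) ^ p₁.toReal := by
          gcongr
          exact lintegral_rpow_convolution_le hp₁ h hg.1
      _ = D ^ p₁.toReal := by
          rw [← ENNReal.mul_rpow_of_nonneg _ _ r.le, hD, ← mul_assoc,
            mul_comm (decayMass n)]
  have h2 := eLpNorm_le_of_enorm_le hp₁ hp hb h1
  exact ⟨⟨hmeas, h2.trans_lt hDtop.lt_top⟩, h2⟩

theorem integral_mul_convolution_eq {p : ℝ≥0∞} (hp : 1 ≤ p) (hKc : Continuous K) (hA : 0 ≤ A)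
    (hK : ∀ x, ‖K x‖ ≤ A * decayWeight x) (hg : MemLp g p volume) (ψ : 𝓢(E n, ℂ)) :
    ∫ x, g x * ∫ y, K (x - y) * ψ y = ∫ y, (∫ x, g x * K (x - y)) * ψ y := by
  have hint : Integrable (Function.uncurry fun y x : E n => g x * K (x - y) * ψ y)
      (volume.prod volume) := by
    have hm : AEStronglyMeasurable (Function.uncurry fun y x : E n => g x * K (x - y) * ψ y)
        (volume.prod volume) := (aestronglyMeasurable_prod_mul_kernel hKc hg.1).mul
      (ψ.continuous.comp continuous_fst).aestronglyMeasurable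
    refine ⟨hm, ?_⟩
    rw [HasFiniteIntegral, lintegral_prod _ hm.enorm]
    set D := ENNReal.ofReal A * (decayMass n * eLpNorm g p volume) with hD
    have hDtop : D ≠ ⊤ := ENNReal.mul_ne_top ENNReal.ofReal_ne_top
      (ENNReal.mul_ne_top decayMass_ne_top hg.2.ne)
    calc _ ≤ ∫⁻ y, D * ‖ψ y‖ₑ := by
          refine lintegral_mono fun y => ?_
          simp only [Function.uncurry]
          simp_rw [enorm_mul _ (ψ y)]
          rw [lintegral_mul_const' _ _ enorm_ne_top]
          refine mul_le_mul' ((lintegral_enorm_mul_kernel_le hA hK y).trans ?_) le_rfl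
          rw [hD]
          refine mul_le_mul' le_rfl ?_
          exact lintegral_enorm_mul_decayWeight_le hp hg.1 y
      _ = D * ∫⁻ y, ‖ψ y‖ₑ := lintegral_const_mul' _ _ hDtop
      _ < ⊤ := ENNReal.mul_lt_top hDtop.lt_top (ψ.integrable (μ := volume)).2
  have hsw := integral_integral_swap hint
  simp_rw [← integral_mul_const]
  rw [hsw]
  simp_rw [← integral_const_mul, mul_assoc]

end Young

/-! ### Fourier multipliers with Schwartz symbols -/

section Kernel

variable {n : ℕ}

theorem two_pi_ne_zero : (2 * Real.pi) ≠ 0 := by positivity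

/-- The dilate `w ↦ b (2π w)`. -/
def dilateTwoPi (n : ℕ) : 𝓢(E n, ℂ) →L[ℂ] 𝓢(E n, ℂ) :=
  compCLMOfContinuousLinearEquiv ℂ (dilation n two_pi_ne_zero)

theorem dilateTwoPi_apply (b : 𝓢(E n, ℂ)) (w : E n) :
    dilateTwoPi n b w = b ((2 * Real.pi) • w) := rfl

/-- The convolution kernel of the Fourier multiplier with symbol `ξ ↦ b (2πξ - κ)`. -/
def multiplierKernel (b : 𝓢(E n, ℂ)) (κ x : E n) : ℂ :=
  Complex.exp (((-inner ℝ κ x : ℝ) : ℂ) * Complex.I) * 𝓕 (dilateTwoPi n b) x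

theorem continuous_multiplierKernel (b : 𝓢(E n, ℂ)) (κ : E n) :
    Continuous (multiplierKernel b κ) :=
  Continuous.mul (by fun_prop) (SchwartzMap.continuous _)

theorem hasTemperateGrowth_dilate_sub {b : E n → ℂ} (hb : b.HasTemperateGrowth) (κ : E n) :
    (fun ξ => b ((2 * Real.pi) • ξ - κ)).HasTemperateGrowth := by
  have h : (fun ξ : E n => (2 * Real.pi) • ξ - κ).HasTemperateGrowth :=
    (dilation n two_pi_ne_zero).hasTemperateGrowth.sub (Function.HasTemperateGrowth.const κ)
  exact hb.comp h

theorem integral_cexp_mul_dilate_sub (b : 𝓢(E n, ℂ)) (κ x : E n) :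
    ∫ v, Complex.exp (((-2 * Real.pi * inner ℝ v x : ℝ) : ℂ) * Complex.I) *
      b ((2 * Real.pi) • v - κ) = multiplierKernel b κ x := by
  rw [← integral_add_right_eq_self _ ((2 * Real.pi)⁻¹ • κ), multiplierKernel, fourier_coe,
    Real.fourier_eq', ← integral_const_mul]
  refine integral_congr_ae (Filter.Eventually.of_forall fun w => ?_)
  simp only [smul_add, smul_smul, mul_inv_cancel₀ two_pi_ne_zero, one_smul, add_sub_cancel_right,
    smul_eq_mul, dilateTwoPi_apply]
  rw [← mul_assoc, ← Complex.exp_add, ← add_mul, ← Complex.ofReal_add]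
  congr 4
  rw [inner_add_left, inner_smul_left]
  simp only [conj_trivial]
  have := two_pi_ne_zero
  field_simp
  ring

theorem integrable_dilate_sub (b : 𝓢(E n, ℂ)) (κ : E n) :
    Integrable fun v : E n => b ((2 * Real.pi) • v - κ) := by
  have h := ((dilateTwoPi n b).integrable (μ := volume)).comp_sub_right ((2 * Real.pi)⁻¹ • κ)
  refine h.congr (Filter.Eventually.of_forall fun v => ?_)
  simp only [dilateTwoPi_apply, smul_sub, smul_smul, mul_inv_cancel₀ two_pi_ne_zero, one_smul]

theorem fourier_smulLeftCLM_fourierInv (b : 𝓢(E n, ℂ)) (κ : E n) (ψ : 𝓢(E n, ℂ)) (x : E n) :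
    𝓕 (smulLeftCLM ℂ (fun ξ : E n => b ((2 * Real.pi) • ξ - κ)) (𝓕⁻ ψ)) x =
      ∫ y, multiplierKernel b κ (x - y) * ψ y := by
  have ht := hasTemperateGrowth_dilate_sub b.hasTemperateGrowth κ
  have hint : Integrable (Function.uncurry fun v y : E n =>
      Complex.exp (((-2 * Real.pi * inner ℝ v (x - y) : ℝ) : ℂ) * Complex.I) *
        (b ((2 * Real.pi) • v - κ) * ψ y)) (volume.prod volume) := by
    have h := (integrable_dilate_sub b κ).mul_prod (ψ.integrable (μ := volume))
    have hc : Continuous fun z : E n × E n =>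
        Complex.exp (((-2 * Real.pi * inner ℝ z.1 (x - z.2) : ℝ) : ℂ) * Complex.I) := by
      fun_prop
    refine h.mono (hc.aestronglyMeasurable.mul h.1) (Filter.Eventually.of_forall fun z => ?_)
    simp only [Function.uncurry]
    rw [norm_mul]
    exact mul_le_of_le_one_left (norm_nonneg _) (norm_cexp_ofReal_mul_I_le _)
  rw [fourier_coe, Real.fourier_eq']
  have h1 : ∀ v : E n, Complex.exp (((-2 * Real.pi * inner ℝ v x : ℝ) : ℂ) * Complex.I) •
      (smulLeftCLM ℂ (fun ξ : E n => b ((2 * Real.pi) • ξ - κ)) (𝓕⁻ ψ)) v =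
      ∫ y, Complex.exp (((-2 * Real.pi * inner ℝ v (x - y) : ℝ) : ℂ) * Complex.I) *
        (b ((2 * Real.pi) • v - κ) * ψ y) := by
    intro v
    rw [smulLeftCLM_apply_apply ht, fourierInv_coe, Real.fourierInv_eq', smul_eq_mul, smul_eq_mul,
      ← integral_const_mul, ← integral_const_mul]
    refine integral_congr_ae (Filter.Eventually.of_forall fun y => ?_)
    simp only [smul_eq_mul]
    have : Complex.exp (((-2 * Real.pi * inner ℝ v (x - y) : ℝ) : ℂ) * Complex.I) =
        Complex.exp (((-2 * Real.pi * inner ℝ v x : ℝ) : ℂ) * Complex.I) *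
          Complex.exp (((2 * Real.pi * inner ℝ y v : ℝ) : ℂ) * Complex.I) := by
      rw [← Complex.exp_add, ← add_mul, ← Complex.ofReal_add]
      congr 3
      rw [inner_sub_right, real_inner_comm v y]
      ring
    rw [this]
    ring
  rw [integral_congr_ae (Filter.Eventually.of_forall h1), integral_integral_swap hint]
  refine integral_congr_ae (Filter.Eventually.of_forall fun y => ?_)
  simp only
  rw [← integral_cexp_mul_dilate_sub, ← integral_mul_const]
  simp_rw [mul_assoc]

/-- Translating the symbol by κ only modulates the kernel, so its modulus does not depend on κ.
Continuity of the Fourier transform on Schwartz space does the rest. -/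
theorem exists_seminorm_bound_multiplierKernel (n : ℕ) :
    ∃ (s : Finset (ℕ × ℕ)) (C : ℝ), 0 < C ∧ ∀ (b : 𝓢(E n, ℂ)) (κ x : E n),
      ‖multiplierKernel b κ x‖ ≤
        C * s.sup (schwartzSeminormFamily ℂ (E n) ℂ) b * decayWeight x := by
  set L : 𝓢(E n, ℂ) →L[ℂ] 𝓢(E n, ℂ) :=
    (FourierTransform.fourierCLM ℂ 𝓢(E n, ℂ)).comp (dilateTwoPi n) with hL
  set Q : Seminorm ℂ 𝓢(E n, ℂ) :=
    (Finset.Iic ((n + 1, 0) : ℕ × ℕ)).sup (schwartzSeminormFamily ℂ (E n) ℂ) with hQ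
  have hQc : Continuous Q :=
    (schwartz_withSeminorms ℂ (E n) ℂ).finset_sups.continuous_seminorm (Finset.Iic (n + 1, 0))
  obtain ⟨s, C, hC, hle⟩ := Seminorm.bound_of_continuous (schwartz_withSeminorms ℂ (E n) ℂ)
    (Q.comp L.toLinearMap) (hQc.comp L.continuous)
  refine ⟨s, 2 ^ (n + 1) * C, by positivity, fun b κ x => ?_⟩
  have h1 := one_add_le_sup_seminorm_apply (𝕜 := ℂ) (m := (n + 1, 0)) (k := n + 1) (n := 0)
    le_rfl le_rfl (L b) x
  rw [norm_iteratedFDeriv_zero] at h1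
  have h2 : Q (L b) ≤ C * s.sup (schwartzSeminormFamily ℂ (E n) ℂ) b := hle b
  have h3 : ‖multiplierKernel b κ x‖ = ‖L b x‖ := by
    rw [multiplierKernel, norm_mul, Complex.norm_exp_ofReal_mul_I, one_mul]
    rfl
  have hx := japaneseBracket_pos x
  rw [h3, decayWeight, Real.rpow_neg hx.le, ← div_eq_mul_inv,
    le_div_iff₀ (Real.rpow_pos_of_pos hx _)]
  have h4 : japaneseBracket x ^ ((n : ℝ) + 1) ≤ (1 + ‖x‖) ^ (n + 1) := by
    rw [← Nat.cast_succ, Real.rpow_natCast]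
    gcongr
    exact japaneseBracket_le_one_add_norm x
  calc ‖L b x‖ * japaneseBracket x ^ ((n : ℝ) + 1) ≤ ‖L b x‖ * (1 + ‖x‖) ^ (n + 1) := by gcongr
    _ = (1 + ‖x‖) ^ (n + 1) * ‖L b x‖ := mul_comm _ _
    _ ≤ 2 ^ (n + 1) * Q (L b) := h1
    _ ≤ 2 ^ (n + 1) * (C * s.sup (schwartzSeminormFamily ℂ (E n) ℂ) b) := by gcongr
    _ = _ := by ring

/-! ### The `L^p` norm of a distribution -/

theorem distLpNorm_le_of_memLp {p : ℝ≥0∞} {u : 𝓢'(E n, ℂ)} {g : E n → ℂ} (hg : MemLp g p volume)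
    (hu : ∀ ψ : 𝓢(E n, ℂ), u ψ = ∫ x, g x * ψ x) : distLpNorm p u ≤ eLpNorm g p volume :=
  iInf₂_le_of_le g hg (iInf_le _ hu)

theorem le_distLpNorm {p : ℝ≥0∞} {u : 𝓢'(E n, ℂ)} {c : ℝ≥0∞}
    (h : ∀ g : E n → ℂ, MemLp g p volume → (∀ ψ : 𝓢(E n, ℂ), u ψ = ∫ x, g x * ψ x) →
      c ≤ eLpNorm g p volume) : c ≤ distLpNorm p u :=
  le_iInf fun g => le_iInf fun hg => le_iInf fun hu => h g hg hu

theorem exists_memLp_of_distLpNorm_lt {p : ℝ≥0∞} {u : 𝓢'(E n, ℂ)} {c : ℝ≥0∞}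
    (h : distLpNorm p u < c) : ∃ g : E n → ℂ, MemLp g p volume ∧
      (∀ ψ : 𝓢(E n, ℂ), u ψ = ∫ x, g x * ψ x) ∧ eLpNorm g p volume < c := by
  simp only [distLpNorm, iInf_lt_iff] at h
  obtain ⟨g, hg, hu, hc⟩ := h
  exact ⟨g, hg, hu, hc⟩

theorem integrable_memLp_mul_schwartz {p : ℝ≥0∞} (hp : 1 ≤ p) {g : E n → ℂ}
    (hg : MemLp g p volume) (ψ : 𝓢(E n, ℂ)) : Integrable fun x => g x * ψ x := by
  have := ENNReal.HolderConjugate.conjExponent hp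
  exact memLp_one_iff_integrable.1 ((ψ.memLp p.conjExponent volume).mul hg (r := 1))

theorem distLpNorm_zero (p : ℝ≥0∞) : distLpNorm p (0 : 𝓢'(E n, ℂ)) = 0 := by
  refine le_antisymm ?_ bot_le
  refine (distLpNorm_le_of_memLp (g := fun _ => 0) MemLp.zero' fun ψ => ?_).trans_eq ?_
  · simp
  · exact eLpNorm_zero'

theorem distLpNorm_add_le {p : ℝ≥0∞} (hp : 1 ≤ p) (u v : 𝓢'(E n, ℂ)) :
    distLpNorm p (u + v) ≤ distLpNorm p u + distLpNorm p v := by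
  refine ENNReal.le_of_forall_pos_le_add fun ε hε htop => ?_
  have hu := (ENNReal.add_lt_top.1 htop).1
  have hv := (ENNReal.add_lt_top.1 htop).2
  have hε2 : (0 : ℝ≥0∞) < (ε / 2 : ℝ≥0) := by exact_mod_cast half_pos hε
  obtain ⟨g, hg, hgu, hgc⟩ := exists_memLp_of_distLpNorm_lt
    (ENNReal.lt_add_right hu.ne hε2.ne')
  obtain ⟨h, hh, hhv, hhc⟩ := exists_memLp_of_distLpNorm_lt
    (ENNReal.lt_add_right hv.ne hε2.ne')
  refine (distLpNorm_le_of_memLp (hg.add hh) fun ψ => ?_).trans ?_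
  · rw [show (u + v) ψ = u ψ + v ψ from rfl, hgu, hhv, ← integral_add
      (integrable_memLp_mul_schwartz hp hg ψ) (integrable_memLp_mul_schwartz hp hh ψ)]
    simp [add_mul]
  · refine (eLpNorm_add_le hg.1 hh.1 hp).trans ((add_le_add hgc.le hhc.le).trans_eq ?_)
    rw [add_add_add_comm, ← ENNReal.coe_add, add_halves]

theorem distLpNorm_sum_le {p : ℝ≥0∞} (hp : 1 ≤ p) {ι : Type*} (s : Finset ι)
    (u : ι → 𝓢'(E n, ℂ)) : distLpNorm p (∑ i ∈ s, u i) ≤ ∑ i ∈ s, distLpNorm p (u i) := by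
  classical
  induction s using Finset.induction_on with
  | empty => simp [distLpNorm_zero]
  | insert i s hi ih =>
    rw [Finset.sum_insert hi, Finset.sum_insert hi]
    exact (distLpNorm_add_le hp _ _).trans (by gcongr)

theorem enorm_apply_le_distLpNorm {p : ℝ≥0∞} (hp : 1 ≤ p) (u : 𝓢'(E n, ℂ)) (ψ : 𝓢(E n, ℂ)) :
    ‖u ψ‖ₑ ≤ distLpNorm p u * eLpNorm ψ p.conjExponent volume := by
  have hc := ENNReal.HolderConjugate.conjExponent hp
  -- The estimate is proved after division by the norm of ψ, so that it passes to the infimum over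
  -- representing functions; norm zero means ψ = 0 and is treated apart.
  rcases eq_or_ne (eLpNorm ψ p.conjExponent volume) 0 with h0 | h0
  · have h1 : (ψ : E n → ℂ) =ᵐ[volume] 0 := (eLpNorm_eq_zero_iff
      ψ.continuous.aestronglyMeasurable
        (one_pos.trans_le (ENNReal.HolderConjugate.one_le p.conjExponent p)).ne').1 h0
    have h2 : ψ = 0 := by
      ext x
      exact congrFun ((ψ.continuous.ae_eq_iff_eq volume continuous_zero).1 h1) x
    rw [h2, map_zero, enorm_zero]
    exact bot_le
  have htop : eLpNorm ψ p.conjExponent volume ≠ ⊤ := (ψ.memLp p.conjExponent volume).2.ne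
  rw [← ENNReal.div_le_iff h0 htop]
  refine le_distLpNorm fun g hg hu => ?_
  rw [ENNReal.div_le_iff h0 htop, hu]
  refine (enorm_integral_le_lintegral_enorm _).trans ?_
  rw [← eLpNorm_one_eq_lintegral_enorm]
  have hψ : AEStronglyMeasurable (fun x => ψ x) volume := ψ.continuous.aestronglyMeasurable
  have h3 := eLpNorm_smul_le_mul_eLpNorm (p := p) (q := p.conjExponent) (r := 1) hψ hg.1
  exact h3

/-- A Fourier multiplier with symbol `b (2πξ - κ)`, `b` a Schwartz function, is bounded from `L^p₁`
to `L^p₂`, with a bound that depends only on finitely many seminorms of `b`. -/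
theorem exists_distLpNorm_fourierMultiplier_le {p₁ p₂ : ℝ≥0∞} (hp₁ : 1 ≤ p₁) (hp : p₁ ≤ p₂) :
    ∃ (s : Finset (ℕ × ℕ)) (C : ℝ), 0 < C ∧ ∀ (b : 𝓢(E n, ℂ)) (B : ℝ), 0 < B →
      s.sup (schwartzSeminormFamily ℂ (E n) ℂ) b ≤ B → ∀ (κ : E n) (u : 𝓢'(E n, ℂ)),
      distLpNorm p₂ (TemperedDistribution.fourierMultiplierCLM ℂ
        (fun ξ : E n => b ((2 * Real.pi) • ξ - κ)) u) ≤
        ENNReal.ofReal (C * B) * distLpNorm p₁ u := by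
  obtain ⟨s, C, hC, h⟩ := exists_seminorm_bound_multiplierKernel n
  have hmass : 1 ≤ (decayMass n).toReal := by
    rw [← ENNReal.toReal_one]
    exact ENNReal.toReal_mono decayMass_ne_top (le_max_left _ _)
  refine ⟨s, (decayMass n).toReal * C, by positivity, fun b B hB hbB κ u => ?_⟩
  have hK : ∀ x, ‖multiplierKernel b κ x‖ ≤ C * B * decayWeight x := fun x =>
    (h b κ x).trans (by have := decayWeight_nonneg x; gcongr)
  have hc0 : ENNReal.ofReal ((decayMass n).toReal * C * B) ≠ 0 := by
    rw [Ne, ENNReal.ofReal_eq_zero, not_le]; positivity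
  rw [mul_comm (ENNReal.ofReal _), ← ENNReal.div_le_iff hc0 ENNReal.ofReal_ne_top]
  refine le_distLpNorm fun g hg hu => ?_
  rw [ENNReal.div_le_iff hc0 ENNReal.ofReal_ne_top]
  obtain ⟨hm, hle⟩ := memLp_convolution_kernel hp₁ hp (continuous_multiplierKernel b κ)
    (by positivity : 0 ≤ C * B) hK hg
  refine (distLpNorm_le_of_memLp hm fun ψ => ?_).trans (hle.trans_eq ?_)
  · rw [TemperedDistribution.fourierMultiplierCLM_apply_apply, hu]
    simp_rw [fourier_smulLeftCLM_fourierInv]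
    exact integral_mul_convolution_eq hp₁ (continuous_multiplierKernel b κ)
      (by positivity : 0 ≤ C * B) hK hg ψ
  · rw [mul_comm (eLpNorm g p₁ volume), mul_assoc (decayMass n).toReal,
      ENNReal.ofReal_mul ENNReal.toReal_nonneg, ENNReal.ofReal_toReal decayMass_ne_top]

end Kernel

/-! ### Localization of a symbol -/

section Localize

variable {n : ℕ}

theorem hasTemperateGrowth_comp_add {M : E n → ℂ} (hM : M.HasTemperateGrowth) (κ : E n) :
    (fun x => M (x + κ)).HasTemperateGrowth :=
  hM.comp (Function.HasTemperateGrowth.id'.add (Function.HasTemperateGrowth.const κ))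

/-- By Leibniz and Peetre, derivatives of M at x + κ are O(⟨κ⟩^a ⟨x⟩^{|a|}), and the growth in x is
absorbed by the decay of Φ. The bound is thus uniform in κ apart from ⟨κ⟩^a. -/
theorem exists_seminorm_localize_le {a : ℝ} {M : E n → ℂ} (hM : IsSymbol a M) (Φ : 𝓢(E n, ℂ))
    (s : Finset (ℕ × ℕ)) : ∃ C : ℝ, 0 < C ∧ ∀ κ : E n,
      s.sup (schwartzSeminormFamily ℂ (E n) ℂ) (smulLeftCLM ℂ (fun x => M (x + κ)) Φ) ≤
        C * japaneseBracket κ ^ a := by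
  choose D hD0 hD using hM.bound
  set K := ⌈|a|⌉₊ with hK
  set S : ℕ → ℕ → ℝ := fun k i =>
    2 ^ (k + K) * ((Finset.Iic (k + K, i)).sup fun m => SchwartzMap.seminorm ℝ m.1 m.2) Φ with hS
  have hS0 : ∀ k i, 0 ≤ S k i := fun k i => by positivity
  set c : ℕ × ℕ → ℝ := fun z => ∑ i ∈ Finset.range (z.2 + 1),
    (z.2.choose i : ℝ) * (D i * 2 ^ |a|) * S z.1 (z.2 - i) with hc
  have hc0 : ∀ z, 0 ≤ c z := fun z => Finset.sum_nonneg fun i _ =>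
    mul_nonneg (mul_nonneg (Nat.cast_nonneg _) (mul_nonneg (hD0 i) (by positivity))) (hS0 _ _)
  have hsum0 : 0 ≤ ∑ z ∈ s, c z := Finset.sum_nonneg fun z _ => hc0 z
  refine ⟨1 + ∑ z ∈ s, c z, by positivity, fun κ => ?_⟩
  have hκ := japaneseBracket_rpow_pos κ a
  refine Seminorm.finset_sup_apply_le (by positivity) fun z hz => ?_
  have hmain : ∀ x : E n, ‖x‖ ^ z.1 * ‖iteratedFDeriv ℝ z.2
      (smulLeftCLM ℂ (fun x => M (x + κ)) Φ) x‖ ≤ c z * japaneseBracket κ ^ a := by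
    intro x
    have ht := hasTemperateGrowth_comp_add hM.hasTemperateGrowth κ
    have hfun : (smulLeftCLM ℂ (fun x => M (x + κ)) Φ : E n → ℂ) = fun x => M (x + κ) * Φ x := by
      ext x; rw [smulLeftCLM_apply_apply ht, smul_eq_mul]
    rw [hfun]
    have h1 := norm_iteratedFDeriv_mul_le (𝕜 := ℝ) (N := ∞) ht.1 (Φ.smooth ⊤) x (n := z.2)
      (by exact_mod_cast le_top)
    have hterm : ∀ i ∈ Finset.range (z.2 + 1), ‖x‖ ^ z.1 * ((z.2.choose i : ℝ) *
        ‖iteratedFDeriv ℝ i (fun x => M (x + κ)) x‖ * ‖iteratedFDeriv ℝ (z.2 - i) Φ x‖) ≤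
        (z.2.choose i : ℝ) * (D i * 2 ^ |a|) * S z.1 (z.2 - i) * japaneseBracket κ ^ a := by
      intro i _
      have h2 : ‖iteratedFDeriv ℝ i (fun x => M (x + κ)) x‖ ≤
          D i * (2 ^ |a| * japaneseBracket κ ^ a * (1 + ‖x‖) ^ K) := by
        rw [iteratedFDeriv_comp_add_right]
        refine (hD i (x + κ)).trans (mul_le_mul_of_nonneg_left ?_ (hD0 i))
        rw [add_comm x]
        refine (japaneseBracket_add_rpow_le κ x a).trans ?_
        gcongr
        calc japaneseBracket x ^ |a| ≤ japaneseBracket x ^ (K : ℝ) :=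
              Real.rpow_le_rpow_of_exponent_le (one_le_japaneseBracket x) (Nat.le_ceil _)
          _ = japaneseBracket x ^ K := Real.rpow_natCast _ _
          _ ≤ _ := by
              gcongr
              · exact (japaneseBracket_pos x).le
              · exact japaneseBracket_le_one_add_norm x
      have h3 : (1 + ‖x‖) ^ (z.1 + K) * ‖iteratedFDeriv ℝ (z.2 - i) Φ x‖ ≤ S z.1 (z.2 - i) :=
        one_add_le_sup_seminorm_apply (𝕜 := ℝ) (m := (z.1 + K, z.2 - i)) le_rfl le_rfl Φ x
      have h4 : ‖x‖ ^ z.1 ≤ (1 + ‖x‖) ^ z.1 := by gcongr; linarith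
      have hDi := hD0 i
      calc _ ≤ (1 + ‖x‖) ^ z.1 * ((z.2.choose i : ℝ) *
            (D i * (2 ^ |a| * japaneseBracket κ ^ a * (1 + ‖x‖) ^ K)) *
              ‖iteratedFDeriv ℝ (z.2 - i) Φ x‖) := by gcongr
        _ = (z.2.choose i : ℝ) * (D i * 2 ^ |a|) * ((1 + ‖x‖) ^ (z.1 + K) *
            ‖iteratedFDeriv ℝ (z.2 - i) Φ x‖) * japaneseBracket κ ^ a := by rw [pow_add]; ring
        _ ≤ _ := by gcongr
    calc _ ≤ ‖x‖ ^ z.1 * _ := mul_le_mul_of_nonneg_left h1 (by positivity)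
      _ ≤ _ := by
        rw [Finset.mul_sum, hc, Finset.sum_mul]
        exact Finset.sum_le_sum hterm
  have h5 : schwartzSeminormFamily ℂ (E n) ℂ z (smulLeftCLM ℂ (fun x => M (x + κ)) Φ) ≤
      c z * japaneseBracket κ ^ a :=
    SchwartzMap.seminorm_le_bound ℂ z.1 z.2 _ (mul_nonneg (hc0 z) hκ.le) hmain
  refine h5.trans ?_
  gcongr
  have := Finset.single_le_sum (fun z _ => hc0 z) hz
  linarith

end Localize

/-! ### The window and the integer lattice -/

section Window

variable {n : ℕ}

theorem latticePoint_add (k l : Fin n → ℤ) :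
    latticePoint (k + l) = latticePoint k + latticePoint l := by
  ext i; simp [latticePoint]

theorem latticePoint_sub (k l : Fin n → ℤ) :
    latticePoint (k - l) = latticePoint k - latticePoint l := by
  ext i; simp [latticePoint]

/-- The integer vectors with all coordinates between `-L` and `L`. -/
def latticeCube (n L : ℕ) : Finset (Fin n → ℤ) :=
  Fintype.piFinset fun _ => Finset.Icc (-(L : ℤ)) L

theorem mem_latticeCube_of_norm_le {L : ℕ} {l : Fin n → ℤ} (h : ‖latticePoint l‖ ≤ L) :
    l ∈ latticeCube n L := by
  rw [latticeCube, Fintype.mem_piFinset]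
  intro i
  have h1 := (PiLp.norm_apply_le (latticePoint l) i).trans h
  simp only [latticePoint, Real.norm_eq_abs] at h1
  rw [Finset.mem_Icc, ← abs_le]
  exact_mod_cast h1

theorem exists_norm_latticePoint_le (n L : ℕ) :
    ∃ R : ℝ, 0 ≤ R ∧ ∀ l ∈ latticeCube n L, ‖latticePoint l‖ ≤ R :=
  ⟨∑ l ∈ latticeCube n L, ‖latticePoint l‖, Finset.sum_nonneg fun _ _ => norm_nonneg _,
    fun _ hl => Finset.single_le_sum (f := fun l => ‖latticePoint l‖)
      (fun _ _ => norm_nonneg _) hl⟩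

variable {φ : E n → ℂ}

/-- The window as a Schwartz function. -/
def IsPartitionWindow.schwartz (hφ : IsPartitionWindow φ) : 𝓢(E n, ℂ) :=
  hφ.compactSupport.toSchwartzMap hφ.smooth

theorem IsPartitionWindow.schwartz_apply (hφ : IsPartitionWindow φ) (x : E n) :
    hφ.schwartz x = φ x := rfl

theorem IsPartitionWindow.hasTemperateGrowth (hφ : IsPartitionWindow φ) (k : Fin n → ℤ) :
    (fun ξ : E n => φ ((2 * Real.pi) • ξ - latticePoint k)).HasTemperateGrowth :=
  hasTemperateGrowth_dilate_sub hφ.schwartz.hasTemperateGrowth (latticePoint k)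

theorem IsPartitionWindow.exists_radius (hφ : IsPartitionWindow φ) :
    ∃ R : ℝ, 0 ≤ R ∧ ∀ ξ, φ ξ ≠ 0 → ‖ξ‖ ≤ R := by
  obtain ⟨R, hR⟩ := hφ.compactSupport.isCompact.isBounded.exists_norm_le
  exact ⟨max R 0, le_max_right _ _, fun ξ hξ =>
    (hR ξ (subset_tsupport φ hξ)).trans (le_max_left _ _)⟩

/-- A term that does not vanish has |ξ - k - l| ≤ R, hence |l| ≤ R + r ≤ L: the finite sum contains
every nonzero term of the partition. -/
theorem IsPartitionWindow.sum_eq_one (hφ : IsPartitionWindow φ) {R r : ℝ}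
    (hR : ∀ ξ, φ ξ ≠ 0 → ‖ξ‖ ≤ R) {L : ℕ} (hL : R + r ≤ L) {ξ : E n} {k : Fin n → ℤ}
    (hξ : ‖ξ - latticePoint k‖ ≤ r) :
    ∑ l ∈ latticeCube n L, φ (ξ - latticePoint (k + l)) = 1 := by
  have h := (Equiv.addLeft k).hasSum_iff.2 (hφ.partition ξ)
  refine (hasSum_sum_of_ne_finset_zero fun l hl => ?_).unique h
  by_contra hne
  refine hl (mem_latticeCube_of_norm_le (le_trans ?_ hL))
  have h1 : ‖ξ - latticePoint (k + l)‖ ≤ R := hR _ hne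
  have h2 : latticePoint l = (ξ - latticePoint k) - (ξ - latticePoint (k + l)) := by
    rw [latticePoint_add]; abel
  rw [h2]
  refine (norm_sub_le _ _).trans ?_
  linarith

/-- On cell k the symbol is b(2πξ - k) with b(x) = M(x + k) φ(x), whose seminorms are O(⟨k⟩^σ). The
kernel estimate then applies uniformly in k. -/
theorem exists_distLpNorm_box_laplacianIteratedAverage_le (hn : 1 ≤ n) (N : ℕ)
    (hφ : IsPartitionWindow φ) {p₁ p₂ : ℝ≥0∞} (hp₁ : 1 ≤ p₁) (hp : p₁ ≤ p₂) :
    ∃ (L : ℕ) (C : ℝ), 0 < C ∧ ∀ (f : 𝓢'(E n, ℂ)) (k : Fin n → ℤ),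
      distLpNorm p₂ (box φ k (laplacianIteratedAverage n N f)) ≤
        ENNReal.ofReal (C * bracket k ^ (2 - ((n : ℝ) - 1) / 2 * N)) *
          ∑ l ∈ latticeCube n L, distLpNorm p₁ (box φ (k + l) f) := by
  obtain ⟨R, hR0, hR⟩ := hφ.exists_radius
  obtain ⟨L, hL⟩ := exists_nat_ge (R + R)
  have hM := isSymbol_averageSymbol hn N
  obtain ⟨s, C, hC, hmul⟩ := exists_distLpNorm_fourierMultiplier_le (n := n) hp₁ hp
  obtain ⟨D, hD, hloc⟩ := exists_seminorm_localize_le hM hφ.schwartz s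
  refine ⟨L, C * D, by positivity, fun f k => ?_⟩
  set b : 𝓢(E n, ℂ) := smulLeftCLM ℂ (fun x => averageSymbol n N (x + latticePoint k)) hφ.schwartz
    with hb
  have hbx : ∀ x, b x = averageSymbol n N (x + latticePoint k) * φ x := fun x => by
    rw [hb, smulLeftCLM_apply_apply (hasTemperateGrowth_comp_add hM.hasTemperateGrowth _),
      hφ.schwartz_apply, smul_eq_mul]
  have htM := hasTemperateGrowth_comp_two_pi hM.hasTemperateGrowth
  have htb := hasTemperateGrowth_dilate_sub b.hasTemperateGrowth (latticePoint k)
  -- Insert the partition of unity: near the support of φ(· - k) only the cells k + l with l in the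
  -- cube contribute.
  have hdecomp : box φ k (laplacianIteratedAverage n N f) =
      ∑ l ∈ latticeCube n L, TemperedDistribution.fourierMultiplierCLM ℂ
        (fun ξ : E n => b ((2 * Real.pi) • ξ - latticePoint k)) (box φ (k + l) f) := by
    have h1 : ∀ l, TemperedDistribution.fourierMultiplierCLM ℂ
        (fun ξ : E n => b ((2 * Real.pi) • ξ - latticePoint k)) (box φ (k + l) f) =
        TemperedDistribution.fourierMultiplierCLM ℂ (fun ξ : E n =>
          φ ((2 * Real.pi) • ξ - latticePoint (k + l)) *
            b ((2 * Real.pi) • ξ - latticePoint k)) f := fun l =>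
      TemperedDistribution.fourierMultiplierCLM_fourierMultiplierCLM_apply
        (hφ.hasTemperateGrowth (k + l)) htb f
    simp_rw [h1]
    rw [laplacianIteratedAverage_eq hn, box,
      TemperedDistribution.fourierMultiplierCLM_fourierMultiplierCLM_apply htM
        (hφ.hasTemperateGrowth k)]
    have h2 := TemperedDistribution.fourierMultiplierCLM_sum ℂ (s := latticeCube n L)
      (g := fun (l : Fin n → ℤ) (ξ : E n) => φ ((2 * Real.pi) • ξ - latticePoint (k + l)) *
            b ((2 * Real.pi) • ξ - latticePoint k))
      (fun l _ => (hφ.hasTemperateGrowth (k + l)).mul htb)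
    have h3 := congrArg (fun T => T f) h2
    simp only [_root_.sum_apply] at h3
    rw [← h3]
    congr 2
    ext ξ
    rw [← Finset.sum_mul, hbx, Pi.mul_apply, sub_add_cancel]
    rcases eq_or_ne (φ ((2 * Real.pi) • ξ - latticePoint k)) 0 with h0 | h0
    · simp [h0]
    · rw [hφ.sum_eq_one hR hL (hR _ h0), one_mul]
  rw [hdecomp, Finset.mul_sum]
  refine (distLpNorm_sum_le (hp₁.trans hp) _ _).trans (Finset.sum_le_sum fun l _ => ?_)
  have := hmul b (D * japaneseBracket (latticePoint k) ^ (2 - ((n : ℝ) - 1) / 2 * N))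
    (mul_pos hD (japaneseBracket_rpow_pos _ _)) (hloc (latticePoint k)) (latticePoint k)
    (box φ (k + l) f)
  rwa [← mul_assoc, ← bracket_eq] at this

end Window

/-! ### Weighted sequence spaces -/

section Sequences

variable {n : ℕ}

/-- The `ℓ^q` norm of a sequence indexed by `ℤⁿ`. -/
def ellNorm (q : ℝ≥0∞) (a : (Fin n → ℤ) → ℝ≥0∞) : ℝ≥0∞ := eLpNorm a q Measure.count

/-- The sequence `⟨k⟩^s a_k`. -/
def weighted (s : ℝ) (a : (Fin n → ℤ) → ℝ≥0∞) (k : Fin n → ℤ) : ℝ≥0∞ :=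
  ENNReal.ofReal (bracket k ^ s) * a k

theorem one_le_bracket (k : Fin n → ℤ) : 1 ≤ bracket k := one_le_japaneseBracket _

theorem bracket_pos (k : Fin n → ℤ) : 0 < bracket k := japaneseBracket_pos _

theorem bracket_rpow_pos (k : Fin n → ℤ) (s : ℝ) : 0 < bracket k ^ s :=
  japaneseBracket_rpow_pos _ _

theorem ellNorm_of_ne_top {q : ℝ≥0∞} (h0 : q ≠ 0) (h : q ≠ ⊤) (a : (Fin n → ℤ) → ℝ≥0∞) :
    ellNorm q a = (∑' k, a k ^ q.toReal) ^ (1 / q.toReal) := by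
  rw [ellNorm, eLpNorm_eq_lintegral_rpow_enorm_toReal h0 h, lintegral_count]
  rfl

theorem ellNorm_top (a : (Fin n → ℤ) → ℝ≥0∞) : ellNorm ⊤ a = ⨆ k, a k := by
  rw [ellNorm, eLpNorm_exponent_top, eLpNormEssSup_count]
  rfl

theorem modulationNorm_eq {φ : E n → ℂ} {s : ℝ} {p q : ℝ≥0∞} (hq : 1 ≤ q) (f : 𝓢'(E n, ℂ)) :
    modulationNorm φ s p q f = ellNorm q (weighted s fun k => distLpNorm p (box φ k f)) := by
  rw [modulationNorm]
  split_ifs with h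
  · rw [h, ellNorm_top]; rfl
  · rw [ellNorm_of_ne_top (one_pos.trans_le hq).ne' h]; rfl

theorem ellNorm_mono {q : ℝ≥0∞} {a b : (Fin n → ℤ) → ℝ≥0∞} (h : ∀ k, a k ≤ b k) :
    ellNorm q a ≤ ellNorm q b :=
  eLpNorm_mono_enorm h

theorem ellNorm_le_const_mul {q c : ℝ≥0∞} {a b : (Fin n → ℤ) → ℝ≥0∞} (h : ∀ k, a k ≤ c * b k) :
    ellNorm q a ≤ c * ellNorm q b :=
  eLpNorm_le_mul_eLpNorm_of_ae_le_mul'' q AEStronglyMeasurable.of_discrete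
    (Filter.Eventually.of_forall h)

theorem ellNorm_comp_add (q : ℝ≥0∞) (a : (Fin n → ℤ) → ℝ≥0∞) (l : Fin n → ℤ) :
    ellNorm q (fun k => a (k + l)) = ellNorm q a :=
  eLpNorm_comp_measurePreserving (g := a) AEStronglyMeasurable.of_discrete
    (measurePreserving_add_right Measure.count l)

theorem ellNorm_sum_le {q : ℝ≥0∞} (hq : 1 ≤ q) {ι : Type*} (s : Finset ι)
    (a : ι → (Fin n → ℤ) → ℝ≥0∞) :
    ellNorm q (fun k => ∑ i ∈ s, a i k) ≤ ∑ i ∈ s, ellNorm q (a i) := by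
  have h := eLpNorm_sum_le (μ := Measure.count) (s := s) (f := a)
    (fun i _ => AEStronglyMeasurable.of_discrete) hq
  have e : (∑ i ∈ s, a i) = fun k => ∑ i ∈ s, a i k := by ext k; simp
  rwa [e] at h

theorem apply_le_ellNorm {q : ℝ≥0∞} (hq : 1 ≤ q) (a : (Fin n → ℤ) → ℝ≥0∞) (k : Fin n → ℤ) :
    a k ≤ ellNorm q a := by
  rcases eq_or_ne q ⊤ with rfl | h
  · rw [ellNorm_top]; exact le_iSup a k
  have h0 : q ≠ 0 := (one_pos.trans_le hq).ne'
  have r := ENNReal.toReal_pos h0 h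
  rw [ellNorm_of_ne_top h0 h, one_div, ENNReal.le_rpow_inv_iff r]
  exact ENNReal.le_tsum k

theorem ellNorm_antitone {q₁ q₂ : ℝ≥0∞} (hq₁ : 1 ≤ q₁) (hq : q₁ ≤ q₂)
    (a : (Fin n → ℤ) → ℝ≥0∞) : ellNorm q₂ a ≤ ellNorm q₁ a :=
  eLpNorm_le_of_enorm_le hq₁ hq (fun k => apply_le_ellNorm hq₁ a k) le_rfl

/-- Sums over finitely many shifts are bounded on weighted sequence spaces. -/
theorem exists_ellNorm_weighted_sum_shift_le (n L : ℕ) (s : ℝ) :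
    ∃ C : ℝ, 0 < C ∧ ∀ q : ℝ≥0∞, 1 ≤ q → ∀ a : (Fin n → ℤ) → ℝ≥0∞,
      ellNorm q (weighted s fun k => ∑ l ∈ latticeCube n L, a (k + l)) ≤
        ENNReal.ofReal C * ellNorm q (weighted s a) := by
  obtain ⟨R, hR0, hR⟩ := exists_norm_latticePoint_le n L
  set c : ℝ := 2 ^ |s| * (1 + R) ^ |s| with hc
  have hc0 : 0 < c := by positivity
  refine ⟨((latticeCube n L).card + 1) * c, by positivity, fun q hq a => ?_⟩
  have hpt : ∀ k, weighted s (fun k => ∑ l ∈ latticeCube n L, a (k + l)) k ≤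
      ENNReal.ofReal c * ∑ l ∈ latticeCube n L, weighted s a (k + l) := by
    intro k
    rw [weighted, Finset.mul_sum, Finset.mul_sum]
    refine Finset.sum_le_sum fun l hl => ?_
    rw [weighted, ← mul_assoc, ← ENNReal.ofReal_mul hc0.le]
    gcongr
    refine japaneseBracket_rpow_le_of_norm_sub_le ?_ s
    rw [latticePoint_add, sub_add_cancel_left, norm_neg]
    exact hR l hl
  calc _ ≤ ENNReal.ofReal c * ellNorm q (fun k => ∑ l ∈ latticeCube n L, weighted s a (k + l)) :=
        ellNorm_le_const_mul hpt
    _ ≤ ENNReal.ofReal c * ∑ l ∈ latticeCube n L, ellNorm q (weighted s a) := by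
        gcongr
        refine (ellNorm_sum_le hq _ _).trans_eq (Finset.sum_congr rfl fun l _ => ?_)
        exact ellNorm_comp_add q (weighted s a) l
    _ = ENNReal.ofReal ((latticeCube n L).card * c) * ellNorm q (weighted s a) := by
        rw [Finset.sum_const, nsmul_eq_mul, ENNReal.ofReal_mul (Nat.cast_nonneg _),
          ENNReal.ofReal_natCast]
        ring
    _ ≤ _ := by
        gcongr
        linarith

theorem ellNorm_mul_le {r q₁ q₂ : ℝ≥0∞} [hr : r.HolderTriple q₁ q₂] (hq₁ : 1 ≤ q₁)
    {w : (Fin n → ℤ) → ℝ} (hw : ∀ k, 0 ≤ w k) (a : (Fin n → ℤ) → ℝ≥0∞)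
    (ha : ellNorm q₁ a ≠ ⊤) :
    ellNorm q₂ (fun k => ENNReal.ofReal (w k) * a k) ≤
      ellNorm r (fun k => ENNReal.ofReal (w k)) * ellNorm q₁ a := by
  -- A finite norm makes every term finite, so Hölder's inequality can be applied to real sequences
  -- without loss.
  have hfin : ∀ k, a k ≠ ⊤ := fun k => ne_top_of_le_ne_top ha (apply_le_ellNorm hq₁ a k)
  have h := eLpNorm_smul_le_mul_eLpNorm (μ := Measure.count) (p := r) (q := q₁) (r := q₂)
    (f := fun k => (a k).toReal) AEStronglyMeasurable.of_discrete (φ := w)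
    AEStronglyMeasurable.of_discrete
  have e1 : eLpNorm (fun k => (a k).toReal) q₁ Measure.count = ellNorm q₁ a := by
    refine eLpNorm_congr_enorm_ae (Filter.Eventually.of_forall fun k => ?_)
    rw [Real.enorm_of_nonneg ENNReal.toReal_nonneg, ENNReal.ofReal_toReal (hfin k)]; rfl
  have e2 : eLpNorm w r Measure.count = ellNorm r fun k => ENNReal.ofReal (w k) := by
    refine eLpNorm_congr_enorm_ae (Filter.Eventually.of_forall fun k => ?_)
    rw [Real.enorm_of_nonneg (hw k)]; rfl
  have e3 : eLpNorm (w • fun k => (a k).toReal) q₂ Measure.count =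
      ellNorm q₂ fun k => ENNReal.ofReal (w k) * a k := by
    refine eLpNorm_congr_enorm_ae (Filter.Eventually.of_forall fun k => ?_)
    rw [Pi.smul_apply', enorm_smul, Real.enorm_of_nonneg (hw k),
      Real.enorm_of_nonneg ENNReal.toReal_nonneg, ENNReal.ofReal_toReal (hfin k)]; rfl
  rwa [e1, e2, e3] at h

theorem latticePoint_injective : Function.Injective (latticePoint : (Fin n → ℤ) → E n) := by
  intro k l h
  ext i
  have := congrArg (fun x : E n => x i) h
  simpa [latticePoint] using this

/-- Comparison with the lattice sum of |k|^{-t} over ℤⁿ; the origin is discarded as a finite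
exception. -/
theorem summable_bracket_rpow {t : ℝ} (ht : (n : ℝ) < t) :
    Summable fun k : Fin n → ℤ => bracket k ^ (-t) := by
  set b := EuclideanSpace.basisFun (Fin n) ℝ with hb
  set Λ := Submodule.span ℤ (Set.range b.toBasis) with hΛ
  have hrank : Module.finrank ℤ Λ = n := by
    rw [ZLattice.rank ℝ Λ]; simp
  have hsum := ZLattice.summable_norm_rpow Λ (-t) (by rw [hrank]; linarith)
  have hmem : ∀ k : Fin n → ℤ, latticePoint k ∈ Λ := by
    intro k
    have : latticePoint k = ∑ i, k i • b.toBasis i := by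
      ext j
      simp [latticePoint, hb, Finset.sum_apply, Pi.single_apply]
    rw [this]
    exact Submodule.sum_mem _ fun i _ => Submodule.smul_mem _ _ (Submodule.subset_span ⟨i, rfl⟩)
  have hinj : Function.Injective fun k : Fin n → ℤ => (⟨latticePoint k, hmem k⟩ : Λ) := by
    intro k l h
    exact latticePoint_injective (congrArg Subtype.val h)
  have h1 := hsum.comp_injective hinj
  refine Summable.of_norm_bounded_eventually h1 ?_
  have h0 : ({0} : Set (Fin n → ℤ))ᶜ ∈ Filter.cofinite := (Set.finite_singleton _).compl_mem_cofinite
  filter_upwards [h0] with k hk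
  rw [Real.norm_of_nonneg (bracket_rpow_pos _ _).le]
  have hne : latticePoint k ≠ 0 := by
    intro h
    apply hk
    refine latticePoint_injective (h.trans ?_)
    ext i; simp [latticePoint]
  refine Real.rpow_le_rpow_of_nonpos (z := -t) (x := ‖latticePoint k‖) (norm_pos_iff.2 hne)
    (norm_le_japaneseBracket _) ?_
  have : (0 : ℝ) ≤ n := Nat.cast_nonneg n
  linarith

theorem weighted_weighted (s t : ℝ) (a : (Fin n → ℤ) → ℝ≥0∞) :
    weighted s (weighted t a) = weighted (s + t) a := by
  ext k
  simp only [weighted]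
  rw [← mul_assoc, ← ENNReal.ofReal_mul (bracket_rpow_pos k s).le,
    ← Real.rpow_add (bracket_pos _)]

/-- The exponent `r` with `1/r = 1/q₂ - 1/q₁`. -/
def gapExponent (q₁ q₂ : ℝ≥0∞) : ℝ≥0∞ := (q₂⁻¹ - q₁⁻¹)⁻¹

section Gap

variable {q₁ q₂ : ℝ≥0∞}

theorem holderTriple_gapExponent (hq : q₂ ≤ q₁) : (gapExponent q₁ q₂).HolderTriple q₁ q₂ :=
  ⟨by rw [gapExponent, inv_inv, tsub_add_cancel_of_le (ENNReal.inv_le_inv.2 hq)]⟩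

theorem gapExponent_ne_top (hq : q₂ < q₁) : gapExponent q₁ q₂ ≠ ⊤ := by
  rw [gapExponent, Ne, ENNReal.inv_eq_top, tsub_eq_zero_iff_le, not_le]
  exact ENNReal.inv_lt_inv.2 hq

theorem inv_toReal_gapExponent (hq₂ : 1 ≤ q₂) (hq : q₂ ≤ q₁) :
    ((gapExponent q₁ q₂).toReal)⁻¹ = q₂⁻¹.toReal - q₁⁻¹.toReal := by
  rw [gapExponent, ENNReal.toReal_inv, inv_inv, ENNReal.toReal_sub_of_le (ENNReal.inv_le_inv.2 hq)]
  exact ENNReal.inv_ne_top.2 (one_pos.trans_le hq₂).ne'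

theorem gapExponent_ne_zero (hq₂ : 1 ≤ q₂) : gapExponent q₁ q₂ ≠ 0 := by
  rw [gapExponent, Ne, ENNReal.inv_eq_zero]
  exact ne_top_of_le_ne_top (ENNReal.inv_ne_top.2 (one_pos.trans_le hq₂).ne') tsub_le_self

theorem gapExponent_toReal_pos (hq₂ : 1 ≤ q₂) (hq : q₂ < q₁) : 0 < (gapExponent q₁ q₂).toReal :=
  ENNReal.toReal_pos (gapExponent_ne_zero hq₂) (gapExponent_ne_top hq)

/-- With 1/r = 1/q₂ - 1/q₁ the hypothesis reads τ r > n, which makes ⟨k⟩^{-τ r} summable. -/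
theorem ellNorm_bracket_rpow_ne_top (hq₂ : 1 ≤ q₂) (hq : q₂ < q₁) {τ : ℝ}
    (hτ : n * (q₂⁻¹.toReal - q₁⁻¹.toReal) < τ) :
    ellNorm (gapExponent q₁ q₂) (fun k : Fin n → ℤ => ENNReal.ofReal (bracket k ^ (-τ))) ≠ ⊤ := by
  have hr := gapExponent_toReal_pos hq₂ hq
  rw [← inv_toReal_gapExponent hq₂ hq.le, ← div_eq_mul_inv, div_lt_iff₀ hr] at hτ
  rw [ellNorm_of_ne_top (gapExponent_ne_zero hq₂) (gapExponent_ne_top hq)]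
  refine ENNReal.rpow_ne_top_of_nonneg (by positivity) ?_
  have h : ∀ k : Fin n → ℤ, ENNReal.ofReal (bracket k ^ (-τ)) ^ (gapExponent q₁ q₂).toReal =
      ENNReal.ofReal (bracket k ^ (-(τ * (gapExponent q₁ q₂).toReal))) := by
    intro k
    rw [ENNReal.ofReal_rpow_of_pos (bracket_rpow_pos k _), ← Real.rpow_mul (bracket_pos k).le,
      neg_mul]
  simp_rw [h]
  rw [← ENNReal.ofReal_tsum_of_nonneg (fun k => (bracket_rpow_pos k _).le) (summable_bracket_rpow hτ)]
  exact ENNReal.ofReal_ne_top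

end Gap

end Sequences

/-! ### Sufficiency -/

section Sufficiency

variable {n : ℕ} {φ : E n → ℂ} {p₁ p₂ q₁ q₂ : ℝ≥0∞} {s₁ s₂ σ : ℝ}

/-- The local estimate costs a factor ⟨k⟩^σ and a finite sum over shifts, and shifts are harmless on
weighted ℓ^q. An embedding of sequence spaces is all that is left to supply. -/
theorem isBoundedOnModulation_of_embedding (hn : 1 ≤ n) (N : ℕ) (hφ : IsPartitionWindow φ)
    (hp₁ : 1 ≤ p₁) (hp : p₁ ≤ p₂) (hq₁ : 1 ≤ q₁) (hq₂ : 1 ≤ q₂)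
    (hσ : σ = 2 - ((n : ℝ) - 1) / 2 * N) {D : ℝ≥0∞} (hD : D ≠ ⊤)
    (hemb : ∀ a : (Fin n → ℤ) → ℝ≥0∞, ellNorm q₁ (weighted s₁ a) ≠ ⊤ →
      ellNorm q₂ (weighted (s₂ + σ) a) ≤ D * ellNorm q₁ (weighted s₁ a)) :
    IsBoundedOnModulation φ s₁ p₁ q₁ s₂ p₂ q₂ (laplacianIteratedAverage n N) := by
  obtain ⟨L, C, hC, hloc⟩ := exists_distLpNorm_box_laplacianIteratedAverage_le hn N hφ hp₁ hp
  obtain ⟨B, hB, hshift⟩ := exists_ellNorm_weighted_sum_shift_le n L (s₂ + σ)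
  have hfin : ENNReal.ofReal C * (ENNReal.ofReal B * D) ≠ ⊤ :=
    ENNReal.mul_ne_top ENNReal.ofReal_ne_top (ENNReal.mul_ne_top ENNReal.ofReal_ne_top hD)
  have key : ∀ f ∈ modulationSpace φ s₁ p₁ q₁,
      modulationNorm φ s₂ p₂ q₂ (laplacianIteratedAverage n N f) ≤
        ENNReal.ofReal C * (ENNReal.ofReal B * D) * modulationNorm φ s₁ p₁ q₁ f := by
    intro f hf
    have hf' : modulationNorm φ s₁ p₁ q₁ f ≠ ⊤ := ne_of_lt hf
    rw [modulationNorm_eq hq₁] at hf' ⊢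
    rw [modulationNorm_eq hq₂]
    set a := fun k => distLpNorm p₁ (box φ k f) with ha
    calc _ ≤ ENNReal.ofReal C *
          ellNorm q₂ (weighted (s₂ + σ) fun k => ∑ l ∈ latticeCube n L, a (k + l)) := by
          refine ellNorm_le_const_mul fun k => ?_
          simp only [weighted]
          calc _ ≤ ENNReal.ofReal (bracket k ^ s₂) * (ENNReal.ofReal (C * bracket k ^ σ) *
                ∑ l ∈ latticeCube n L, a (k + l)) := by
                gcongr
                rw [hσ]
                exact hloc f k
            _ = _ := by
                rw [← mul_assoc, ← mul_assoc, ← ENNReal.ofReal_mul (bracket_rpow_pos k s₂).le,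
                  ← ENNReal.ofReal_mul hC.le, Real.rpow_add (bracket_pos _)]
                rw [mul_left_comm]
      _ ≤ ENNReal.ofReal C * (ENNReal.ofReal B * ellNorm q₂ (weighted (s₂ + σ) a)) := by
          gcongr
          exact hshift q₂ hq₂ a
      _ ≤ ENNReal.ofReal C * (ENNReal.ofReal B * (D * ellNorm q₁ (weighted s₁ a))) := by
          gcongr
          exact hemb a hf'
      _ = _ := by ring
  refine ⟨(ENNReal.ofReal C * (ENNReal.ofReal B * D)).toNNReal, fun f hf => ?_⟩
  rw [ENNReal.coe_toNNReal hfin]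
  exact ⟨(key f hf).trans_lt (ENNReal.mul_lt_top hfin.lt_top hf), key f hf⟩

theorem isBoundedOnModulation_of_le (hn : 1 ≤ n) (N : ℕ) (hφ : IsPartitionWindow φ)
    (hp₁ : 1 ≤ p₁) (hp : p₁ ≤ p₂) (hq₁ : 1 ≤ q₁) (hq : q₁ ≤ q₂)
    (hσ : σ = 2 - ((n : ℝ) - 1) / 2 * N) (hs : s₂ + σ ≤ s₁) :
    IsBoundedOnModulation φ s₁ p₁ q₁ s₂ p₂ q₂ (laplacianIteratedAverage n N) := by
  refine isBoundedOnModulation_of_embedding hn N hφ hp₁ hp hq₁ (hq₁.trans hq) hσ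
    ENNReal.one_ne_top fun a _ => ?_
  rw [one_mul]
  refine (ellNorm_mono fun k => ?_).trans (ellNorm_antitone hq₁ hq _)
  simp only [weighted]
  gcongr
  exact one_le_bracket k

theorem isBoundedOnModulation_of_gap (hn : 1 ≤ n) (N : ℕ) (hφ : IsPartitionWindow φ)
    (hp₁ : 1 ≤ p₁) (hp : p₁ ≤ p₂) (hq₂ : 1 ≤ q₂) (hq : q₂ < q₁)
    (hσ : σ = 2 - ((n : ℝ) - 1) / 2 * N)
    (hs : s₂ + σ + n * q₂⁻¹.toReal < s₁ + n * q₁⁻¹.toReal) :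
    IsBoundedOnModulation φ s₁ p₁ q₁ s₂ p₂ q₂ (laplacianIteratedAverage n N) := by
  have hq₁ := hq₂.trans hq.le
  have hw := ellNorm_bracket_rpow_ne_top (n := n) hq₂ hq (τ := s₁ - s₂ - σ) (by linarith)
  refine isBoundedOnModulation_of_embedding hn N hφ hp₁ hp hq₁ hq₂ hσ hw fun a ha => ?_
  have := holderTriple_gapExponent hq.le
  have h := ellNorm_mul_le (r := gapExponent q₁ q₂) (q₂ := q₂) hq₁
    (w := fun k => bracket k ^ (-(s₁ - s₂ - σ))) (fun k => (bracket_rpow_pos k _).le) _ ha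
  refine le_trans (le_of_eq ?_) h
  have e : s₂ + σ = -(s₁ - s₂ - σ) + s₁ := by ring
  rw [e, ← weighted_weighted]
  rfl

end Sufficiency

/-! ### Points where the symbol is large -/

section LargePoints

variable {n : ℕ}

/-- Move κ outwards along its ray, by at most 1, to a radius t where t^{(n-1)/2}|m| ≥ ε. There |M| =
t²|m|^N ≥ ε^N t^σ. -/
theorem exists_averageSymbol_ge (hn : 1 ≤ n) (N : ℕ) {σ : ℝ}
    (hσ : σ = 2 - ((n : ℝ) - 1) / 2 * N) :
    ∃ c : ℝ, 0 < c ∧ ∀ κ : E n, 1 ≤ ‖κ‖ →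
      ∃ ξ, ‖ξ - κ‖ ≤ 1 ∧ c * japaneseBracket κ ^ σ ≤ ‖averageSymbol n N ξ‖ := by
  obtain ⟨ε, hε, h⟩ := (exists_sphereSymbol_bounds hn).2
  set b : ℝ := ((n : ℝ) - 1) / 2 with hb
  -- The first two factors compare ⟨κ⟩ with ⟨ξ⟩, the last one ⟨ξ⟩ with t.
  set B : ℝ := 2 ^ |σ| * (1 + 1) ^ |σ| * 2 ^ |σ| with hB
  have hB0 : 0 < B := by positivity
  refine ⟨ε ^ N / B, by positivity, fun κ hκ => ?_⟩
  obtain ⟨t, ht, hm⟩ := h ‖κ‖ hκ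
  have hκ0 : 0 < ‖κ‖ := by linarith
  have ht1 : 1 ≤ t := hκ.trans ht.1
  have ht0 : 0 < t := by linarith
  set ξ : E n := (t / ‖κ‖) • κ with hξ
  have hξn : ‖ξ‖ = t := by
    rw [hξ, norm_smul, Real.norm_of_nonneg (by positivity)]; field_simp
  have hdist : ‖ξ - κ‖ ≤ 1 := by
    have : ξ - κ = (t / ‖κ‖ - 1) • κ := by rw [hξ, sub_smul, one_smul]
    have h0 : 0 ≤ t / ‖κ‖ - 1 := by rw [sub_nonneg, one_le_div hκ0]; exact ht.1
    rw [this, norm_smul, Real.norm_of_nonneg h0, sub_mul, div_mul_cancel₀ _ hκ0.ne']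
    linarith [ht.2]
  refine ⟨ξ, hdist, ?_⟩
  have hlow : ε ^ N * t ^ σ ≤ ‖averageSymbol n N ξ‖ := by
    have h1 := hm ξ hξn
    rw [averageSymbol, norm_neg, norm_mul, norm_pow, Complex.norm_real, Complex.norm_real, hξn,
      Real.norm_of_nonneg (by positivity), Real.norm_eq_abs]
    have h2 : ε ^ N ≤ (t ^ b * |sphereSymbol n ξ|) ^ N := by gcongr
    have h3 : t ^ σ * (t ^ b) ^ N = t ^ 2 := by
      rw [← Real.rpow_natCast (t ^ b), ← Real.rpow_mul ht0.le, ← Real.rpow_add ht0, hσ,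
        sub_add_cancel]
      norm_cast
    calc ε ^ N * t ^ σ ≤ (t ^ b * |sphereSymbol n ξ|) ^ N * t ^ σ := by gcongr
      _ = (t ^ σ * (t ^ b) ^ N) * |sphereSymbol n ξ| ^ N := by rw [mul_pow]; ring
      _ = _ := by rw [h3]
  have h4 : japaneseBracket κ ^ σ ≤ 2 ^ |σ| * (1 + 1) ^ |σ| * japaneseBracket ξ ^ σ :=
    japaneseBracket_rpow_le_of_norm_sub_le (by rwa [norm_sub_rev]) σ
  have h5 : japaneseBracket ξ ^ σ ≤ 2 ^ |σ| * t ^ σ := by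
    rcases le_total 0 σ with hs | hs
    · rw [abs_of_nonneg hs, ← Real.mul_rpow (by norm_num) ht0.le]
      refine Real.rpow_le_rpow (japaneseBracket_pos ξ).le ?_ hs
      have := japaneseBracket_le_one_add_norm ξ
      rw [hξn] at this
      linarith
    · have h6 : japaneseBracket ξ ^ σ ≤ t ^ σ := by
        refine Real.rpow_le_rpow_of_nonpos ht0 ?_ hs
        rw [← hξn]; exact norm_le_japaneseBracket ξ
      refine h6.trans (le_mul_of_one_le_left (by positivity) ?_)
      exact Real.one_le_rpow (by norm_num) (abs_nonneg σ)
  have h7 : japaneseBracket κ ^ σ ≤ B * t ^ σ := by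
    refine h4.trans ?_
    rw [hB, mul_assoc _ (2 ^ |σ|) (t ^ σ)]
    gcongr
  refine le_trans ?_ hlow
  rw [div_mul_eq_mul_div, div_le_iff₀ hB0, mul_assoc, mul_comm (t ^ σ)]
  gcongr

theorem IsSymbol.exists_norm_sub_le {a : ℝ} {M : E n → ℂ} (hM : IsSymbol a M) :
    ∃ C : ℝ, 0 < C ∧ ∀ ξ η : E n, ‖η - ξ‖ ≤ 1 →
      ‖M η - M ξ‖ ≤ C * japaneseBracket ξ ^ a * ‖η - ξ‖ := by
  obtain ⟨D, hD, h⟩ := hM.bound 1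
  refine ⟨D * (2 ^ |a| * (1 + 1) ^ |a|) + 1, by positivity, fun ξ η hη => ?_⟩
  have hpos := japaneseBracket_rpow_pos ξ a
  have hdiff : Differentiable ℝ M := hM.contDiff.differentiable (by simp)
  refine (convex_closedBall ξ 1).norm_image_sub_le_of_norm_fderiv_le (𝕜 := ℝ)
    (fun z _ => hdiff z) (fun z hz => ?_) (Metric.mem_closedBall_self zero_le_one)
    (mem_closedBall_iff_norm.2 hη)
  rw [← norm_iteratedFDeriv_one]
  refine (h z).trans ?_
  have h1 := japaneseBracket_rpow_le_of_norm_sub_le (mem_closedBall_iff_norm.1 hz) a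
  calc D * japaneseBracket z ^ a ≤ D * (2 ^ |a| * (1 + 1) ^ |a| * japaneseBracket ξ ^ a) := by
        gcongr
    _ = D * (2 ^ |a| * (1 + 1) ^ |a|) * japaneseBracket ξ ^ a := by ring
    _ ≤ _ := by gcongr; linarith

theorem exists_averageSymbol_large_point (hn : 1 ≤ n) (N : ℕ) {σ : ℝ}
    (hσ : σ = 2 - ((n : ℝ) - 1) / 2 * N) :
    ∃ c δ : ℝ, 0 < c ∧ 0 < δ ∧ δ ≤ 1 ∧ ∀ κ : E n, 1 ≤ ‖κ‖ → ∃ ξ, ‖ξ - κ‖ ≤ 1 ∧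
      c * japaneseBracket κ ^ σ ≤ ‖averageSymbol n N ξ‖ ∧
      ∀ η, ‖η - ξ‖ ≤ δ → ‖averageSymbol n N η - averageSymbol n N ξ‖ ≤
        ‖averageSymbol n N ξ‖ / 2 := by
  obtain ⟨c, hc, h⟩ := exists_averageSymbol_ge hn N hσ
  have hM := isSymbol_averageSymbol hn N
  rw [← hσ] at hM
  obtain ⟨C, hC, hlip⟩ := hM.exists_norm_sub_le
  set B : ℝ := 2 ^ |σ| * (1 + 1) ^ |σ| with hB
  have hB0 : 0 < B := by positivity
  -- On a ball of this radius M varies by at most C B ⟨κ⟩^σ δ ≤ c ⟨κ⟩^σ / 2, half the lower bound at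
  -- its centre. The radius is the same for all κ.
  refine ⟨c, min 1 (c / (2 * C * B)), hc, by positivity, min_le_left _ _, fun κ hκ => ?_⟩
  obtain ⟨ξ, hξ, hlow⟩ := h κ hκ
  refine ⟨ξ, hξ, hlow, fun η hη => ?_⟩
  have h1 : japaneseBracket ξ ^ σ ≤ B * japaneseBracket κ ^ σ :=
    japaneseBracket_rpow_le_of_norm_sub_le hξ σ
  have hpos := japaneseBracket_rpow_pos κ σ
  have hpos' := japaneseBracket_rpow_pos ξ σ
  calc _ ≤ C * japaneseBracket ξ ^ σ * ‖η - ξ‖ := hlip ξ η (hη.trans (min_le_left _ _))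
    _ ≤ C * (B * japaneseBracket κ ^ σ) * (c / (2 * C * B)) := by
        gcongr
        exact hη.trans (min_le_right _ _)
    _ = c * japaneseBracket κ ^ σ / 2 := by field_simp
    _ ≤ _ := by gcongr

end LargePoints

/-! ### Wave packets -/

section Packets

variable {n : ℕ}

/-- The Schwartz function `w ↦ b (2πw - ξ)`. -/
def packet (b : 𝓢(E n, ℂ)) (ξ : E n) : 𝓢(E n, ℂ) :=
  compSubConstCLM ℂ ((2 * Real.pi)⁻¹ • ξ) (dilateTwoPi n b)

theorem packet_apply (b : 𝓢(E n, ℂ)) (ξ w : E n) : packet b ξ w = b ((2 * Real.pi) • w - ξ) := by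
  rw [packet, compSubConstCLM_apply, dilateTwoPi_apply, smul_sub, smul_smul,
    mul_inv_cancel₀ two_pi_ne_zero, one_smul]

/-- The distribution with Fourier transform `w ↦ b (2πw - ξ)`. -/
def packetDistribution (b : 𝓢(E n, ℂ)) (ξ : E n) : 𝓢'(E n, ℂ) :=
  toTemperedDistributionCLM (E n) ℂ volume (𝓕⁻ (packet b ξ))

theorem packetDistribution_apply (b : 𝓢(E n, ℂ)) (ξ : E n) (ψ : 𝓢(E n, ℂ)) :
    packetDistribution b ξ ψ = ∫ w, packet b ξ w * (𝓕⁻ ψ : 𝓢(E n, ℂ)) w := by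
  refine (toTemperedDistributionCLM_apply_apply volume (𝓕⁻ (packet b ξ)) ψ).trans ?_
  have h := integral_fourierInv_smul_eq (packet b ξ) ψ
  simp only [smul_eq_mul] at h ⊢
  rw [← h]
  exact integral_congr_ae (Filter.Eventually.of_forall fun x => mul_comm _ _)

theorem fourierMultiplier_packetDistribution_apply {g : E n → ℂ} (hg : g.HasTemperateGrowth)
    (b : 𝓢(E n, ℂ)) (ξ : E n) (ψ : 𝓢(E n, ℂ)) :
    TemperedDistribution.fourierMultiplierCLM ℂ g (packetDistribution b ξ) ψ =
      ∫ w, packet b ξ w * (g w * (𝓕⁻ ψ : 𝓢(E n, ℂ)) w) := by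
  rw [TemperedDistribution.fourierMultiplierCLM_apply_apply, packetDistribution_apply,
    FourierTransform.fourierInv_fourier_eq]
  refine integral_congr_ae (Filter.Eventually.of_forall fun w => ?_)
  simp only
  rw [smulLeftCLM_apply_apply hg, smul_eq_mul]

/-- The `L^p` norm of the Fourier transform of `w ↦ b (2πw)`. -/
def packetNorm (p : ℝ≥0∞) (b : 𝓢(E n, ℂ)) : ℝ≥0∞ :=
  eLpNorm (𝓕 (dilateTwoPi n b) : 𝓢(E n, ℂ)) p volume

theorem packetNorm_ne_top (p : ℝ≥0∞) (b : 𝓢(E n, ℂ)) : packetNorm p b ≠ ⊤ :=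
  ((𝓕 (dilateTwoPi n b) : 𝓢(E n, ℂ)).memLp p volume).2.ne

theorem norm_fourier_packet (b : 𝓢(E n, ℂ)) (ξ x : E n) :
    ‖(𝓕 (packet b ξ) : 𝓢(E n, ℂ)) x‖ = ‖(𝓕 (dilateTwoPi n b) : 𝓢(E n, ℂ)) x‖ := by
  have h : (𝓕 (packet b ξ) : 𝓢(E n, ℂ)) x = multiplierKernel b ξ x := by
    rw [← integral_cexp_mul_dilate_sub, fourier_coe, Real.fourier_eq']
    refine integral_congr_ae (Filter.Eventually.of_forall fun w => ?_)
    simp only [smul_eq_mul, packet_apply]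
  rw [h, multiplierKernel, norm_mul, Complex.norm_exp_ofReal_mul_I, one_mul]

theorem eLpNorm_fourier_packet (p : ℝ≥0∞) (b : 𝓢(E n, ℂ)) (ξ : E n) :
    eLpNorm (𝓕 (packet b ξ) : 𝓢(E n, ℂ)) p volume = packetNorm p b :=
  eLpNorm_congr_norm_ae (Filter.Eventually.of_forall fun x => norm_fourier_packet b ξ x)

theorem eLpNorm_fourierInv_packet (p : ℝ≥0∞) (b : 𝓢(E n, ℂ)) (ξ : E n) :
    eLpNorm (𝓕⁻ (packet b ξ) : 𝓢(E n, ℂ)) p volume = packetNorm p b := by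
  rw [← eLpNorm_fourier_packet p b ξ, ← eLpNorm_comp_measurePreserving
    (𝓕 (packet b ξ) : 𝓢(E n, ℂ)).continuous.aestronglyMeasurable
    (Measure.measurePreserving_neg (volume : Measure (E n)))]
  refine eLpNorm_congr_ae (Filter.Eventually.of_forall fun x => ?_)
  rw [fourierInv_coe, Real.fourierInv_eq_fourier_neg, Function.comp_apply, fourier_coe]

theorem distLpNorm_packetDistribution_le (p : ℝ≥0∞) (b : 𝓢(E n, ℂ)) (ξ : E n) :
    distLpNorm p (packetDistribution b ξ) ≤ packetNorm p b := by
  rw [← eLpNorm_fourierInv_packet p b ξ]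
  refine distLpNorm_le_of_memLp (SchwartzMap.memLp _ p volume) fun ψ => ?_
  refine (toTemperedDistributionCLM_apply_apply volume (𝓕⁻ (packet b ξ)) ψ).trans ?_
  exact integral_congr_ae (Filter.Eventually.of_forall fun x => mul_comm _ _)

theorem distLpNorm_smul_le {p : ℝ≥0∞} (c : ℝ≥0) (u : 𝓢'(E n, ℂ)) :
    distLpNorm p (((c : ℝ) : ℂ) • u) ≤ c * distLpNorm p u := by
  rcases eq_or_ne c 0 with rfl | hc
  · have h0 : ((((0 : ℝ≥0) : ℝ) : ℂ) • u) = 0 := by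
      ext ψ
      exact (congrArg (· * u ψ) (by simp)).trans (zero_mul (u ψ))
    rw [h0, distLpNorm_zero]
    exact zero_le
  have hc' : (c : ℝ≥0∞) ≠ 0 := by simpa using hc
  rw [mul_comm, ← ENNReal.div_le_iff hc' ENNReal.coe_ne_top]
  refine le_distLpNorm fun g hg hgu => ?_
  rw [ENNReal.div_le_iff hc' ENNReal.coe_ne_top]
  refine (distLpNorm_le_of_memLp (hg.const_smul ((c : ℝ) : ℂ)) fun ψ => ?_).trans_eq ?_
  · rw [show (((c : ℝ) : ℂ) • u) ψ = ((c : ℝ) : ℂ) • u ψ from rfl, hgu, ← integral_smul]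
    refine integral_congr_ae (Filter.Eventually.of_forall fun x => ?_)
    simp only [Pi.smul_apply, smul_eq_mul]
    ring
  · rw [eLpNorm_const_smul, mul_comm]
    congr 1
    rw [← ofReal_norm, show ‖((c : ℝ) : ℂ)‖ = c from Complex.norm_of_nonneg c.2,
      ENNReal.ofReal_coe_nnreal]

/-- The superposition of wave packets with amplitudes `a k` at frequencies `ξ k`. -/
def packetSum (b : 𝓢(E n, ℂ)) (ξ : (Fin n → ℤ) → E n) (F : Finset (Fin n → ℤ))
    (a : (Fin n → ℤ) → ℝ≥0) : 𝓢'(E n, ℂ) :=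
  ∑ k ∈ F, ((a k : ℝ) : ℂ) • packetDistribution b (ξ k)

variable {φ : E n → ℂ}

/-- Each packet has an L^p norm independent of its frequency. A packet meets cell j only if |k - j|
≤ R + 2: R for the window, 1 for the support of b, 1 for the displacement of ξ k from k. -/
theorem exists_distLpNorm_box_packetSum_le (hφ : IsPartitionWindow φ) {p : ℝ≥0∞} (hp : 1 ≤ p) :
    ∃ (L : ℕ) (C : ℝ), 0 < C ∧ ∀ (b : 𝓢(E n, ℂ)), (∀ x, b x ≠ 0 → ‖x‖ ≤ 1) →
      ∀ (ξ : (Fin n → ℤ) → E n) (F : Finset (Fin n → ℤ)) (a : (Fin n → ℤ) → ℝ≥0),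
      (∀ k ∈ F, ‖ξ k - latticePoint k‖ ≤ 1) → ∀ j,
      distLpNorm p (box φ j (packetSum b ξ F a)) ≤
        ENNReal.ofReal C * packetNorm p b * ∑ l ∈ latticeCube n L, (a (j + l) : ℝ≥0∞) := by
  obtain ⟨R, hR0, hR⟩ := hφ.exists_radius
  obtain ⟨L, hL⟩ := exists_nat_ge (R + 2)
  obtain ⟨s, C, hC, hmul⟩ := exists_distLpNorm_fourierMultiplier_le (n := n) hp (le_refl p)
  set B : ℝ := s.sup (schwartzSeminormFamily ℂ (E n) ℂ) hφ.schwartz + 1 with hB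
  have hB0 : 0 < B := by
    have : 0 ≤ s.sup (schwartzSeminormFamily ℂ (E n) ℂ) hφ.schwartz := apply_nonneg _ _
    linarith
  refine ⟨L, C * B, by positivity, fun b hb ξ F a hξ j => ?_⟩
  classical
  have hle : ∀ k, distLpNorm p (box φ j (packetDistribution b (ξ k))) ≤
      ENNReal.ofReal (C * B) * packetNorm p b := fun k =>
    (hmul hφ.schwartz B hB0 (by linarith) (latticePoint j) _).trans
      (by gcongr; exact distLpNorm_packetDistribution_le p b (ξ k))
  have hzero : ∀ k ∈ F, k - j ∉ latticeCube n L → box φ j (packetDistribution b (ξ k)) = 0 := by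
    intro k hk hkj
    ext ψ
    rw [box, fourierMultiplier_packetDistribution_apply (hφ.hasTemperateGrowth j)]
    rw [show (0 : 𝓢'(E n, ℂ)) ψ = 0 from rfl]
    refine (integral_congr_ae (Filter.Eventually.of_forall fun w => ?_)).trans (integral_zero _ _)
    by_contra hne
    have h1 : packet b (ξ k) w ≠ 0 := left_ne_zero_of_mul hne
    have h2 : φ ((2 * Real.pi) • w - latticePoint j) ≠ 0 :=
      left_ne_zero_of_mul (right_ne_zero_of_mul hne)
    rw [packet_apply] at h1
    refine hkj (mem_latticeCube_of_norm_le (le_trans ?_ hL))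
    have e : latticePoint (k - j) = ((2 * Real.pi) • w - latticePoint j) -
        ((2 * Real.pi) • w - ξ k) - (ξ k - latticePoint k) := by
      rw [latticePoint_sub]; abel
    rw [e]
    have t1 := norm_sub_le (((2 * Real.pi) • w - latticePoint j) -
        ((2 * Real.pi) • w - ξ k)) (ξ k - latticePoint k)
    have t2 := norm_sub_le ((2 * Real.pi) • w - latticePoint j) ((2 * Real.pi) • w - ξ k)
    have := hR _ h2
    have := hb _ h1
    have := hξ k hk
    linarith
  have hexp : box φ j (packetSum b ξ F a) =
      ∑ k ∈ F, ((a k : ℝ) : ℂ) • box φ j (packetDistribution b (ξ k)) := by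
    rw [packetSum, map_sum]
    simp_rw [map_smul]
  rw [hexp]
  refine (distLpNorm_sum_le hp _ _).trans ?_
  calc ∑ k ∈ F, distLpNorm p (((a k : ℝ) : ℂ) • box φ j (packetDistribution b (ξ k)))
      ≤ ∑ k ∈ F, if k - j ∈ latticeCube n L then
          ENNReal.ofReal (C * B) * packetNorm p b * (a k : ℝ≥0∞) else 0 := by
        refine Finset.sum_le_sum fun k hk => ?_
        split_ifs with h
        · refine (distLpNorm_smul_le (a k) _).trans ?_
          rw [mul_comm]
          gcongr
          exact hle k
        · have h0 : ((a k : ℝ) : ℂ) • (0 : 𝓢'(E n, ℂ)) = 0 := by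
            ext ψ
            exact mul_zero ((a k : ℝ) : ℂ)
          rw [hzero k hk h, h0, distLpNorm_zero]
    _ = ∑ k ∈ F with k - j ∈ latticeCube n L,
          ENNReal.ofReal (C * B) * packetNorm p b * (a k : ℝ≥0∞) := (Finset.sum_filter _ _).symm
    _ ≤ ∑ k ∈ (latticeCube n L).image (j + ·),
          ENNReal.ofReal (C * B) * packetNorm p b * (a k : ℝ≥0∞) := by
        refine Finset.sum_le_sum_of_subset fun k hk => ?_
        rw [Finset.mem_filter] at hk
        exact Finset.mem_image.2 ⟨k - j, hk.2, add_sub_cancel j k⟩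
    _ = _ := by
        rw [Finset.sum_image fun x _ y _ h => add_left_cancel h, Finset.mul_sum]

/-- The test function is the Fourier transform of the k-th packet profile, so the pairing is an
integral over frequencies. Two overlapping packets would have lattice points at distance at most 1 +
1 + 1 + 1 = 4, and separation 5 excludes this. -/
theorem laplacianIteratedAverage_packetSum_apply (hn : 1 ≤ n) (N : ℕ) {b : 𝓢(E n, ℂ)} {δ : ℝ}
    (hδ : δ ≤ 1) (hb : ∀ x, b x ≠ 0 → ‖x‖ ≤ δ) {ξ : (Fin n → ℤ) → E n} {F : Finset (Fin n → ℤ)}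
    (a : (Fin n → ℤ) → ℝ≥0) (hξ : ∀ k ∈ F, ‖ξ k - latticePoint k‖ ≤ 1)
    (hsep : ∀ k ∈ F, ∀ k' ∈ F, k' ≠ k → 5 ≤ ‖latticePoint k - latticePoint k'‖)
    {k : Fin n → ℤ} (hk : k ∈ F) :
    laplacianIteratedAverage n N (packetSum b ξ F a) (𝓕 (packet b (ξ k))) =
      (a k : ℝ) * ∫ w, averageSymbol n N ((2 * Real.pi) • w) * packet b (ξ k) w ^ 2 := by
  have htM := hasTemperateGrowth_comp_two_pi (isSymbol_averageSymbol hn N).hasTemperateGrowth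
  have hexp : laplacianIteratedAverage n N (packetSum b ξ F a) =
      ∑ k' ∈ F, ((a k' : ℝ) : ℂ) • TemperedDistribution.fourierMultiplierCLM ℂ
        (fun ξ : E n => averageSymbol n N ((2 * Real.pi) • ξ)) (packetDistribution b (ξ k')) := by
    rw [laplacianIteratedAverage_eq hn, packetSum, map_sum]
    simp_rw [map_smul]
  have happ : ∀ (G : Finset (Fin n → ℤ)) (u : (Fin n → ℤ) → 𝓢'(E n, ℂ)) (ψ : 𝓢(E n, ℂ)),
      (∑ k' ∈ G, ((a k' : ℝ) : ℂ) • u k') ψ = ∑ k' ∈ G, ((a k' : ℝ) : ℂ) * u k' ψ := by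
    classical
    intro G u ψ
    induction G using Finset.induction_on with
    | empty => rfl
    | insert x s hx ih =>
      rw [Finset.sum_insert hx, Finset.sum_insert hx, ← ih]
      rfl
  rw [hexp, happ, Finset.sum_eq_single k]
  · rw [fourierMultiplier_packetDistribution_apply htM, FourierTransform.fourierInv_fourier_eq]
    congr 1
    refine integral_congr_ae (Filter.Eventually.of_forall fun w => ?_)
    simp only
    ring
  · intro k' hk' hne
    rw [fourierMultiplier_packetDistribution_apply htM, FourierTransform.fourierInv_fourier_eq]
    refine mul_eq_zero_of_right _
      ((integral_congr_ae (Filter.Eventually.of_forall fun w => ?_)).trans (integral_zero _ _))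
    by_contra h
    have h1 : packet b (ξ k') w ≠ 0 := left_ne_zero_of_mul h
    have h2 : packet b (ξ k) w ≠ 0 := right_ne_zero_of_mul (right_ne_zero_of_mul h)
    rw [packet_apply] at h1 h2
    have e : latticePoint k - latticePoint k' = (((2 * Real.pi) • w - ξ k') -
        ((2 * Real.pi) • w - ξ k)) + ((ξ k' - latticePoint k') - (ξ k - latticePoint k)) := by abel
    have t0 := hsep k hk k' hk' hne
    rw [e] at t0
    have t1 := norm_add_le (((2 * Real.pi) • w - ξ k') - ((2 * Real.pi) • w - ξ k))
      ((ξ k' - latticePoint k') - (ξ k - latticePoint k))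
    have t2 := norm_sub_le ((2 * Real.pi) • w - ξ k') ((2 * Real.pi) • w - ξ k)
    have t3 := norm_sub_le (ξ k' - latticePoint k') (ξ k - latticePoint k)
    have := hb _ h1
    have := hb _ h2
    have := hξ k hk
    have := hξ k' hk'
    linarith
  · exact fun h => absurd hk h

theorem integrable_norm_sq (f : 𝓢(E n, ℂ)) : Integrable (fun w => ‖f w‖ ^ 2) :=
  (f.memLp 2 volume).integrable_norm_pow (by norm_num)

theorem integral_norm_packet_sq (b : 𝓢(E n, ℂ)) (ξ : E n) :
    ∫ w, ‖packet b ξ w‖ ^ 2 = ∫ w, ‖dilateTwoPi n b w‖ ^ 2 :=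
  integral_sub_right_eq_self (fun w => ‖dilateTwoPi n b w‖ ^ 2) ((2 * Real.pi)⁻¹ • ξ)

/-- As b ≥ 0, freezing M at ξ gives modulus |M(ξ)| times the full L² mass. The error from the
variation of M is at most half of that. -/
theorem le_norm_integral_mul_packet_sq {M : E n → ℂ} (hM : Continuous M)
    {b : 𝓢(E n, ℂ)} {δ : ℝ} (hb : ∀ x, b x ≠ 0 → ‖x‖ ≤ δ) (hbr : ∀ x, b x = (‖b x‖ : ℂ)) {ξ : E n}
    (hvar : ∀ η, ‖η - ξ‖ ≤ δ → ‖M η - M ξ‖ ≤ ‖M ξ‖ / 2) :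
    ‖M ξ‖ / 2 * ∫ w, ‖dilateTwoPi n b w‖ ^ 2 ≤
      ‖∫ w, M ((2 * Real.pi) • w) * packet b ξ w ^ 2‖ := by
  set I := ∫ w, ‖dilateTwoPi n b w‖ ^ 2 with hI
  have hint := integrable_norm_sq (packet b ξ)
  have hsq : ∀ w, packet b ξ w ^ 2 = ((‖packet b ξ w‖ ^ 2 : ℝ) : ℂ) := fun w => by
    rw [packet_apply, hbr]; simp
  have hbound : ∀ w, ‖(M ((2 * Real.pi) • w) - M ξ) * packet b ξ w ^ 2‖ ≤
      ‖M ξ‖ / 2 * ‖packet b ξ w‖ ^ 2 := by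
    intro w
    rw [norm_mul, norm_pow]
    rcases eq_or_ne (packet b ξ w) 0 with h | h
    · simp [h]
    · gcongr
      refine hvar _ (hb _ ?_)
      rwa [packet_apply] at h
  have hmeas : AEStronglyMeasurable
      (fun w => (M ((2 * Real.pi) • w) - M ξ) * packet b ξ w ^ 2) volume :=
    (by have := (packet b ξ).continuous; fun_prop : Continuous _).aestronglyMeasurable
  have hint1 : Integrable (fun w => (M ((2 * Real.pi) • w) - M ξ) * packet b ξ w ^ 2) :=
    (hint.const_mul _).mono' hmeas (Filter.Eventually.of_forall hbound)
  have hint2 : Integrable (fun w => M ξ * packet b ξ w ^ 2) := by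
    simp_rw [hsq]
    exact hint.ofReal.const_mul _
  have hsplit : ∫ w, M ((2 * Real.pi) • w) * packet b ξ w ^ 2 =
      (∫ w, (M ((2 * Real.pi) • w) - M ξ) * packet b ξ w ^ 2) + M ξ * (I : ℂ) := by
    have e : M ξ * (I : ℂ) = ∫ w, M ξ * packet b ξ w ^ 2 := by
      rw [integral_const_mul, hI, ← integral_norm_packet_sq b ξ]
      simp_rw [hsq]
      rw [integral_complex_ofReal]
    rw [e, ← integral_add hint1 hint2]
    refine integral_congr_ae (Filter.Eventually.of_forall fun w => ?_)
    simp only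
    ring
  have h1 : ‖∫ w, (M ((2 * Real.pi) • w) - M ξ) * packet b ξ w ^ 2‖ ≤ ‖M ξ‖ / 2 * I := by
    refine (norm_integral_le_of_norm_le (hint.const_mul _)
      (Filter.Eventually.of_forall hbound)).trans_eq ?_
    rw [integral_const_mul, integral_norm_packet_sq]
  have hI0 : 0 ≤ I := integral_nonneg fun w => by positivity
  have h2 : ‖M ξ * (I : ℂ)‖ = ‖M ξ‖ * I := by
    rw [norm_mul, Complex.norm_of_nonneg hI0]
  rw [hsplit]
  have h3 := norm_sub_le ((∫ w, (M ((2 * Real.pi) • w) - M ξ) * packet b ξ w ^ 2) + M ξ * (I : ℂ))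
    (∫ w, (M ((2 * Real.pi) • w) - M ξ) * packet b ξ w ^ 2)
  rw [add_sub_cancel_left, h2] at h3
  linarith

/-- The packet lies within 1 + 1 = 2 of k in frequency, where the cells k + l already sum to 1. -/
theorem IsPartitionWindow.apply_fourier_packet_eq_sum (hφ : IsPartitionWindow φ) {R : ℝ}
    (hR : ∀ ξ, φ ξ ≠ 0 → ‖ξ‖ ≤ R) {L : ℕ} (hL : R + 2 ≤ L) {b : 𝓢(E n, ℂ)}
    (hb : ∀ x, b x ≠ 0 → ‖x‖ ≤ 1) {ξ : E n} {k : Fin n → ℤ} (hξ : ‖ξ - latticePoint k‖ ≤ 1)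
    (u : 𝓢'(E n, ℂ)) :
    u (𝓕 (packet b ξ)) = ∑ l ∈ latticeCube n L, box φ (k + l) u (𝓕 (packet b ξ)) := by
  have h1 : ∀ l, box φ (k + l) u (𝓕 (packet b ξ)) = u (FourierTransform.fourierCLM ℂ 𝓢(E n, ℂ)
      (smulLeftCLM ℂ
        (fun w : E n => φ ((2 * Real.pi) • w - latticePoint (k + l))) (packet b ξ))) := by
    intro l
    rw [box, TemperedDistribution.fourierMultiplierCLM_apply_apply,
      FourierTransform.fourierInv_fourier_eq]
    rfl
  simp_rw [h1]
  rw [← map_sum, ← map_sum]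
  suffices h : ∑ l ∈ latticeCube n L, smulLeftCLM ℂ
      (fun w : E n => φ ((2 * Real.pi) • w - latticePoint (k + l))) (packet b ξ) = packet b ξ by
    rw [h]; rfl
  ext w
  rw [_root_.sum_apply]
  simp_rw [smulLeftCLM_apply_apply (hφ.hasTemperateGrowth _), smul_eq_mul]
  rw [← Finset.sum_mul]
  rcases eq_or_ne (packet b ξ w) 0 with h | h
  · rw [h, mul_zero]
  · rw [hφ.sum_eq_one hR hL, one_mul]
    rw [packet_apply] at h
    have := norm_add_le ((2 * Real.pi) • w - ξ) (ξ - latticePoint k)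
    rw [sub_add_sub_cancel] at this
    linarith [hb _ h]

/-- The pairing with the k-th packet is at least a_k |M(ξ_k)|/2 times the L² mass. By the partition
of unity and Hölder's inequality it is also bounded by the L^p norms of the cells near k. -/
theorem exists_packetSum_le_distLpNorm_box (hn : 1 ≤ n) (N : ℕ) (hφ : IsPartitionWindow φ)
    {p : ℝ≥0∞} (hp : 1 ≤ p) :
    ∃ L : ℕ, ∀ (b : 𝓢(E n, ℂ)) (δ : ℝ), δ ≤ 1 → (∀ x, b x ≠ 0 → ‖x‖ ≤ δ) →
      (∀ x, b x = (‖b x‖ : ℂ)) →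
      ∀ (ξ : (Fin n → ℤ) → E n) (F : Finset (Fin n → ℤ)) (a : (Fin n → ℤ) → ℝ≥0),
      (∀ k ∈ F, ‖ξ k - latticePoint k‖ ≤ 1) →
      (∀ k ∈ F, ∀ k' ∈ F, k' ≠ k → 5 ≤ ‖latticePoint k - latticePoint k'‖) →
      (∀ k ∈ F, ∀ η, ‖η - ξ k‖ ≤ δ → ‖averageSymbol n N η - averageSymbol n N (ξ k)‖ ≤
        ‖averageSymbol n N (ξ k)‖ / 2) →
      ∀ k ∈ F, ENNReal.ofReal (‖averageSymbol n N (ξ k)‖ / 2 * ∫ w, ‖dilateTwoPi n b w‖ ^ 2) * a k ≤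
        packetNorm p.conjExponent b * ∑ l ∈ latticeCube n L,
          distLpNorm p (box φ (k + l) (laplacianIteratedAverage n N (packetSum b ξ F a))) := by
  obtain ⟨R, hR0, hR⟩ := hφ.exists_radius
  obtain ⟨L, hL⟩ := exists_nat_ge (R + 2)
  refine ⟨L, fun b δ hδ hb hbr ξ F a hξ hsep hvar k hk => ?_⟩
  set T := laplacianIteratedAverage n N (packetSum b ξ F a) with hT
  set g : 𝓢(E n, ℂ) := 𝓕 (packet b (ξ k)) with hg
  calc ENNReal.ofReal (‖averageSymbol n N (ξ k)‖ / 2 * ∫ w, ‖dilateTwoPi n b w‖ ^ 2) * a k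
      ≤ ENNReal.ofReal (‖∫ w, averageSymbol n N ((2 * Real.pi) • w) * packet b (ξ k) w ^ 2‖) *
          a k := by
        gcongr
        exact le_norm_integral_mul_packet_sq (isSymbol_averageSymbol hn N).contDiff.continuous
          hb hbr (hvar k hk)
    _ = ‖T g‖ₑ := by
        rw [hT, hg, laplacianIteratedAverage_packetSum_apply hn N hδ hb a hξ hsep hk, enorm_mul,
          ofReal_norm, mul_comm]
        congr 1
        rw [← ofReal_norm, show ‖((a k : ℝ) : ℂ)‖ = a k from Complex.norm_of_nonneg (a k).2,
          ENNReal.ofReal_coe_nnreal]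
    _ = ‖∑ l ∈ latticeCube n L, box φ (k + l) T g‖ₑ := by
        rw [hg, hφ.apply_fourier_packet_eq_sum hR hL (fun x hx => (hb x hx).trans hδ) (hξ k hk)]
    _ ≤ ∑ l ∈ latticeCube n L, ‖box φ (k + l) T g‖ₑ := enorm_sum_le _ _
    _ ≤ ∑ l ∈ latticeCube n L, packetNorm p.conjExponent b * distLpNorm p (box φ (k + l) T) := by
        refine Finset.sum_le_sum fun l _ => ?_
        rw [mul_comm, ← eLpNorm_fourier_packet _ b (ξ k)]
        exact enorm_apply_le_distLpNorm hp _ g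
    _ = _ := (Finset.mul_sum _ _ _).symm

end Packets

/-! ### Bumps and their dilations -/

section Bumps

variable {n : ℕ}

/-- `b` is nonnegative, not identically zero, and vanishes outside the ball of radius `δ`. -/
structure IsBump (δ : ℝ) (b : 𝓢(E n, ℂ)) : Prop where
  norm_le : ∀ x, b x ≠ 0 → ‖x‖ ≤ δ
  eq_norm : ∀ x, b x = (‖b x‖ : ℂ)
  integral_pos : 0 < ∫ w, ‖dilateTwoPi n b w‖ ^ 2

theorem exists_isBump {δ : ℝ} (hδ : 0 < δ) : ∃ b : 𝓢(E n, ℂ), IsBump δ b := by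
  let f : ContDiffBump (0 : E n) := ⟨δ / 2, δ, by linarith, by linarith⟩
  have hcs : HasCompactSupport fun x => (f x : ℂ) :=
    f.hasCompactSupport.comp_left (g := fun t : ℝ => (t : ℂ)) Complex.ofReal_zero
  have hsm : ContDiff ℝ ∞ fun x => (f x : ℂ) := Complex.ofRealCLM.contDiff.comp f.contDiff
  set b : 𝓢(E n, ℂ) := hcs.toSchwartzMap hsm with hb
  have hbx : ∀ x, b x = (f x : ℂ) := fun x => rfl
  refine ⟨b, ⟨fun x hx => ?_, fun x => ?_, ?_⟩⟩
  · rw [hbx, Ne, Complex.ofReal_eq_zero] at hx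
    have : x ∈ Function.support f := hx
    rw [f.support_eq] at this
    exact (mem_ball_zero_iff.1 this).le
  · rw [hbx, Complex.norm_of_nonneg f.nonneg]
  · have hcont : Continuous fun w => ‖dilateTwoPi n b w‖ ^ 2 :=
      ((dilateTwoPi n b).continuous.norm).pow 2
    refine integral_pos_of_integrable_nonneg_nonzero hcont (integrable_norm_sq _)
      (fun w => by positivity) (x := 0) ?_
    rw [dilateTwoPi_apply, smul_zero, hbx, f.one_of_mem_closedBall]
    · simp
    · exact Metric.mem_closedBall_self f.rIn_pos.le

/-- The dilation `x ↦ b (R x)`. -/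
def dilateBump {R : ℝ} (hR : R ≠ 0) (b : 𝓢(E n, ℂ)) : 𝓢(E n, ℂ) :=
  compCLMOfContinuousLinearEquiv ℂ (dilation n hR) b

theorem dilateBump_apply {R : ℝ} (hR : R ≠ 0) (b : 𝓢(E n, ℂ)) (x : E n) :
    dilateBump hR b x = b (R • x) := rfl

theorem integral_norm_dilateBump_sq {R : ℝ} (hR : 0 < R) (b : 𝓢(E n, ℂ)) :
    ∫ w, ‖dilateTwoPi n (dilateBump hR.ne' b) w‖ ^ 2 =
      (R ^ n)⁻¹ * ∫ w, ‖dilateTwoPi n b w‖ ^ 2 := by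
  have h := Measure.integral_comp_smul_of_nonneg volume
    (fun w => ‖dilateTwoPi n b w‖ ^ 2) R (hR := hR.le)
  rw [finrank_euclideanSpace_fin, smul_eq_mul] at h
  rw [← h]
  refine integral_congr_ae (Filter.Eventually.of_forall fun w => ?_)
  simp only [dilateTwoPi_apply, dilateBump_apply, smul_comm R]

/-- For R ≥ 1 the support shrinks, so a single δ serves the whole family of dilates. -/
theorem IsBump.dilateBump {δ : ℝ} {b : 𝓢(E n, ℂ)} (hb : IsBump δ b) {R : ℝ} (hR : 1 ≤ R) :
    IsBump δ (dilateBump (zero_lt_one.trans_le hR).ne' b) where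
  norm_le x hx := by
    rw [dilateBump_apply] at hx
    refine le_trans ?_ (hb.norm_le _ hx)
    rw [norm_smul, Real.norm_of_nonneg (by linarith)]
    exact le_mul_of_one_le_left (norm_nonneg x) hR
  eq_norm x := hb.eq_norm _
  integral_pos := by
    rw [integral_norm_dilateBump_sq (by linarith)]
    have := hb.integral_pos
    have : 0 < R := by linarith
    positivity

theorem eLpNorm_comp_inv_smul (g : 𝓢(E n, ℂ)) (p : ℝ≥0∞) {R : ℝ} (hR : 0 < R) :
    eLpNorm (fun x => g (R⁻¹ • x)) p volume =
      ENNReal.ofReal (R ^ (n * p⁻¹.toReal)) * eLpNorm g p volume := by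
  have hmeas : AEMeasurable (fun x : E n => R⁻¹ • x) volume := by fun_prop
  have hR' : 0 < R ^ n := by positivity
  rw [show (fun x => g (R⁻¹ • x)) = g ∘ fun x : E n => R⁻¹ • x from rfl,
    ← eLpNorm_map_measure g.continuous.aestronglyMeasurable hmeas,
    Measure.map_addHaar_smul _ (inv_ne_zero hR.ne'), finrank_euclideanSpace_fin, inv_pow, inv_inv,
    abs_of_pos hR', eLpNorm_smul_measure_of_ne_zero (by simpa using hR'), smul_eq_mul, one_div,
    ENNReal.ofReal_rpow_of_pos hR', ← Real.rpow_natCast, ← Real.rpow_mul hR.le]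

/-- Dilating b by R turns its transform into R^{-n} times a dilate by R⁻¹, and the latter has L^p
norm larger by R^{n/p}. -/
theorem packetNorm_dilateBump (p : ℝ≥0∞) {R : ℝ} (hR : 0 < R) (b : 𝓢(E n, ℂ)) :
    packetNorm p (dilateBump hR.ne' b) =
      ENNReal.ofReal (R ^ (n * p⁻¹.toReal - n)) * packetNorm p b := by
  have hval : ∀ x, (𝓕 (dilateTwoPi n (dilateBump hR.ne' b)) : 𝓢(E n, ℂ)) x =
      ((R ^ n)⁻¹ : ℝ) • (𝓕 (dilateTwoPi n b) : 𝓢(E n, ℂ)) (R⁻¹ • x) := by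
    intro x
    rw [fourier_coe, fourier_coe, Real.fourier_eq', Real.fourier_eq']
    have h := Measure.integral_comp_smul_of_nonneg volume (fun w : E n =>
      Complex.exp (↑(-2 * Real.pi * inner ℝ w (R⁻¹ • x)) * Complex.I) • dilateTwoPi n b w) R
      (hR := hR.le)
    rw [finrank_euclideanSpace_fin] at h
    rw [← h]
    refine integral_congr_ae (Filter.Eventually.of_forall fun w => ?_)
    have hi : inner ℝ (R • w) (R⁻¹ • x) = inner ℝ w x := by
      rw [real_inner_smul_left, real_inner_smul_right, mul_inv_cancel_left₀ hR.ne']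
    simp only [dilateTwoPi_apply, dilateBump_apply, smul_comm R (2 * Real.pi), hi]
  rw [packetNorm, packetNorm, funext hval]
  have := eLpNorm_const_smul ((R ^ n)⁻¹ : ℝ)
    (fun x => (𝓕 (dilateTwoPi n b) : 𝓢(E n, ℂ)) (R⁻¹ • x)) p volume
  refine this.trans ?_
  rw [eLpNorm_comp_inv_smul _ p hR, ← mul_assoc, ← ofReal_norm,
    Real.norm_of_nonneg (by positivity), ← ENNReal.ofReal_mul (by positivity)]
  congr 2
  rw [sub_eq_neg_add, Real.rpow_add hR, Real.rpow_neg hR.le, Real.rpow_natCast]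

end Bumps

/-! ### Divergence of lattice sums -/

section Divergence

variable {n : ℕ}

theorem bracket_le_of_abs_le {L : ℕ} (hn : 1 ≤ n) (hL : 1 ≤ L) {m : Fin n → ℤ}
    (hm : ∀ i, |(m i : ℝ)| ≤ 2 * L) : bracket m ≤ (1 + 2 * n) * L := by
  have hn' : (1 : ℝ) ≤ n := by exact_mod_cast hn
  have hL' : (1 : ℝ) ≤ L := by exact_mod_cast hL
  have hnorm : ‖latticePoint m‖ ^ 2 ≤ n * (2 * L) ^ 2 := by
    rw [EuclideanSpace.norm_sq_eq]
    calc ∑ i, ‖latticePoint m i‖ ^ 2 ≤ ∑ _i : Fin n, (2 * (L : ℝ)) ^ 2 := by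
          refine Finset.sum_le_sum fun i _ => ?_
          gcongr
          exact hm i
      _ = _ := by simp
  rw [bracket, Real.sqrt_le_left (by positivity)]
  nlinarith [mul_nonneg (sub_nonneg.2 hn') (sq_nonneg (L : ℝ)), mul_self_nonneg ((L : ℝ) - 1)]

/-- The cube (L, 2L]ⁿ contains Lⁿ lattice points, each with ⟨m⟩^{-n} ≥ ((1+2n)L)^{-n}. Cubes
arbitrarily far out therefore carry mass at least (1+2n)^{-n}, against the Cauchy criterion. -/
theorem lt_of_summable_bracket_rpow (hn : 1 ≤ n) {t : ℝ}
    (h : Summable fun m : Fin n → ℤ => bracket m ^ (-t)) : (n : ℝ) < t := by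
  by_contra! ht
  have hsum : Summable fun m : Fin n → ℤ => bracket m ^ (-(n : ℝ)) :=
    h.of_nonneg_of_le (fun m => (bracket_rpow_pos m _).le) fun m =>
      Real.rpow_le_rpow_of_exponent_le (one_le_bracket m) (by linarith)
  have hε : 0 < ((1 + 2 * n : ℝ) ^ n)⁻¹ := by positivity
  obtain ⟨s, hs⟩ := summable_iff_vanishing_norm.1 hsum _ hε
  obtain ⟨L, hL1, hL⟩ : ∃ L : ℕ, 1 ≤ L ∧ ∀ m ∈ s, ∀ i, m i ≤ L := by
    refine ⟨1 + ∑ m ∈ s, ∑ i, (m i).toNat, by omega, fun m hm i => ?_⟩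
    have h1 := Finset.single_le_sum (f := fun i => (m i).toNat) (fun _ _ => Nat.zero_le _)
      (Finset.mem_univ i)
    have h2 := Finset.single_le_sum (f := fun m : Fin n → ℤ => ∑ i, (m i).toNat)
      (fun _ _ => Nat.zero_le _) hm
    have h3 := Int.self_le_toNat (m i)
    omega
  set t : Finset (Fin n → ℤ) := Fintype.piFinset fun _ => Finset.Icc (L + 1 : ℤ) (2 * L) with ht
  have hdisj : Disjoint t s := by
    rw [Finset.disjoint_left]
    intro m hm hms
    have h1 := Fintype.mem_piFinset.1 hm ⟨0, hn⟩
    have h2 := hL m hms ⟨0, hn⟩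
    rw [Finset.mem_Icc] at h1
    omega
  have hcard : t.card = L ^ n := by
    rw [ht, Fintype.card_piFinset_const, Int.card_Icc]
    congr 1
    omega
  have hlt := hs t hdisj
  rw [Real.norm_of_nonneg (Finset.sum_nonneg fun m _ => (bracket_rpow_pos m _).le)] at hlt
  refine absurd hlt (not_lt.2 ?_)
  have hL' : (0 : ℝ) < L := by exact_mod_cast hL1
  calc ((1 + 2 * n : ℝ) ^ n)⁻¹ = ∑ _m ∈ t, (((1 + 2 * n : ℝ) * L) ^ n)⁻¹ := by
        rw [Finset.sum_const, hcard, nsmul_eq_mul, mul_pow]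
        push_cast
        field_simp
    _ ≤ _ := by
        refine Finset.sum_le_sum fun m hm => ?_
        rw [Real.rpow_neg (bracket_pos m).le, Real.rpow_natCast]
        have hb := bracket_pos m
        gcongr
        refine bracket_le_of_abs_le hn hL1 fun i => ?_
        have h1 := Finset.mem_Icc.1 (Fintype.mem_piFinset.1 hm i)
        have h2 : ((m i : ℤ) : ℝ) ≤ 2 * L := by exact_mod_cast h1.2
        have h3 : (0 : ℝ) ≤ (m i : ℤ) := by
          have : (0 : ℤ) ≤ m i := by omega
          exact_mod_cast this
        rwa [abs_of_nonneg h3]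

end Divergence

/-! ### Necessary conditions -/

section Necessity

variable {n N : ℕ} {φ : E n → ℂ} {p₁ p₂ q₁ q₂ : ℝ≥0∞} {s₁ s₂ σ : ℝ}

/-- The points of `F` are nonzero and at distance at least `5` from each other. -/
structure IsSparse (F : Finset (Fin n → ℤ)) : Prop where
  norm_ge : ∀ k ∈ F, 1 ≤ ‖latticePoint k‖
  separated : ∀ k ∈ F, ∀ k' ∈ F, k' ≠ k → 5 ≤ ‖latticePoint k - latticePoint k'‖

theorem ellNorm_ne_top_of_finite {q : ℝ≥0∞} (hq : 1 ≤ q) {F : Finset (Fin n → ℤ)}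
    {a : (Fin n → ℤ) → ℝ≥0∞} (ha : ∀ k, a k ≠ ⊤) (hF : ∀ k ∉ F, a k = 0) : ellNorm q a ≠ ⊤ := by
  refine ne_top_of_le_ne_top ?_ (ellNorm_antitone le_rfl hq a)
  rw [ellNorm_of_ne_top one_ne_zero ENNReal.one_ne_top]
  simp only [ENNReal.toReal_one, ENNReal.rpow_one, div_one]
  rw [tsum_eq_sum fun k hk => hF k hk]
  exact ENNReal.sum_ne_top.2 fun k _ => ha k

/-- Apply the bound to a superposition of packets, estimating the input norm from above and the
output norm from below. The dependence on b is kept explicit, with δ and C independent of b, so that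
the shape can still be varied. -/
theorem IsBoundedOnModulation.exists_ellNorm_le (hn : 1 ≤ n) (hσ : σ = 2 - ((n : ℝ) - 1) / 2 * N)
    (hφ : IsPartitionWindow φ) (hp₁ : 1 ≤ p₁) (hp₂ : 1 ≤ p₂) (hq₁ : 1 ≤ q₁) (hq₂ : 1 ≤ q₂)
    (h : IsBoundedOnModulation φ s₁ p₁ q₁ s₂ p₂ q₂ (laplacianIteratedAverage n N)) :
    ∃ (δ : ℝ) (C : ℝ≥0), 0 < δ ∧ ∀ (b : 𝓢(E n, ℂ)), IsBump δ b →
      ∀ F : Finset (Fin n → ℤ), IsSparse F → ∀ a : (Fin n → ℤ) → ℝ≥0, (∀ k ∉ F, a k = 0) →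
      ellNorm q₂ (weighted (s₂ + σ) fun k => a k) ≤
        C * ((ENNReal.ofReal (∫ w, ‖dilateTwoPi n b w‖ ^ 2))⁻¹ * packetNorm p₂.conjExponent b *
          packetNorm p₁ b) * ellNorm q₁ (weighted s₁ fun k => a k) := by
  obtain ⟨C, hC⟩ := h
  obtain ⟨c, δ, hc, hδ, hδ1, hlarge⟩ := exists_averageSymbol_large_point hn N hσ
  obtain ⟨L₁, C₁, hC₁, hup⟩ := exists_distLpNorm_box_packetSum_le hφ hp₁
  obtain ⟨L₂, hlow⟩ := exists_packetSum_le_distLpNorm_box hn N hφ hp₂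
  obtain ⟨D₁, hD₁, hshift₁⟩ := exists_ellNorm_weighted_sum_shift_le n L₁ s₁
  obtain ⟨D₂, hD₂, hshift₂⟩ := exists_ellNorm_weighted_sum_shift_le n L₂ s₂
  refine ⟨δ, (c / 2)⁻¹.toNNReal * D₂.toNNReal * C * C₁.toNNReal * D₁.toNNReal, hδ,
    fun b hb F hF a ha => ?_⟩
  -- The centres are chosen for all k at once; the value 0 where |k| < 1 is never used, because F is
  -- sparse.
  have hex : ∀ k : Fin n → ℤ, ∃ ξ : E n, 1 ≤ ‖latticePoint k‖ → ‖ξ - latticePoint k‖ ≤ 1 ∧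
      c * bracket k ^ σ ≤ ‖averageSymbol n N ξ‖ ∧ ∀ η, ‖η - ξ‖ ≤ δ →
        ‖averageSymbol n N η - averageSymbol n N ξ‖ ≤ ‖averageSymbol n N ξ‖ / 2 := by
    intro k
    by_cases hk : 1 ≤ ‖latticePoint k‖
    · obtain ⟨ξ, hξ⟩ := hlarge _ hk
      exact ⟨ξ, fun _ => hξ⟩
    · exact ⟨0, fun h => absurd h hk⟩
  choose ξ hξ using hex
  set f := packetSum b ξ F a with hf
  set I := ∫ w, ‖dilateTwoPi n b w‖ ^ 2 with hI
  have hI0 : 0 < I := hb.integral_pos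
  have hfnorm : modulationNorm φ s₁ p₁ q₁ f ≤
      ENNReal.ofReal C₁ * packetNorm p₁ b *
        (ENNReal.ofReal D₁ * ellNorm q₁ (weighted s₁ fun k => a k)) := by
    rw [modulationNorm_eq hq₁]
    refine (ellNorm_le_const_mul (c := ENNReal.ofReal C₁ * packetNorm p₁ b)
      (b := weighted s₁ fun k => ∑ l ∈ latticeCube n L₁, (a (k + l) : ℝ≥0∞)) fun k => ?_).trans ?_
    · rw [weighted, weighted, mul_left_comm]
      gcongr
      exact hup b (fun x hx => (hb.norm_le x hx).trans hδ1) ξ F a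
        (fun k hk => (hξ k (hF.norm_ge k hk)).1) k
    · gcongr
      exact hshift₁ q₁ hq₁ fun k => (a k : ℝ≥0∞)
  have hfin : ellNorm q₁ (weighted s₁ fun k => (a k : ℝ≥0∞)) ≠ ⊤ :=
    ellNorm_ne_top_of_finite hq₁ (F := F)
      (fun k => ENNReal.mul_ne_top ENNReal.ofReal_ne_top ENNReal.coe_ne_top)
      fun k hk => by rw [weighted, ha k hk, ENNReal.coe_zero, mul_zero]
  have hmem : f ∈ modulationSpace φ s₁ p₁ q₁ :=
    hfnorm.trans_lt (ENNReal.mul_lt_top (ENNReal.mul_lt_top ENNReal.ofReal_lt_top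
      (packetNorm_ne_top p₁ b).lt_top) (ENNReal.mul_lt_top ENNReal.ofReal_lt_top hfin.lt_top))
  have hTf := (hC f hmem).2
  set v : (Fin n → ℤ) → ℝ≥0∞ := fun k => distLpNorm p₂ (box φ k (laplacianIteratedAverage n N f))
    with hv
  rw [modulationNorm_eq hq₂] at hTf
  have hpt : ∀ k, weighted (s₂ + σ) (fun k => (a k : ℝ≥0∞)) k ≤
      ENNReal.ofReal (c / 2)⁻¹ * (ENNReal.ofReal I)⁻¹ * packetNorm p₂.conjExponent b *
        weighted s₂ (fun k => ∑ l ∈ latticeCube n L₂, v (k + l)) k := by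
    intro k
    by_cases hk : k ∈ F
    · have h1 := hlow b δ hδ1 hb.norm_le hb.eq_norm ξ F a
        (fun k hk => (hξ k (hF.norm_ge k hk)).1) hF.separated
        (fun k hk => (hξ k (hF.norm_ge k hk)).2.2) k hk
      have h2 := (hξ k (hF.norm_ge k hk)).2.1
      have hσ0 := bracket_rpow_pos k σ
      have h3 : ENNReal.ofReal (bracket k ^ σ) * a k ≤ ENNReal.ofReal (c / 2)⁻¹ *
          (ENNReal.ofReal I)⁻¹ * (ENNReal.ofReal (‖averageSymbol n N (ξ k)‖ / 2 * I) * a k) := by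
        rw [← mul_assoc, ← ENNReal.ofReal_inv_of_pos hI0, ← ENNReal.ofReal_mul (by positivity),
          ← ENNReal.ofReal_mul (by positivity)]
        gcongr
        have : (c / 2)⁻¹ * I⁻¹ * (c * bracket k ^ σ / 2 * I) = bracket k ^ σ := by field_simp
        rw [← this]
        gcongr
      calc weighted (s₂ + σ) (fun k => (a k : ℝ≥0∞)) k
          = ENNReal.ofReal (bracket k ^ s₂) * (ENNReal.ofReal (bracket k ^ σ) * a k) := by
            rw [← weighted_weighted]; rfl
        _ ≤ ENNReal.ofReal (bracket k ^ s₂) * (ENNReal.ofReal (c / 2)⁻¹ *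
              (ENNReal.ofReal I)⁻¹ * (packetNorm p₂.conjExponent b *
                ∑ l ∈ latticeCube n L₂, v (k + l))) := by
            refine mul_le_mul_right (h3.trans ?_) _
            exact mul_le_mul_right h1 _
        _ = _ := by rw [weighted]; ring
    · rw [weighted, ha k hk, ENNReal.coe_zero, mul_zero]
      exact zero_le
  calc ellNorm q₂ (weighted (s₂ + σ) fun k => (a k : ℝ≥0∞))
      ≤ ENNReal.ofReal (c / 2)⁻¹ * (ENNReal.ofReal I)⁻¹ * packetNorm p₂.conjExponent b *
        (ENNReal.ofReal D₂ * (C * (ENNReal.ofReal C₁ * packetNorm p₁ b *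
        (ENNReal.ofReal D₁ * ellNorm q₁ (weighted s₁ fun k => a k))))) := by
        refine (ellNorm_le_const_mul hpt).trans ?_
        gcongr
        refine (hshift₂ q₂ hq₂ v).trans ?_
        gcongr
        refine hTf.trans ?_
        gcongr
    _ = _ := by
        simp only [ENNReal.coe_mul, ENNReal.ofReal]
        ring

/-! ### Power sequences on finite sets as test sequences. -/

theorem ellNorm_weighted_ite {q : ℝ≥0∞} (hq : 1 ≤ q) (hq' : q ≠ ⊤) (F : Finset (Fin n → ℤ))
    [DecidablePred (· ∈ F)] (y : ℝ) :
    ellNorm q (fun k => if k ∈ F then ENNReal.ofReal (bracket k ^ (y * q⁻¹.toReal)) else 0) =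
      (∑ k ∈ F, ENNReal.ofReal (bracket k ^ y)) ^ q⁻¹.toReal := by
  have h0 : q ≠ 0 := (one_pos.trans_le hq).ne'
  have hpos : 0 < q.toReal := ENNReal.toReal_pos h0 hq'
  rw [ellNorm_of_ne_top h0 hq', ENNReal.toReal_inv, one_div, tsum_eq_sum (s := F)]
  · congr 1
    refine Finset.sum_congr rfl fun k hk => ?_
    rw [if_pos hk, ENNReal.ofReal_rpow_of_pos (bracket_rpow_pos k _),
      ← Real.rpow_mul (bracket_pos k).le, mul_assoc, inv_mul_cancel₀ hpos.ne', mul_one]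
  · intro k hk
    rw [if_neg hk, ENNReal.zero_rpow_of_pos hpos]

/-- At q = ∞ the exponent 1/q is 0 and the right side is 1, while the left side is 0 when F is
empty; hence only an inequality. -/
theorem ellNorm_weighted_ite_le {q : ℝ≥0∞} (hq : 1 ≤ q) (F : Finset (Fin n → ℤ))
    [DecidablePred (· ∈ F)] (y : ℝ) :
    ellNorm q (fun k => if k ∈ F then ENNReal.ofReal (bracket k ^ (y * q⁻¹.toReal)) else 0) ≤
      (∑ k ∈ F, ENNReal.ofReal (bracket k ^ y)) ^ q⁻¹.toReal := by
  rcases eq_or_ne q ⊤ with rfl | hq'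
  · rw [ellNorm_top]
    refine iSup_le fun k => ?_
    split_ifs <;> simp
  · exact (ellNorm_weighted_ite hq hq' F y).le

theorem weighted_ite (s x : ℝ) (F : Finset (Fin n → ℤ)) [DecidablePred (· ∈ F)] :
    weighted s (fun k => ((if k ∈ F then (bracket k ^ x).toNNReal else 0 : ℝ≥0) : ℝ≥0∞)) =
      fun k => if k ∈ F then ENNReal.ofReal (bracket k ^ (s + x)) else 0 := by
  ext k
  rw [weighted]
  split_ifs with h
  · rw [Real.rpow_add (bracket_pos k), ENNReal.ofReal_mul (bracket_rpow_pos k s).le]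
    rfl
  · simp

/-- The integer vector `(m, 0, …, 0)`. -/
def axisPoint (hn : 1 ≤ n) (m : ℤ) : Fin n → ℤ := Pi.single ⟨0, hn⟩ m

theorem norm_latticePoint_axisPoint (hn : 1 ≤ n) (m : ℤ) :
    ‖latticePoint (axisPoint hn m)‖ = |(m : ℝ)| := by
  have : latticePoint (axisPoint hn m) = EuclideanSpace.single ⟨0, hn⟩ (m : ℝ) := by
    ext i
    by_cases hi : i = ⟨0, hn⟩
    · subst hi; simp [latticePoint, axisPoint]
    · simp [latticePoint, axisPoint, hi]
  rw [this, PiLp.norm_single, Real.norm_eq_abs]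

theorem isSparse_singleton {k : Fin n → ℤ} (hk : 1 ≤ ‖latticePoint k‖) : IsSparse {k} where
  norm_ge k' hk' := by rwa [Finset.mem_singleton.1 hk']
  separated k' hk' k'' hk'' h :=
    absurd ((Finset.mem_singleton.1 hk'').trans (Finset.mem_singleton.1 hk').symm) h

/-- Keep one fixed amplitude at one frequency and dilate the bump. The constant in the sequence
inequality scales like R^{-e} with e = n(1/p₂ - 1/p₁), so if p₂ < p₁ it tends to 0 while the left
side is a fixed positive number. -/
theorem IsBoundedOnModulation.exponent_le (hn : 1 ≤ n)
    (hσ : σ = 2 - ((n : ℝ) - 1) / 2 * N)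
    (hφ : IsPartitionWindow φ) (hp₁ : 1 ≤ p₁) (hp₂ : 1 ≤ p₂) (hq₁ : 1 ≤ q₁) (hq₂ : 1 ≤ q₂)
    (h : IsBoundedOnModulation φ s₁ p₁ q₁ s₂ p₂ q₂ (laplacianIteratedAverage n N)) :
    p₁ ≤ p₂ := by
  classical
  obtain ⟨δ, C, hδ, hmain⟩ := h.exists_ellNorm_le hn hσ hφ hp₁ hp₂ hq₁ hq₂
  obtain ⟨b, hb⟩ := exists_isBump (n := n) hδ
  set k : Fin n → ℤ := axisPoint hn 1 with hk
  have hk1 : 1 ≤ ‖latticePoint k‖ := by rw [hk, norm_latticePoint_axisPoint]; simp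
  set a : (Fin n → ℤ) → ℝ≥0 := fun j => if j ∈ ({k} : Finset _) then (bracket j ^ (0 : ℝ)).toNNReal
    else 0 with ha
  have ha0 : ∀ j ∉ ({k} : Finset (Fin n → ℤ)), a j = 0 := fun j hj => if_neg hj
  set S₁ := ellNorm q₁ (weighted s₁ fun k => a k) with hS₁
  set S₂ := ellNorm q₂ (weighted (s₂ + σ) fun k => a k) with hS₂
  have hS₁t : S₁ ≠ ⊤ := ellNorm_ne_top_of_finite hq₁ (F := {k})
      (fun k => ENNReal.mul_ne_top ENNReal.ofReal_ne_top ENNReal.coe_ne_top)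
      fun k hk => by rw [weighted, ha0 k hk, ENNReal.coe_zero, mul_zero]
  have hS₂0 : S₂ ≠ 0 := by
    have h1 := apply_le_ellNorm hq₂ (weighted (s₂ + σ) fun k => (a k : ℝ≥0∞)) k
    refine ((ENNReal.ofReal_pos.2 (bracket_rpow_pos k (s₂ + σ + 0))).trans_le ?_).ne'
    refine le_of_eq_of_le ?_ h1
    rw [weighted_ite]
    exact (if_pos (Finset.mem_singleton_self k)).symm
  set I := ∫ w, ‖dilateTwoPi n b w‖ ^ 2 with hI
  have hI0 : 0 < I := hb.integral_pos
  set e : ℝ := n * (p₂⁻¹.toReal - p₁⁻¹.toReal) with he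
  set D : ℝ≥0∞ := C * ((ENNReal.ofReal I)⁻¹ * packetNorm p₂.conjExponent b * packetNorm p₁ b) * S₁
    with hD
  have hDt : D ≠ ⊤ := by
    refine ENNReal.mul_ne_top (ENNReal.mul_ne_top ENNReal.coe_ne_top (ENNReal.mul_ne_top
      (ENNReal.mul_ne_top ?_ (packetNorm_ne_top _ b)) (packetNorm_ne_top _ b))) hS₁t
    exact ENNReal.inv_ne_top.2 (by simpa using hI0)
  have hconj : p₂.conjExponent⁻¹.toReal = 1 - p₂⁻¹.toReal := by
    have : p₂.HolderConjugate p₂.conjExponent := ENNReal.HolderConjugate.conjExponent hp₂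
    have h1 := ENNReal.HolderConjugate.inv_add_inv_eq_one p₂ p₂.conjExponent
    have h2 := congrArg ENNReal.toReal h1
    rw [ENNReal.toReal_add, ENNReal.toReal_one] at h2
    · linarith
    · exact ENNReal.inv_ne_top.2 (one_pos.trans_le hp₂).ne'
    · intro h3
      rw [h3] at h1
      simp at h1
  -- The exponents n from the L² mass, n/p₂' - n and n/p₁ - n from the two packet norms add up to
  -- -e.
  have hR : ∀ R : ℝ, 1 ≤ R → S₂ ≤ D * ENNReal.ofReal (R ^ (-e)) := by
    intro R hR
    have hR0 : 0 < R := by linarith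
    have h1 := hmain _ (hb.dilateBump hR) {k} (isSparse_singleton hk1) a ha0
    rw [integral_norm_dilateBump_sq hR0, packetNorm_dilateBump _ hR0, packetNorm_dilateBump _ hR0,
      ← ENNReal.ofReal_inv_of_pos (by positivity), mul_inv, inv_inv,
      ENNReal.ofReal_mul (by positivity), ENNReal.ofReal_inv_of_pos hI0] at h1
    refine h1.trans_eq ?_
    have h2 : ENNReal.ofReal (R ^ (-e)) = ENNReal.ofReal (R ^ n) *
        ENNReal.ofReal (R ^ (n * p₂.conjExponent⁻¹.toReal - n)) *
        ENNReal.ofReal (R ^ (n * p₁⁻¹.toReal - n)) := by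
      rw [← ENNReal.ofReal_mul (by positivity), ← ENNReal.ofReal_mul (by positivity), 
        ← Real.rpow_natCast, ← Real.rpow_add hR0, ← Real.rpow_add hR0, hconj, he]
      congr 2
      ring
    rw [h2, hD]
    ring
  by_contra! hlt
  have hepos : 0 < e := by
    have hn' : (0 : ℝ) < n := by exact_mod_cast hn
    refine mul_pos hn' (sub_pos.2 ?_)
    refine (ENNReal.toReal_lt_toReal ?_ ?_).2 (ENNReal.inv_lt_inv.2 hlt)
    · exact ENNReal.inv_ne_top.2 (one_pos.trans_le hp₁).ne'
    · exact ENNReal.inv_ne_top.2 (one_pos.trans_le hp₂).ne'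
  have hlim : Filter.Tendsto (fun R : ℝ => D * ENNReal.ofReal (R ^ (-e))) Filter.atTop (nhds 0) := by
    have h1 := ENNReal.tendsto_ofReal (tendsto_rpow_neg_atTop hepos)
    have h2 := ENNReal.Tendsto.const_mul (a := D) h1 (Or.inr hDt)
    simpa using h2
  have := ge_of_tendsto hlim ((Filter.eventually_ge_atTop 1).mono hR)
  exact hS₂0 (le_antisymm this zero_le)

theorem IsBoundedOnModulation.exists_sequence_bound (hn : 1 ≤ n)
    (hσ : σ = 2 - ((n : ℝ) - 1) / 2 * N)
    (hφ : IsPartitionWindow φ) (hp₁ : 1 ≤ p₁) (hp₂ : 1 ≤ p₂) (hq₁ : 1 ≤ q₁) (hq₂ : 1 ≤ q₂)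
    (h : IsBoundedOnModulation φ s₁ p₁ q₁ s₂ p₂ q₂ (laplacianIteratedAverage n N)) :
    ∃ K : ℝ≥0∞, K ≠ ⊤ ∧ ∀ F : Finset (Fin n → ℤ), IsSparse F →
      ∀ a : (Fin n → ℤ) → ℝ≥0, (∀ k ∉ F, a k = 0) →
      ellNorm q₂ (weighted (s₂ + σ) fun k => a k) ≤ K * ellNorm q₁ (weighted s₁ fun k => a k) := by
  obtain ⟨δ, C, hδ, hmain⟩ := h.exists_ellNorm_le hn hσ hφ hp₁ hp₂ hq₁ hq₂
  obtain ⟨b, hb⟩ := exists_isBump (n := n) hδ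
  refine ⟨_, ?_, hmain b hb⟩
  refine ENNReal.mul_ne_top ENNReal.coe_ne_top (ENNReal.mul_ne_top
    (ENNReal.mul_ne_top ?_ (packetNorm_ne_top _ b)) (packetNorm_ne_top _ b))
  exact ENNReal.inv_ne_top.2 (by simpa using hb.integral_pos)

/-- Test with a single packet of amplitude ⟨k⟩^{-s₁} at k = (m, 0, …, 0): its weighted input norm is
at most 1, and the output grows at least like m^τ if τ = s₂ + σ - s₁ > 0. -/
theorem IsBoundedOnModulation.smoothness_le (hn : 1 ≤ n) (hσ : σ = 2 - ((n : ℝ) - 1) / 2 * N)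
    (hφ : IsPartitionWindow φ) (hp₁ : 1 ≤ p₁) (hp₂ : 1 ≤ p₂) (hq₁ : 1 ≤ q₁) (hq₂ : 1 ≤ q₂)
    (h : IsBoundedOnModulation φ s₁ p₁ q₁ s₂ p₂ q₂ (laplacianIteratedAverage n N)) :
    s₂ + σ ≤ s₁ := by
  classical
  obtain ⟨K, hK, hseq⟩ := h.exists_sequence_bound hn hσ hφ hp₁ hp₂ hq₁ hq₂
  set τ := s₂ + σ - s₁ with hτ
  by_contra! hlt
  have hτ0 : 0 < τ := sub_pos.2 hlt
  have hbound : ∀ m : ℕ, 1 ≤ m → ENNReal.ofReal ((m : ℝ) ^ τ) ≤ K := by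
    intro m hm
    set k : Fin n → ℤ := axisPoint hn m with hk
    have hnorm : ‖latticePoint k‖ = m := by rw [hk, norm_latticePoint_axisPoint]; simp
    have hk1 : 1 ≤ ‖latticePoint k‖ := by rw [hnorm]; exact_mod_cast hm
    have h1 := hseq {k} (isSparse_singleton hk1)
      (fun j => if j ∈ ({k} : Finset _) then (bracket j ^ (-s₁)).toNNReal else 0)
      (fun j hj => if_neg hj)
    rw [weighted_ite, weighted_ite] at h1
    have h2 := apply_le_ellNorm hq₂ (fun j => if j ∈ ({k} : Finset (Fin n → ℤ)) then
      ENNReal.ofReal (bracket j ^ (s₂ + σ + -s₁)) else 0) k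
    have h3 := ellNorm_weighted_ite_le hq₁ {k} (0 : ℝ)
    rw [zero_mul] at h3
    simp only [Finset.mem_singleton_self, if_true] at h2
    rw [add_neg_cancel] at h1
    simp only [Finset.sum_singleton, Real.rpow_zero, ENNReal.ofReal_one, ENNReal.one_rpow] at h1 h3
    calc ENNReal.ofReal ((m : ℝ) ^ τ) ≤ ENNReal.ofReal (bracket k ^ τ) := by
          gcongr
          rw [← hnorm]
          exact norm_le_japaneseBracket _
      _ ≤ _ := (h2.trans h1).trans (mul_le_of_le_one_right zero_le h3)
  have hlim := ENNReal.tendsto_ofReal_atTop.comp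
    ((tendsto_rpow_atTop hτ0).comp tendsto_natCast_atTop_atTop)
  have := le_of_tendsto hlim ((Filter.eventually_ge_atTop 1).mono hbound)
  exact hK (top_le_iff.1 this)

theorem latticePoint_five_mul (m : Fin n → ℤ) :
    latticePoint (fun i => 5 * m i) = (5 : ℝ) • latticePoint m := by
  ext i
  simp [latticePoint]

theorem one_le_norm_latticePoint {m : Fin n → ℤ} (hm : m ≠ 0) : 1 ≤ ‖latticePoint m‖ := by
  obtain ⟨i, hi⟩ := Function.ne_iff.1 hm
  refine le_trans ?_ (PiLp.norm_apply_le (latticePoint m) i)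
  simp only [latticePoint, Real.norm_eq_abs]
  exact_mod_cast Int.one_le_abs hi

/-- Testing on extremizers of Hölder's inequality bounds the sums of ⟨k⟩^{-τ r} over sparse sets,
where 1/r = 1/q₂ - 1/q₁. Summability over ℤⁿ follows and forces τ r > n, which is the strict
inequality. -/
theorem IsBoundedOnModulation.gap_lt (hn : 1 ≤ n) (hσ : σ = 2 - ((n : ℝ) - 1) / 2 * N)
    (hφ : IsPartitionWindow φ) (hp₁ : 1 ≤ p₁) (hp₂ : 1 ≤ p₂) (hq₂ : 1 ≤ q₂) (hq : q₂ < q₁)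
    (h : IsBoundedOnModulation φ s₁ p₁ q₁ s₂ p₂ q₂ (laplacianIteratedAverage n N)) :
    s₂ + σ + n * q₂⁻¹.toReal < s₁ + n * q₁⁻¹.toReal := by
  classical
  have hq₁ : 1 ≤ q₁ := hq₂.trans hq.le
  obtain ⟨K, hK, hseq⟩ := h.exists_sequence_bound hn hσ hφ hp₁ hp₂ hq₁ hq₂
  set τ := s₁ - (s₂ + σ) with hτ
  set r := (gapExponent q₁ q₂).toReal with hr
  have hr0 : 0 < r := gapExponent_toReal_pos hq₂ hq
  have hrinv : r⁻¹ = q₂⁻¹.toReal - q₁⁻¹.toReal := inv_toReal_gapExponent hq₂ hq.le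
  have hsum : ∀ F : Finset (Fin n → ℤ), IsSparse F →
      ∑ k ∈ F, ENNReal.ofReal (bracket k ^ (-(τ * r))) ≤ K ^ r := by
    intro F hF
    set S := ∑ k ∈ F, ENNReal.ofReal (bracket k ^ (-(τ * r))) with hS
    have hSt : S ≠ ⊤ := ENNReal.sum_ne_top.2 fun k _ => ENNReal.ofReal_ne_top
    rcases eq_or_ne S 0 with h0 | h0
    · rw [h0]; exact zero_le
    -- With this exponent both weighted sequences become powers of ⟨k⟩^{-τ r}, namely 1/q₁ and 1/q₂.
    -- The inequality reads S^{1/q₂} ≤ K S^{1/q₁}, that is, S^{1/r} ≤ K.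
    have h1 := hseq F hF (fun j => if j ∈ F then
      (bracket j ^ (-s₁ + -(τ * r) * q₁⁻¹.toReal)).toNNReal else 0) (fun j hj => if_neg hj)
    have e1 : s₁ + (-s₁ + -(τ * r) * q₁⁻¹.toReal) = -(τ * r) * q₁⁻¹.toReal := by ring
    have e2 : s₂ + σ + (-s₁ + -(τ * r) * q₁⁻¹.toReal) = -(τ * r) * q₂⁻¹.toReal := by
      have : q₂⁻¹.toReal = r⁻¹ + q₁⁻¹.toReal := by rw [hrinv]; ring
      rw [this, hτ]
      field_simp
      ring
    rw [weighted_ite, weighted_ite, e1, e2, ellNorm_weighted_ite hq₂ (hq.trans_le le_top).ne] at h1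
    have h2 : S ^ q₂⁻¹.toReal ≤ K * S ^ q₁⁻¹.toReal :=
      h1.trans (by gcongr; exact ellNorm_weighted_ite_le hq₁ F _)
    have h3 : S ^ r⁻¹ ≤ K := by
      rw [hrinv, ENNReal.rpow_sub _ _ h0 hSt]
      exact ENNReal.div_le_of_le_mul h2
    calc S = (S ^ r⁻¹) ^ r := by rw [← ENNReal.rpow_mul, inv_mul_cancel₀ hr0.ne', ENNReal.rpow_one]
      _ ≤ K ^ r := by gcongr
  have hKr : K ^ r ≠ ⊤ := ENNReal.rpow_ne_top_of_nonneg hr0.le hK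
  -- Distinct points of 5ℤⁿ are at distance at least 5, so finite subsets of 5ℤⁿ without the origin
  -- are sparse.
  have hsummable : Summable fun m : {m : Fin n → ℤ // m ≠ 0} =>
      bracket (fun i => 5 * m.1 i) ^ (-(τ * r)) := by
    refine summable_of_sum_le (c := (K ^ r).toReal)
      (fun m => (bracket_rpow_pos _ _).le) fun G => ?_
    have hinj : Function.Injective
        fun (m : {m : Fin n → ℤ // m ≠ 0}) (i : Fin n) => 5 * m.1 i := by
      intro m m' hmm
      ext i
      have := congrFun hmm i
      simp only at this
      omega
    have hsp : IsSparse (G.image fun m i => 5 * m.1 i) := by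
      refine ⟨fun k hk => ?_, fun k hk k' hk' hne => ?_⟩
      · obtain ⟨m, -, rfl⟩ := Finset.mem_image.1 hk
        rw [latticePoint_five_mul, norm_smul]
        have := one_le_norm_latticePoint m.2
        norm_num
        linarith
      · obtain ⟨m, -, rfl⟩ := Finset.mem_image.1 hk
        obtain ⟨m', -, rfl⟩ := Finset.mem_image.1 hk'
        rw [latticePoint_five_mul, latticePoint_five_mul, ← smul_sub, norm_smul,
          ← latticePoint_sub]
        have hmm : m.1 - m'.1 ≠ 0 := fun h0 => hne (by rw [sub_eq_zero.1 h0])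
        have := one_le_norm_latticePoint hmm
        norm_num
        linarith
    have h1 := hsum _ hsp
    rw [Finset.sum_image fun x _ y _ hxy => hinj hxy,
      ← ENNReal.ofReal_sum_of_nonneg fun m _ => (bracket_rpow_pos _ _).le] at h1
    exact (ENNReal.ofReal_le_iff_le_toReal hKr).1 h1
  -- The sign of τ r is not yet known, so both ⟨m⟩ ≤ ⟨5m⟩ and ⟨5m⟩ ≤ 5⟨m⟩ are needed.
  have hcomp : Summable fun m : {m : Fin n → ℤ // m ≠ 0} => bracket m.1 ^ (-(τ * r)) := by
    refine (hsummable.mul_left (5 ^ |τ * r|)).of_nonneg_of_le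
      (fun m => (bracket_rpow_pos _ _).le) fun m => ?_
    have h1 : bracket m.1 ≤ bracket fun i => 5 * m.1 i := by
      rw [bracket, bracket, latticePoint_five_mul, norm_smul]
      refine Real.sqrt_le_sqrt ?_
      norm_num
      nlinarith [sq_nonneg ‖latticePoint m.1‖]
    have h2 : (bracket fun i => 5 * m.1 i) ≤ 5 * bracket m.1 := by
      have h3 : bracket m.1 ^ 2 = 1 + ‖latticePoint m.1‖ ^ 2 := Real.sq_sqrt (by positivity)
      have h4 := bracket_pos m.1
      rw [bracket, latticePoint_five_mul, norm_smul, Real.sqrt_le_left (by positivity), mul_pow,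
        mul_pow, h3]
      norm_num
      linarith
    have hp := bracket_pos m.1
    have hp5 := bracket_pos fun i => 5 * m.1 i
    rcases le_total 0 (τ * r) with ht | ht
    · rw [abs_of_nonneg ht, Real.rpow_neg hp.le, Real.rpow_neg hp5.le, ← div_eq_mul_inv,
        le_div_iff₀ (by positivity), inv_mul_le_iff₀ (by positivity),
        mul_comm (bracket m.1 ^ (τ * r)), ← Real.mul_rpow (by norm_num) hp.le]
      exact Real.rpow_le_rpow hp5.le h2 ht
    · refine (Real.rpow_le_rpow hp.le h1 (by linarith)).trans
        (le_mul_of_one_le_left (by positivity) ?_)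
      exact Real.one_le_rpow (by norm_num) (abs_nonneg _)
  have hfull : Summable fun m : Fin n → ℤ => bracket m ^ (-(τ * r)) := by
    refine (Set.Finite.summable_compl_iff (s := {0}) (Set.finite_singleton 0)).1 ?_
    exact hcomp
  have hlt := lt_of_summable_bracket_rpow hn hfull
  have h4 : (n : ℝ) * r⁻¹ < τ := by
    rw [← div_eq_mul_inv, div_lt_iff₀ hr0]; exact hlt
  rw [hrinv, hτ] at h4
  linarith

end Necessity

end SphericalModulation

end

/-! ### The characterization of boundedness. -/

theorem theorem1p1 (n N : ℕ) (hn : 2 ≤ n) (hN : 1 ≤ N)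
    (φ : SphericalModulation.E n → ℂ) (hφ : SphericalModulation.IsPartitionWindow φ)
    (p₁ p₂ q₁ q₂ : ℝ≥0∞) (hp₁ : 1 ≤ p₁) (hp₂ : 1 ≤ p₂) (hq₁ : 1 ≤ q₁) (hq₂ : 1 ≤ q₂)
    (s₁ s₂ σ : ℝ) (hσ : σ = 2 - ((n : ℝ) - 1) / 2 * N) :
    (q₁ ≤ q₂ →
      (SphericalModulation.IsBoundedOnModulation φ s₁ p₁ q₁ s₂ p₂ q₂
          (SphericalModulation.laplacianIteratedAverage n N) ↔
        p₁ ≤ p₂ ∧ s₁ ≥ s₂ + σ)) ∧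
    (q₁ > q₂ →
      (SphericalModulation.IsBoundedOnModulation φ s₁ p₁ q₁ s₂ p₂ q₂
          (SphericalModulation.laplacianIteratedAverage n N) ↔
        p₁ ≤ p₂ ∧ s₁ + n * (q₁⁻¹).toReal > s₂ + σ + n * (q₂⁻¹).toReal)) := by
  have hn1 : 1 ≤ n := by omega
  refine ⟨fun hq => ⟨fun h => ⟨?_, ?_⟩, fun h => ?_⟩, fun hq => ⟨fun h => ⟨?_, ?_⟩, fun h => ?_⟩⟩
  · exact h.exponent_le hn1 hσ hφ hp₁ hp₂ hq₁ hq₂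
  · exact h.smoothness_le hn1 hσ hφ hp₁ hp₂ hq₁ hq₂
  · exact SphericalModulation.isBoundedOnModulation_of_le hn1 N hφ hp₁ h.1 hq₁ hq hσ h.2
  · exact h.exponent_le hn1 hσ hφ hp₁ hp₂ hq₁ hq₂
  · exact h.gap_lt hn1 hσ hφ hp₁ hp₂ hq₂ hq
  · exact SphericalModulation.isBoundedOnModulation_of_gap hn1 N hφ hp₁ h.1 hq₂ hq hσ h.2
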